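/- **Definitions.** An *embedded cycle* in a metric space is the image of an injective continuous map from the unit circle. An *$\mathbb{R}$-tree* is a geodesic metric space with no embedded cycle. An *$\mathbb{R}$-graph* is a compact geodesic metric space $(X,d)$ such that every $x\in X$ has an open ball $(B_\epsilon(x),d)$, $\epsilon>0$, which is an $\mathbb{R}$-tree; the *degree* $\deg_X(x)$ is then the number of connected components of $B_\epsilon(x)\setminus\{x\}$, which does not depend on the choice of such an $\epsilon$. The *core* of $X$ is the union of all simple arcs having both endpoints in embedded cycles of $X$; if non-empty it is itself an $\mathbb{R}$-graph. Its *kernel* has vertex set $k(X)$, the points of degree at least $3$ in $\mathrm{core}(X)$, and edge set $e(X)$, the closures of the connected components of $\mathrm{core}(X)\setminus k(X)$ (so that if the core is a cycle, then $k(X)=\varnothing$ and this cycle is the only edge); $\ell(e)$ is the length of the edge $e$. The *surplus* is $s(X)=|e(X)|-|k(X)|+1$ if $k(X)\ne\varnothing$, while $s(X)=1$ if the core is a cycle and $s(X)=0$ if $X$ is an $\mathbb{R}$-tree. A *measured $\mathbb{R}$-graph* $(X,d,\mu)$ is an $\mathbb{R}$-graph with a finite Borel measure. With a marked point $x\in X$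 it is *safely pointed* if $x\in\mathrm{core}(X)$, $X\setminus\{x\}$ is connected, $\deg_X(x)=2$ and $\mu(\{x\})=0$. For $r\in(0,1)$, let $\mathcal A_r^\bullet$ be the class of safely pointed measured $\mathbb{R}$-graphs $(X,d,x,\mu)$ such that $s(X)\le 1/r$, $\ell(e)\ge r$ for every $e\in e(X)$, and $\sum_{e\in e(X)}\ell(e)\le 1/r$. If $(X,d,x,\mu)$ is safely pointed, the *cut space* $(X_x,d_x)$ is the metric completion of $X\setminus\{x\}$ for the intrinsic distance, in which the distance from $y$ to $z$ is the infimum of the lengths of the paths from $y$ to $z$ in $X$ that do not visit $x$. It carries the image of $\mu|_{X\setminus\{x\}}$ under $X\setminus\{x\}\to X_x$, still denoted by $\mu$. For metric spaces $(X,d),(X',d')$ with finite Borel measures $\mu,\mu'$, let $$\mathrm{d}_{\mathrm{GHP}}\big((X,d,\mu),(X',d',\mu')\big)=\inf_{C,\pi}\ \max\Big\{\tfrac12\mathrm{dis}(C),\ \|\mu-p_*\pi\|+\|\mu'-p'_*\pi\|,\ \pi(C^c)\Big\},$$ where $C$ ranges over the correspondences between $X$ and $X'$ (measurable subsets of $X\times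 X'$ projecting onto both $X$ and $X'$), $\pi$ ranges over the finite Borel measures on $X\times X'$, $\mathrm{dis}(C)=\sup\{|d(y,z)-d'(y',z')|:(y,y'),(z,z')\in C\}$, $p,p'$ are the projections from $X\times X'$ to $X$ and $X'$, and $\|\cdot\|$ is the total variation norm of a signed measure. For marked points $x\in X$, $x'\in X'$, the distance $\mathrm{d}_{\mathrm{GHP}}^{1,1}((X,d,x,\mu),(X',d',x',\mu'))$ is defined by the same formula, with $C$ restricted to the correspondences that contain $(x,x')$. **Theorem.** Fix $r\in(0,1)$. Let $(X^n,d^n,x^n,\mu^n)$, $n\ge 1$, and $(X,d,x,\mu)$ be elements of $\mathcal A_r^\bullet$ (in particular $\mu^n(\{x^n\})=\mu(\{x\})=0$ for every $n$), and suppose that $$\mathrm{d}_{\mathrm{GHP}}^{1,1}\big((X^n,d^n,x^n,\mu^n),(X,d,x,\mu)\big)\to 0\qquad (n\to\infty).$$ Then $$\mathrm{d}_{\mathrm{GHP}}\big((X^n_{x^n},d^n_{x^n},\mu^n),(X_x,d_x,\mu)\big)\to 0\qquad (n\to\infty).$$ -/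

import Mathlib

open MeasureTheory Filter Topology Set
open scoped ENNReal unitInterval

namespace RGraphs

universe u v

section MetricNotions

variable (X : Type u) [MetricSpace X]

/-- Any two points are joined by a geodesic, i.e. by an isometric embedding of a segment. -/
def IsGeodesicSpace : Prop :=
  ∀ a b : X, ∃ f : ℝ → X, f 0 = a ∧ f (dist a b) = b ∧
    ∀ s ∈ Icc 0 (dist a b), ∀ t ∈ Icc 0 (dist a b), dist (f s) (f t) = |s - t|

variable {X} in
/-- An embedded cycle: the image of an injective continuous map from the unit circle. -/
def IsEmbeddedCycle (c : Set X) : Prop :=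
  ∃ f : Circle → X, Continuous f ∧ Function.Injective f ∧ range f = c

/-- An `ℝ`-tree: a geodesic metric space without embedded cycles. -/
structure IsRTree : Prop where
  geodesic : IsGeodesicSpace X
  acyclic : ∀ c : Set X, ¬ IsEmbeddedCycle c

/-- An `ℝ`-graph: a compact geodesic metric space in which every point is the centre of an open
ball of positive radius that is an `ℝ`-tree for the restricted distance. -/
structure IsRGraph : Prop where
  compact : CompactSpace X
  geodesic : IsGeodesicSpace X
  locally_tree : ∀ x : X, ∃ ε : ℝ, 0 < ε ∧ IsRTree (Metric.ball x ε)

/-- The length of a continuous path, the supremum of the sums `∑ d(f(tᵢ₋₁), f(tᵢ))`. -/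
noncomputable def len (f : I → X) : ℝ≥0∞ := eVariationOn f univ

variable {X}

/-- The degree of a point of an `ℝ`-graph: the number of connected components of
`B_ε(x) \ {x}`, where `B_ε(x)` is an `ℝ`-tree. This number is the same for all such `ε`, so the
supremum is over a constant family. -/
noncomputable def degree (x : X) : ℕ∞ :=
  ⨆ (ε : ℝ) (_ : 0 < ε) (_ : IsRTree (Metric.ball x ε)),
    ENat.card (ConnectedComponents ↥(Metric.ball x ε \ {x}))

variable (X)

/-- The core: the union of all simple arcs with both endpoints in embedded cycles. -/
def core : Set X :=
  {z | ∃ f : I → X, Continuous f ∧ Function.Injective f ∧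
    (∃ c, IsEmbeddedCycle c ∧ f 0 ∈ c) ∧ (∃ c, IsEmbeddedCycle c ∧ f 1 ∈ c) ∧ z ∈ range f}

/-- The points of the core whose removal does not disconnect the space. -/
def conn : Set X := {x | x ∈ core X ∧ IsConnected ({x}ᶜ : Set X)}

end MetricNotions

section Kernel

/-- The vertices of the kernel of an `ℝ`-graph `Z` without leaves: the points of degree at
least three. -/
def kernelVertices (Z : Type u) [MetricSpace Z] : Set Z := {z | 3 ≤ degree z}

/-- The edges of the kernel of an `ℝ`-graph `Z` without leaves: the closures of the connected
components of the complement of the set of vertices. If `Z` is a cycle, there are no vertices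
and `Z` itself is the only edge. -/
def kernelEdges (Z : Type u) [MetricSpace Z] : Set (Set Z) :=
  {e | ∃ z ∈ (kernelVertices Z)ᶜ, e = closure (connectedComponentIn (kernelVertices Z)ᶜ z)}

/-- The length of a kernel edge, i.e. the length of a parametrisation `γ : [0,1] → Z` of it that
is injective on `[0,1)`. All these parametrisations have the same length. -/
noncomputable def edgeLength {Z : Type u} [MetricSpace Z] (e : Set Z) : ℝ≥0∞ :=
  ⨅ (γ : I → Z) (_ : Continuous γ) (_ : InjOn γ {t | t ≠ 1}) (_ : range γ = e), len Z γ

open Classical in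
/-- The surplus of an `ℝ`-graph: `|E| - |V| + 1` for its kernel `(V, E)`, the kernel of its core,
when the kernel has a vertex; otherwise `1` if the core is a cycle, and `0` for an `ℝ`-tree,
whose core is empty. The kernel of an `ℝ`-graph is finite. -/
noncomputable def surplus (X : Type u) [MetricSpace X] : ℤ :=
  if core X = ∅ then 0
  else if kernelVertices (core X) = ∅ then 1
  else ((kernelEdges (core X)).ncard : ℤ) - (kernelVertices (core X)).ncard + 1

/-- The condition defining the class `𝒜_r` of `ℝ`-graphs: surplus at most `1/r`, all kernel edges
of length at least `r`, total length of the kernel edges at most `1/r`. -/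
structure IsElliptic (r : ℝ) (X : Type u) [MetricSpace X] : Prop where
  isRGraph : IsRGraph X
  surplus_le : (surplus X : ℝ) ≤ 1 / r
  le_edgeLength : ∀ e ∈ kernelEdges (core X), ENNReal.ofReal r ≤ edgeLength e
  sum_edgeLength_le :
    ∑' e : kernelEdges (core X), edgeLength (e : Set (core X)) ≤ ENNReal.ofReal (1 / r)

end Kernel

/-- `(X, d, x, μ)` is safely pointed: `X` is an `ℝ`-graph and `x` is a point of degree `2` in
`conn X` that is not an atom of `μ`. -/
structure IsSafelyPointed {X : Type u} [MetricSpace X] [MeasurableSpace X]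
    (x : X) (μ : Measure X) : Prop where
  isRGraph : IsRGraph X
  mem_conn : x ∈ conn X
  degree_eq : degree x = 2
  measure_eq_zero : μ {x} = 0

section Cut

variable {X : Type u} [MetricSpace X]

/-- The intrinsic distance on `X \ {x}`: the infimum of the lengths of the paths from `y` to `z`
that do not visit `x`. -/
noncomputable def puncturedEDist (x : X) (y z : {y : X // y ≠ x}) : ℝ≥0∞ :=
  ⨅ (f : Path (y : X) z) (_ : ∀ t, f t ≠ x), len X f

theorem edist_le_puncturedEDist (x : X) (y z : {y : X // y ≠ x}) :
    edist (y : X) z ≤ puncturedEDist x y z := by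
  refine le_iInf fun f => le_iInf fun _ => ?_
  have h := eVariationOn.edist_le (f : I → X) (s := univ) (mem_univ 0) (mem_univ 1)
  simpa [len] using h

theorem puncturedEDist_le_of_geodesic (hX : IsGeodesicSpace X) {x : X} (y z : {y : X // y ≠ x})
    (h : dist (y : X) z < dist (y : X) x) : puncturedEDist x y z ≤ edist (y : X) z := by
  obtain ⟨f, f0, f1, hf⟩ := hX y z
  set D := dist (y : X) z with hD
  have D0 : 0 ≤ D := dist_nonneg
  have hmem : ∀ t : I, (t : ℝ) * D ∈ Icc 0 D := fun t =>
    ⟨mul_nonneg t.2.1 D0, mul_le_of_le_one_left D0 t.2.2⟩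
  have hL : LipschitzOnWith 1 f (Icc 0 D) :=
    LipschitzOnWith.of_dist_le_mul fun s hs t ht => by simp [hf s hs t ht, Real.dist_eq]
  have hc : Continuous fun t : I => f ((t : ℝ) * D) :=
    hL.continuousOn.comp_continuous (by fun_prop) hmem
  let γ : Path (y : X) z := ⟨⟨fun t => f ((t : ℝ) * D), hc⟩, by simp [f0], by simp [f1]⟩
  have hγ : ∀ t, γ t ≠ x := by
    intro t ht
    have h1 : dist (f 0) (f ((t : ℝ) * D)) = |0 - (t : ℝ) * D| :=
      hf 0 ⟨le_rfl, D0⟩ _ (hmem t)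
    have h2 : f ((t : ℝ) * D) = x := ht
    rw [f0, h2, zero_sub, abs_neg, abs_of_nonneg (hmem t).1] at h1
    have := (hmem t).2
    linarith
  refine (iInf₂_le γ hγ).trans ?_
  have e1 : eVariationOn (f ∘ fun t : I => (t : ℝ) * D) univ ≤ eVariationOn f (Icc 0 D) :=
    eVariationOn.comp_le_of_monotoneOn f (fun t : I => (t : ℝ) * D)
      (fun s _ t _ hst => mul_le_mul_of_nonneg_right (by exact_mod_cast hst) D0)
      (fun t _ => hmem t)
  have e2 : eVariationOn (f ∘ id) (Icc 0 D) ≤ (1 : NNReal) * eVariationOn (id : ℝ → ℝ) (Icc 0 D) :=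
    hL.comp_eVariationOn_le (fun t ht => ht)
  have e4 : edist (y : X) z = ENNReal.ofReal D := by rw [edist_dist]
  rw [e4]
  refine e1.trans (le_trans e2 ?_)
  simp

theorem puncturedEDist_self (x : X) (y : {y : X // y ≠ x}) : puncturedEDist x y y = 0 := by
  refine le_antisymm ((iInf₂_le (Path.refl (y : X)) (fun _ => y.2)).trans ?_) zero_le
  refine le_of_eq (eVariationOn.constant_on (f := (Path.refl (y : X) : I → X)) ?_)
  rintro _ ⟨s, _, rfl⟩ _ ⟨t, _, rfl⟩
  simp

theorem puncturedEDist_comm_le (x : X) (y z : {y : X // y ≠ x}) :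
    puncturedEDist x y z ≤ puncturedEDist x z y := by
  refine le_iInf fun f => le_iInf fun hf => ?_
  refine (iInf₂_le f.symm (fun t => hf _)).trans ?_
  exact eVariationOn.comp_le_of_antitoneOn (f : I → X) unitInterval.symm
    (fun s _ t _ hst => unitInterval.symm_le_symm.2 hst) (fun t _ => mem_univ _)

theorem len_trans_le {a b c : X} (f : Path a b) (g : Path b c) :
    len X (f.trans g) ≤ len X f + len X g := by
  let m : I := ⟨1 / 2, by norm_num, by norm_num⟩
  have hu : (univ : Set I) = Iic m ∪ Ici m := Iic_union_Ici.symm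
  unfold len
  rw [hu, eVariationOn.union (f.trans g) (x := m) isGreatest_Iic isLeast_Ici]
  gcongr
  · have h1 : EqOn (f.trans g) (f ∘ fun t : I => projIcc (0 : ℝ) 1 zero_le_one (2 * (t : ℝ)))
        (Iic m) := by
      intro t ht
      have ht' : (t : ℝ) ≤ 1 / 2 := ht
      have h2 : (f.trans g) t = if (t : ℝ) ≤ 1 / 2 then f.extend (2 * t) else g.extend (2 * t - 1) :=
        rfl
      rw [h2, if_pos ht']
      rfl
    rw [eVariationOn.congr h1, ← hu]
    refine eVariationOn.comp_le_of_monotoneOn _ _ ?_ (fun t _ => mem_univ _)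
    intro s _ t _ hst
    exact monotone_projIcc _ (by have : (s : ℝ) ≤ t := hst; linarith)
  · have h1 : EqOn (f.trans g) (g ∘ fun t : I => projIcc (0 : ℝ) 1 zero_le_one (2 * (t : ℝ) - 1))
        (Ici m) := by
      intro t ht
      have ht' : 1 / 2 ≤ (t : ℝ) := ht
      have h2 : (f.trans g) t = if (t : ℝ) ≤ 1 / 2 then f.extend (2 * t) else g.extend (2 * t - 1) :=
        rfl
      have h3 : (g ∘ fun t : I => projIcc (0 : ℝ) 1 zero_le_one (2 * (t : ℝ) - 1)) t =
        g.extend (2 * t - 1) := rfl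
      rw [h2, h3]
      rcases ht'.eq_or_lt with h | h
      · rw [← h]; norm_num
      · rw [if_neg (not_le.2 h)]
    rw [eVariationOn.congr h1, ← hu]
    refine eVariationOn.comp_le_of_monotoneOn _ _ ?_ (fun t _ => mem_univ _)
    intro s _ t _ hst
    exact monotone_projIcc _ (by have : (s : ℝ) ≤ t := hst; linarith)

theorem puncturedEDist_triangle (x : X) (y z w : {y : X // y ≠ x}) :
    puncturedEDist x y w ≤ puncturedEDist x y z + puncturedEDist x z w := by
  unfold puncturedEDist
  simp only [ENNReal.iInf_add, ENNReal.add_iInf]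
  refine le_iInf fun g => le_iInf fun hg => le_iInf fun f => le_iInf fun hf => ?_
  refine (iInf₂_le (f.trans g) ?_).trans (len_trans_le f g)
  intro t
  rw [Path.trans_apply]
  split_ifs
  · exact hf _
  · exact hg _

/-- In an `ℝ`-graph, the intrinsic distance on the complement of a non-disconnecting point is
finite. -/
theorem puncturedEDist_ne_top (hX : IsRGraph X) {x : X} (hx : x ∈ conn X)
    (y z : {y : X // y ≠ x}) : puncturedEDist x y z ≠ ⊤ := by
  have : ConnectedSpace {y : X // y ≠ x} := isConnected_iff_connectedSpace.1 hx.2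
  have key : ∀ w w' : {y : X // y ≠ x}, dist (w : X) w' < dist (w : X) x →
      puncturedEDist x w w' ≠ ⊤ := fun w w' h =>
    ((puncturedEDist_le_of_geodesic hX.geodesic w w' h).trans_lt (edist_lt_top _ _)).ne
  have hpos : ∀ w : {y : X // y ≠ x}, 0 < dist (w : X) x := fun w => dist_pos.2 w.2
  have hcl : IsClopen {w | puncturedEDist x y w ≠ ⊤} := by
    constructor
    · rw [← isOpen_compl_iff, Metric.isOpen_iff]
      intro w hw
      refine ⟨dist (w : X) x, hpos w, fun w' hw' => ?_⟩
      simp only [mem_compl_iff, mem_ofPred_eq, not_not] at hw ⊢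
      by_contra hne
      have h1 : puncturedEDist x w' w ≠ ⊤ := fun h => key w w' (by
        rw [dist_comm]; exact hw') (top_le_iff.1 (h ▸ puncturedEDist_comm_le x w' w))
      exact ENNReal.add_ne_top.2 ⟨hne, h1⟩
        (top_le_iff.1 (hw ▸ puncturedEDist_triangle x y w' w))
    · rw [Metric.isOpen_iff]
      intro w hw
      refine ⟨dist (w : X) x, hpos w, fun w' hw' => ?_⟩
      have h1 := key w w' (by rw [dist_comm]; exact hw')
      intro h
      exact ENNReal.add_ne_top.2 ⟨hw, h1⟩
        (top_le_iff.1 (h ▸ puncturedEDist_triangle x y w w'))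
  have hun := hcl.eq_univ ⟨y, by simp [puncturedEDist_self]⟩
  have hz : z ∈ {w | puncturedEDist x y w ≠ ⊤} := hun ▸ mem_univ z
  exact hz

/-- The set `X \ {x}`, to be endowed with its intrinsic distance. -/
def PuncturedSpace {x : X} (_hX : IsRGraph X) (_hx : x ∈ conn X) : Type u := {y : X // y ≠ x}

noncomputable instance {x : X} (hX : IsRGraph X) (hx : x ∈ conn X) :
    MetricSpace (PuncturedSpace hX hx) :=
  letI : EMetricSpace (PuncturedSpace hX hx) :=
    { edist := puncturedEDist x
      edist_self := puncturedEDist_self x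
      edist_comm := fun y z =>
        le_antisymm (puncturedEDist_comm_le x y z) (puncturedEDist_comm_le x z y)
      edist_triangle := puncturedEDist_triangle x
      eq_of_edist_eq_zero := fun {y z} h => Subtype.ext <| edist_le_zero.1 <|
        (edist_le_puncturedEDist x y z).trans (le_of_eq h) }
  EMetricSpace.toMetricSpace (puncturedEDist_ne_top hX hx)

/-- The `ℝ`-graph `X` cut at `x`: the metric completion of `X \ {x}` with its intrinsic
distance. -/
def CutSpace {x : X} (hX : IsRGraph X) (hx : x ∈ conn X) : Type u :=
  UniformSpace.Completion (PuncturedSpace hX hx)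

noncomputable instance {x : X} (hX : IsRGraph X) (hx : x ∈ conn X) :
    MetricSpace (CutSpace hX hx) :=
  inferInstanceAs (MetricSpace (UniformSpace.Completion (PuncturedSpace hX hx)))

noncomputable instance {x : X} (hX : IsRGraph X) (hx : x ∈ conn X) :
    MeasurableSpace (CutSpace hX hx) := borel _

instance {x : X} (hX : IsRGraph X) (hx : x ∈ conn X) : BorelSpace (CutSpace hX hx) := ⟨rfl⟩

/-- The canonical map `X \ {x} → X_x`. -/
noncomputable def toCut {x : X} (hX : IsRGraph X) (hx : x ∈ conn X) (y : {y : X // y ≠ x}) :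
    CutSpace hX hx :=
  ((show PuncturedSpace hX hx from y : PuncturedSpace hX hx) :
    UniformSpace.Completion (PuncturedSpace hX hx))

/-- The canonical map `X \ {x} → X_x` is continuous for the topology of `X` (hence Borel, so that
the push-forward below is a genuine one). -/
theorem continuous_toCut {x : X} (hX : IsRGraph X) (hx : x ∈ conn X) :
    Continuous (toCut hX hx) := by
  refine (UniformSpace.Completion.continuous_coe (PuncturedSpace hX hx)).comp
    (f := fun y : {y : X // y ≠ x} => (show PuncturedSpace hX hx from y)) ?_
  rw [continuous_iff_continuousAt]
  intro y
  rw [ContinuousAt, EMetric.tendsto_nhds]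
  intro ε hε
  have h1 : ∀ᶠ z in 𝓝 y, edist z y < ε := Metric.eball_mem_nhds y hε
  have h2 : ∀ᶠ z in 𝓝 y, dist z y < dist (y : X) x := Metric.ball_mem_nhds y (dist_pos.2 y.2)
  filter_upwards [h1, h2] with z hz1 hz2
  rw [edist_comm]
  refine (puncturedEDist_le_of_geodesic hX.geodesic y z ?_).trans_lt ?_
  · rw [dist_comm]; exact hz2
  · rw [edist_comm]; exact hz1

/-- The measure induced by `μ` on the cut space: the image under `X \ {x} → X_x` of the
restriction of `μ` to `X \ {x}`. -/
noncomputable def cutMeasure [MeasurableSpace X] {x : X} (hX : IsRGraph X) (hx : x ∈ conn X)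
    (μ : Measure X) : Measure (CutSpace hX hx) :=
  (μ.comap (Subtype.val : {y : X // y ≠ x} → X)).map (toCut hX hx)

instance [MeasurableSpace X] [BorelSpace X] {x : X} (hX : IsRGraph X) (hx : x ∈ conn X)
    (μ : Measure X) [IsFiniteMeasure μ] : IsFiniteMeasure (cutMeasure hX hx μ) := by
  have hm : MeasurableSet {y : X | y ≠ x} := (measurableSet_singleton x).compl
  have : IsFiniteMeasure (μ.comap (Subtype.val : {y : X // y ≠ x} → X)) := by
    refine ⟨?_⟩
    have he := (MeasurableEmbedding.subtype_coe hm).comap_apply μ univ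
    refine lt_of_eq_of_lt he ?_
    exact measure_lt_top _ _
  unfold cutMeasure
  infer_instance

end Cut

section GHP

variable {X : Type u} {Y : Type v} [MetricSpace X] [MetricSpace Y]

/-- The distortion of a subset of `X × Y`. -/
noncomputable def distortion (C : Set (X × Y)) : ℝ≥0∞ :=
  ⨆ p ∈ C, ⨆ q ∈ C, ENNReal.ofReal |dist p.1 q.1 - dist p.2 q.2|

variable [MeasurableSpace X] [MeasurableSpace Y]

/-- A correspondence between `X` and `Y`. -/
structure IsCorrespondence (C : Set (X × Y)) : Prop where
  measurableSet : MeasurableSet C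
  exists_right : ∀ x : X, ∃ y : Y, (x, y) ∈ C
  exists_left : ∀ y : Y, ∃ x : X, (x, y) ∈ C

/-- The discrepancy of `π` with respect to `μ` and `ν`: the sum of the total variations of the
signed measures `μ - p_* π` and `ν - p'_* π`. -/
noncomputable def discrepancy (π : Measure (X × Y)) [IsFiniteMeasure π]
    (μ : Measure X) [IsFiniteMeasure μ] (ν : Measure Y) [IsFiniteMeasure ν] : ℝ≥0∞ :=
  (μ.toSignedMeasure - (π.map Prod.fst).toSignedMeasure).totalVariation univ +
    (ν.toSignedMeasure - (π.map Prod.snd).toSignedMeasure).totalVariation univ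

/-- The Gromov--Hausdorff--Prokhorov distance between `(X, d, μ)` and `(Y, d', ν)`. -/
noncomputable def ghpDist (μ : Measure X) [IsFiniteMeasure μ]
    (ν : Measure Y) [IsFiniteMeasure ν] : ℝ≥0∞ :=
  ⨅ (C : Set (X × Y)) (_ : IsCorrespondence C) (π : FiniteMeasure (X × Y)),
    max (distortion C / 2) (max (discrepancy (π : Measure (X × Y)) μ ν)
      ((π : Measure (X × Y)) Cᶜ))

/-- The pointed Gromov--Hausdorff--Prokhorov distance between `(X, d, x, μ)` and
`(Y, d', y, ν)`, with one marked point and one measure. -/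
noncomputable def pointedGhpDist (x : X) (μ : Measure X) [IsFiniteMeasure μ]
    (y : Y) (ν : Measure Y) [IsFiniteMeasure ν] : ℝ≥0∞ :=
  ⨅ (C : Set (X × Y)) (_ : IsCorrespondence C) (_ : (x, y) ∈ C) (π : FiniteMeasure (X × Y)),
    max (distortion C / 2) (max (discrepancy (π : Measure (X × Y)) μ ν)
      ((π : Measure (X × Y)) Cᶜ))

end GHP

end RGraphs

open RGraphs

/-!
The difficulty is that a path of `X^n` may pass close to `x^n` on either side of it: the metric
`d^n` does not distinguish points on different sides of `x^n`, whereas `d^n_{x^n}` does. The proof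
shows that the notion of side is metric and stable.

Say that `p` and `q` are on the same side of `z` when `d(p, q) < d(p, z) + d(z, q)` (`Near`). This
open condition passes through a correspondence of small distortion as soon as it holds with a
margin (`PointedCorr.near`). In a geodesic space, if it fails to be a transitive relation, then
there is an embedded cycle through `z`, made of the geodesics between the three points involved
(`exists_isLoop_of_not_near`). For a space of the class `𝒜_r` there is none that is shorter than
`r`, because every embedded cycle contains an edge of the kernel (`IsLoop.exists_kernelEdge`).
Hence being on the same side of a point is transitive in the ball of radius `r / 6` centred at this
point (`IsElliptic.nearTrans`), with the same radius for all the spaces of the sequence.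

That a cycle contains an edge of the kernel rests on the structure of the core, which is convex
(`IsArc.mem_core_of_mem_core`), has no leaves (`exists_extension`), and is therefore a finite star
around each point (`exists_core_star`). Consequently a point of a cycle is a vertex of the kernel
exactly when the core is not contained in the cycle around it (`IsLoop.mem_kernelVertices_iff`),
and an arc of the cycle between consecutive vertices, or the whole cycle, is an edge.

The cut distance is the infimum of the lengths of the chains of points whose consecutive points are
on the same side of the marked point (`cutDist_le_sum`, `exists_chain`). A fixed chain of `X` is
transferred to `X^n`, and compactness gives a uniform upper bound for the cut distances of `X^n` by
those of `X` (`cutDist_le_uniform`). For the converse bound, the chains depend on `n`. Marked points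
have exactly two sides, which reach a macroscopic distance because the marked point does not
disconnect the space (`near_of_degree_le_two`, `exists_opposite`); hence the two sides of `x^n` match
those of `x` (`near_of_near`), uniformly away from the marked points, and a chain of `X^n` can be
transferred to `X` after it has been divided into a bounded number of pieces
(`cutDist_le_of_chain`). This yields `abs_cutDist_sub_le`: the correspondence has a small distortion
for the cut distances on the pairs of points that are not close to the marked points.

Every point of the cut spaces is close to the image of such a point (`CutAt.exists_far`), so these
pairs, thickened, form a correspondence `cutCorr` between the cut spaces. A measure on the product
of the original spaces is pushed forward; the discrepancy does not increase
(`totalVariation_sub_le_of_map`), and the mass lost near the marked points is small because they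
are not atoms (`ghpDist_cut_le`, `exists_measure_ball_le`).
-/

namespace RGraphs

universe u v

/-! ### Simple arcs and simple closed curves -/

section Arcs

variable {X : Type u}

/-- The curve `f` up to time `b`, followed by the curve `g` from time `c` on. -/
noncomputable def glue (f g : ℝ → X) (b c : ℝ) : ℝ → X := fun t =>
  if t ≤ b then f t else g (t - b + c)

theorem glue_left {f g : ℝ → X} {b c t : ℝ} (h : t ≤ b) : glue f g b c t = f t := if_pos h

theorem glue_right {f g : ℝ → X} {b c t : ℝ} (hfg : f b = g c) (h : b ≤ t) :
    glue f g b c t = g (t - b + c) := by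
  rcases h.eq_or_lt with rfl | h
  · simp [glue, hfg]
  · exact if_neg (not_le.2 h)

theorem glue_image_subset {f g : ℝ → X} {a b c d : ℝ} (hfg : f b = g c) :
    glue f g b c '' Icc a (b + (d - c)) ⊆ f '' Icc a b ∪ g '' Icc c d := by
  rintro _ ⟨t, ht, rfl⟩
  rcases le_total t b with h | h
  · rw [glue_left h]; exact Or.inl ⟨t, ⟨ht.1, h⟩, rfl⟩
  · rw [glue_right hfg h]
    exact Or.inr ⟨t - b + c, ⟨by linarith, by linarith [ht.2]⟩, rfl⟩

variable [MetricSpace X]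

/-- `f` restricted to the parameter interval `[a, b]` is a simple arc, possibly reduced to a
point. -/
structure IsArc (f : ℝ → X) (a b : ℝ) : Prop where
  le : a ≤ b
  cont : ContinuousOn f (Icc a b)
  inj : InjOn f (Icc a b)

/-- `f` restricted to the parameter interval `[a, b]` is a simple closed curve. -/
structure IsLoop (f : ℝ → X) (a b : ℝ) : Prop where
  lt : a < b
  cont : ContinuousOn f (Icc a b)
  inj : InjOn f (Ico a b)
  closed : f a = f b

/-- `p` and `q` are joined in `S` by a simple arc of length at most `L`, or are equal. -/
def ArcIn (S : Set X) (L : ℝ≥0∞) (p q : X) : Prop :=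
  ∃ (f : ℝ → X) (a b : ℝ), IsArc f a b ∧ f a = p ∧ f b = q ∧ f '' Icc a b ⊆ S ∧
    eVariationOn f (Icc a b) ≤ L

theorem glue_continuousOn {f g : ℝ → X} {a b c d : ℝ} (hab : a ≤ b) (hcd : c ≤ d)
    (hf : ContinuousOn f (Icc a b)) (hg : ContinuousOn g (Icc c d)) (hfg : f b = g c) :
    ContinuousOn (glue f g b c) (Icc a (b + (d - c))) := by
  have h1 : ContinuousOn (glue f g b c) (Icc a b) :=
    hf.congr fun t ht => glue_left ht.2
  have h2 : ContinuousOn (glue f g b c) (Icc b (b + (d - c))) := by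
    refine ContinuousOn.congr (f := fun t => g (t - b + c)) ?_ fun t ht => glue_right hfg ht.1
    refine hg.comp (by fun_prop) fun t ht => ⟨by linarith [ht.1], by linarith [ht.2]⟩
  rw [← Icc_union_Icc_eq_Icc hab (by linarith : b ≤ b + (d - c))]
  exact h1.union_of_isClosed h2 isClosed_Icc isClosed_Icc

theorem eVariationOn_shift (g : ℝ → X) (b c d : ℝ) :
    eVariationOn (fun t => g (t - b + c)) (Icc b (b + (d - c))) ≤ eVariationOn g (Icc c d) :=
  eVariationOn.comp_le_of_monotoneOn g (fun t => t - b + c)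
    (fun s _ t _ h => by simpa using h)
    (fun t ht => ⟨by linarith [ht.1], by linarith [ht.2]⟩)

theorem eVariationOn_glue_le {f g : ℝ → X} {a b c d : ℝ} (hab : a ≤ b) (hcd : c ≤ d)
    (hfg : f b = g c) :
    eVariationOn (glue f g b c) (Icc a (b + (d - c))) ≤
      eVariationOn f (Icc a b) + eVariationOn g (Icc c d) := by
  have h := eVariationOn.Icc_add_Icc (glue f g b c) (s := univ) hab
    (by linarith : b ≤ b + (d - c)) (mem_univ _)
  simp only [univ_inter] at h
  rw [← h]
  gcongr
  · exact (eVariationOn.congr fun t ht => glue_left ht.2).le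
  · exact (eVariationOn.congr fun t ht => glue_right hfg ht.1).le.trans (eVariationOn_shift g b c d)

theorem IsArc.sub {f : ℝ → X} {a b s t : ℝ} (h : IsArc f a b) (hs : a ≤ s) (hst : s ≤ t)
    (ht : t ≤ b) : IsArc f s t :=
  ⟨hst, h.cont.mono (Icc_subset_Icc hs ht), h.inj.mono (Icc_subset_Icc hs ht)⟩

theorem IsLoop.arc {f : ℝ → X} {a b s t : ℝ} (h : IsLoop f a b) (hs : a ≤ s) (hst : s ≤ t)
    (ht : t < b) : IsArc f s t :=
  ⟨hst, h.cont.mono (Icc_subset_Icc hs ht.le),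
    h.inj.mono (Icc_subset_Ico hs ht)⟩

theorem IsLoop.eq_of_eq {f : ℝ → X} {a b s t : ℝ} (h : IsLoop f a b) (hs : s ∈ Ioo a b)
    (ht : t ∈ Icc a b) (e : f s = f t) : s = t := by
  rcases ht.2.eq_or_lt with rfl | h1
  · rw [← h.closed] at e
    have := h.inj ⟨hs.1.le, hs.2⟩ ⟨le_rfl, h.lt⟩ e
    exact absurd this hs.1.ne'
  · exact h.inj ⟨hs.1.le, hs.2⟩ ⟨ht.1, h1⟩ e

theorem IsArc.isClosed_image {f : ℝ → X} {a b : ℝ} (h : IsArc f a b) : IsClosed (f '' Icc a b) :=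
  (isCompact_Icc.image_of_continuousOn h.cont).isClosed

theorem exists_first_mem {f : ℝ → X} {a b : ℝ} (hf : ContinuousOn f (Icc a b)) {B : Set X}
    (hB : IsClosed B) (h : ∃ t ∈ Icc a b, f t ∈ B) :
    ∃ t ∈ Icc a b, f t ∈ B ∧ ∀ s ∈ Ico a t, f s ∉ B := by
  have hc : IsCompact (Icc a b ∩ f ⁻¹' B) :=
    isCompact_Icc.of_isClosed_subset (hf.preimage_isClosed_of_isClosed isClosed_Icc hB)
      inter_subset_left
  obtain ⟨t, ht, htl⟩ := hc.exists_isLeast (by obtain ⟨t, h1, h2⟩ := h; exact ⟨t, h1, h2⟩)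
  refine ⟨t, ht.1, ht.2, fun s hs hsB => ?_⟩
  exact not_le.2 hs.2 (htl ⟨⟨hs.1, hs.2.le.trans ht.1.2⟩, hsB⟩)

theorem exists_last_mem {f : ℝ → X} {a b : ℝ} (hf : ContinuousOn f (Icc a b)) {B : Set X}
    (hB : IsClosed B) (h : ∃ t ∈ Icc a b, f t ∈ B) :
    ∃ t ∈ Icc a b, f t ∈ B ∧ ∀ s ∈ Ioc t b, f s ∉ B := by
  have hc : IsCompact (Icc a b ∩ f ⁻¹' B) :=
    isCompact_Icc.of_isClosed_subset (hf.preimage_isClosed_of_isClosed isClosed_Icc hB)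
      inter_subset_left
  obtain ⟨t, ht, htl⟩ := hc.exists_isGreatest (by obtain ⟨t, h1, h2⟩ := h; exact ⟨t, h1, h2⟩)
  refine ⟨t, ht.1, ht.2, fun s hs hsB => ?_⟩
  exact not_le.2 hs.1 (htl ⟨⟨ht.1.1.trans hs.1.le, hs.2⟩, hsB⟩)

theorem ArcIn.mono {S S' : Set X} {L L' : ℝ≥0∞} {p q : X} (h : ArcIn S L p q) (hS : S ⊆ S')
    (hL : L ≤ L') : ArcIn S' L' p q := by
  obtain ⟨f, a, b, h1, h2, h3, h4, h5⟩ := h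
  exact ⟨f, a, b, h1, h2, h3, h4.trans hS, h5.trans hL⟩

theorem IsArc.arcIn {f : ℝ → X} {a b : ℝ} (h : IsArc f a b) {S : Set X}
    (hS : ∀ t ∈ Icc a b, f t ∈ S) : ArcIn S (eVariationOn f (Icc a b)) (f a) (f b) :=
  ⟨f, a, b, h, rfl, rfl, by rintro _ ⟨t, ht, rfl⟩; exact hS t ht, le_rfl⟩

theorem ArcIn.refl {S : Set X} {L : ℝ≥0∞} {p : X} (h : p ∈ S) : ArcIn S L p p :=
  ⟨fun _ => p, 0, 0, ⟨le_rfl, continuousOn_const, by simp⟩, rfl, rfl, by simpa using h, by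
    rw [Icc_self, eVariationOn.subsingleton _ subsingleton_singleton]; exact zero_le⟩

theorem ArcIn.symm {S : Set X} {L : ℝ≥0∞} {p q : X} (h : ArcIn S L p q) : ArcIn S L q p := by
  obtain ⟨f, a, b, h1, h2, h3, h4, h5⟩ := h
  have hm : ∀ t ∈ Icc (-b) (-a), -t ∈ Icc a b := fun t ht =>
    ⟨by linarith [ht.2], by linarith [ht.1]⟩
  refine ⟨fun t => f (-t), -b, -a, ⟨by linarith [h1.le], h1.cont.comp (by fun_prop) hm, ?_⟩,
    by simpa using h3, by simpa using h2, ?_, ?_⟩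
  · intro s hs t ht e
    exact neg_injective (h1.inj (hm s hs) (hm t ht) e)
  · rintro _ ⟨t, ht, rfl⟩
    exact h4 ⟨_, hm t ht, rfl⟩
  · refine le_trans ?_ h5
    exact eVariationOn.comp_le_of_antitoneOn f (fun t => -t)
      (fun s _ t _ h => by simpa using h) hm

/-- Two points of a simple arc are joined by a part of it. -/
theorem IsArc.arcIn_image {f : ℝ → X} {a b s t : ℝ} (h : IsArc f a b) (hs : s ∈ Icc a b)
    (ht : t ∈ Icc a b) :
    ArcIn (f '' Icc a b) (eVariationOn f (Icc a b)) (f s) (f t) := by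
  have key : ∀ s ∈ Icc a b, ∀ t ∈ Icc a b, s ≤ t →
      ArcIn (f '' Icc a b) (eVariationOn f (Icc a b)) (f s) (f t) := fun s hs t ht hst =>
    ((h.sub hs.1 hst ht.2).arcIn (S := f '' Icc a b)
      fun u hu => ⟨u, ⟨hs.1.trans hu.1, hu.2.trans ht.2⟩, rfl⟩).mono subset_rfl
      (eVariationOn.mono f (Icc_subset_Icc hs.1 ht.2))
  rcases le_total s t with hst | hst
  · exact key s hs t ht hst
  · exact (key t ht s hs hst).symm

/-- Being joined by a simple arc is a transitive relation: follow the first arc up to its first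
meeting point with the second one, and then the second one. -/
theorem ArcIn.trans {S : Set X} {L L' : ℝ≥0∞} {p m q : X} (h : ArcIn S L p m)
    (h' : ArcIn S L' m q) : ArcIn S (L + L') p q := by
  obtain ⟨f, a, b, h1, h2, h3, h4, h5⟩ := h
  obtain ⟨g, c, d, k1, k2, k3, k4, k5⟩ := h'
  obtain ⟨s, hs, ⟨w, hw, hws⟩, hfirst⟩ := exists_first_mem h1.cont k1.isClosed_image
    ⟨b, ⟨h1.le, le_rfl⟩, ⟨c, ⟨le_rfl, k1.le⟩, by rw [k2, h3]⟩⟩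
  have hle : s ≤ s + (d - w) := by linarith [hw.2]
  have F := h1.sub le_rfl hs.1 hs.2
  have G := k1.sub hw.1 hw.2 le_rfl
  refine ⟨glue f g s w, a, s + (d - w), ⟨hs.1.trans hle,
    glue_continuousOn hs.1 hw.2 F.cont G.cont hws.symm, ?_⟩, ?_, ?_, ?_, ?_⟩
  · have key : ∀ t ∈ Icc a (s + (d - w)), ∀ t' ∈ Icc a (s + (d - w)), t ≤ t' →
        glue f g s w t = glue f g s w t' → t = t' := by
      intro t ht t' ht' htt' e
      rcases le_or_gt t' s with h | h
      · rw [glue_left h, glue_left (htt'.trans h)] at e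
        exact F.inj ⟨ht.1, htt'.trans h⟩ ⟨ht'.1, h⟩ e
      · rw [glue_right hws.symm h.le] at e
        rcases lt_or_ge t s with h2 | h2
        · rw [glue_left h2.le] at e
          exact absurd ⟨_, ⟨by linarith [hw.1], by linarith [ht'.2]⟩, e.symm⟩ (hfirst t ⟨ht.1, h2⟩)
        · rw [glue_right hws.symm h2] at e
          have := G.inj ⟨by linarith, by linarith [ht.2]⟩ ⟨by linarith, by linarith [ht'.2]⟩ e
          linarith
    intro t ht t' ht' e
    rcases le_total t t' with h | h
    · exact key t ht t' ht' h e
    · exact (key t' ht' t ht h e.symm).symm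
  · rw [glue_left hs.1, h2]
  · rw [glue_right hws.symm hle, ← k3]; congr 1; ring
  · refine (glue_image_subset hws.symm).trans (union_subset ?_ ?_)
    · exact (image_mono (Icc_subset_Icc le_rfl hs.2)).trans h4
    · exact (image_mono (Icc_subset_Icc hw.1 le_rfl)).trans k4
  · refine (eVariationOn_glue_le hs.1 hw.2 hws.symm).trans (add_le_add ?_ ?_)
    · exact (eVariationOn.mono f (Icc_subset_Icc le_rfl hs.2)).trans h5
    · exact (eVariationOn.mono g (Icc_subset_Icc hw.1 le_rfl)).trans k5

/-- If the endpoints of an arc are also joined by an arc that avoids a given interior point of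
the first one, then there is a simple closed curve through this point. -/
theorem IsArc.exists_isLoop {f : ℝ → X} {a b t₀ : ℝ} (hf : IsArc f a b) (h0 : t₀ ∈ Icc a b)
    {S : Set X} {L : ℝ≥0∞} (hS : f t₀ ∉ S) (hg : ArcIn S L (f a) (f b)) :
    ∃ (h : ℝ → X) (s t : ℝ), IsLoop h s t ∧ t₀ ∈ Icc s t ∧ h t₀ = f t₀ ∧
      eVariationOn h (Icc s t) ≤ eVariationOn f (Icc a b) + L := by
  obtain ⟨g, c, d, k1, k2, k3, k4, k5⟩ := hg
  have hna : f t₀ ∉ g '' Icc c d := fun h => hS (k4 h)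
  obtain ⟨s, hs, ⟨w, hw, hws⟩, hlast⟩ := exists_last_mem
    (hf.sub le_rfl h0.1 h0.2).cont k1.isClosed_image
    ⟨a, ⟨le_rfl, h0.1⟩, ⟨c, ⟨le_rfl, k1.le⟩, k2⟩⟩
  obtain ⟨t, ht, ⟨w', hw', hwt⟩, hfirst⟩ := exists_first_mem
    (hf.sub h0.1 h0.2 le_rfl).cont k1.isClosed_image
    ⟨b, ⟨h0.2, le_rfl⟩, ⟨d, ⟨k1.le, le_rfl⟩, k3⟩⟩
  have hs0 : s < t₀ := lt_of_le_of_ne hs.2 fun e => hna ⟨w, hw, by rw [hws, e]⟩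
  have ht0 : t₀ < t := lt_of_le_of_ne ht.1 fun e => hna ⟨w', hw', by rw [hwt, e]⟩
  obtain ⟨k, c', d', m1, m2, m3, m4, m5⟩ := k1.arcIn_image hw' hw
  rw [hwt] at m2
  rw [hws] at m3
  have hst := hs0.trans ht0
  have F := hf.sub hs.1 hst.le ht.2
  have hle : t ≤ t + (d' - c') := by linarith [m1.le]
  have havoid : ∀ u, s < u → u < t → f u ∉ g '' Icc c d := by
    intro u h1 h2
    rcases le_or_gt u t₀ with h | h
    · exact hlast u ⟨h1, h⟩
    · exact hfirst u ⟨h.le, h2⟩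
  refine ⟨glue f k t c', s, t + (d' - c'), ⟨hst.trans_le hle,
    glue_continuousOn hst.le m1.le F.cont m1.cont m2.symm, ?_, ?_⟩, ⟨hs0.le, ht0.le.trans hle⟩,
    glue_left ht0.le, ?_⟩
  · have key : ∀ u ∈ Ico s (t + (d' - c')), ∀ u' ∈ Ico s (t + (d' - c')), u ≤ u' →
        glue f k t c' u = glue f k t c' u' → u = u' := by
      intro u hu u' hu' huu' e
      rcases le_or_gt u' t with h | h
      · rw [glue_left h, glue_left (huu'.trans h)] at e
        exact F.inj ⟨hu.1, huu'.trans h⟩ ⟨hu'.1, h⟩ e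
      · rw [glue_right m2.symm h.le] at e
        have hu'' : u' - t + c' ∈ Icc c' d' := ⟨by linarith, by linarith [hu'.2]⟩
        rcases lt_or_ge u t with h2 | h2
        · rw [glue_left h2.le] at e
          rcases hu.1.eq_or_lt with rfl | h3
          · rw [← m3] at e
            have := m1.inj ⟨m1.le, le_rfl⟩ hu'' e
            linarith [hu'.2]
          · exact absurd (m4 ⟨_, hu'', e.symm⟩) (havoid u h3 h2)
        · rw [glue_right m2.symm h2] at e
          have := m1.inj ⟨by linarith, by linarith [hu.2]⟩ hu'' e
          linarith
    intro u hu u' hu' e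
    rcases le_total u u' with h | h
    · exact key u hu u' hu' h e
    · exact (key u' hu' u hu h e.symm).symm
  · rw [glue_left hst.le, glue_right m2.symm hle, ← m3]; congr 1; ring
  · refine (eVariationOn_glue_le hst.le m1.le m2.symm).trans (add_le_add ?_ ?_)
    · exact eVariationOn.mono f (Icc_subset_Icc hs.1 ht.2)
    · exact m5.trans k5

/-- The starting point of a simple closed curve can be changed. -/
theorem IsLoop.rotate {f : ℝ → X} {a b t₀ : ℝ} (hf : IsLoop f a b) (h0 : t₀ ∈ Icc a b) :
    ∃ (h : ℝ → X) (s t : ℝ), IsLoop h s t ∧ h s = f t₀ ∧ h '' Icc s t = f '' Icc a b ∧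
      eVariationOn h (Icc s t) ≤ eVariationOn f (Icc a b) := by
  rcases h0.2.eq_or_lt with rfl | hlt
  · exact ⟨f, a, t₀, hf, hf.closed, rfl, le_rfl⟩
  have e0 : f b = f a := hf.closed.symm
  have F := hf.cont.mono (Icc_subset_Icc h0.1 le_rfl)
  have G := hf.cont.mono (Icc_subset_Icc le_rfl h0.2)
  have hle : b ≤ b + (t₀ - a) := by linarith [h0.1]
  refine ⟨glue f f b a, t₀, b + (t₀ - a), ⟨hlt.trans_le hle,
    glue_continuousOn h0.2 h0.1 F G e0, ?_, ?_⟩, glue_left h0.2, ?_, ?_⟩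
  · have key : ∀ u ∈ Ico t₀ (b + (t₀ - a)), ∀ u' ∈ Ico t₀ (b + (t₀ - a)), u ≤ u' →
        glue f f b a u = glue f f b a u' → u = u' := by
      intro u hu u' hu' huu' e
      rcases lt_or_ge u' b with h | h
      · rw [glue_left h.le, glue_left (huu'.trans h.le)] at e
        exact hf.inj ⟨h0.1.trans hu.1, huu'.trans_lt h⟩ ⟨h0.1.trans hu'.1, h⟩ e
      · rw [glue_right e0 h] at e
        have hu'' : u' - b + a ∈ Ico a b := ⟨by linarith, by linarith [hu'.2]⟩
        rcases lt_or_ge u b with h2 | h2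
        · rw [glue_left h2.le] at e
          have := hf.inj ⟨h0.1.trans hu.1, h2⟩ hu'' e
          linarith [hu'.2, hu.1]
        · rw [glue_right e0 h2] at e
          have := hf.inj ⟨by linarith, by linarith [hu.2]⟩ hu'' e
          linarith
    intro u hu u' hu' e
    rcases le_total u u' with h | h
    · exact key u hu u' hu' h e
    · exact (key u' hu' u hu h e.symm).symm
  · rw [glue_left h0.2, glue_right e0 hle]; congr 1; ring
  · refine Subset.antisymm ((glue_image_subset e0).trans (union_subset ?_ ?_)) ?_
    · exact image_mono (Icc_subset_Icc h0.1 le_rfl)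
    · exact image_mono (Icc_subset_Icc le_rfl h0.2)
    · rintro _ ⟨u, hu, rfl⟩
      rcases le_total t₀ u with h | h
      · exact ⟨u, ⟨h, hu.2.trans hle⟩, glue_left hu.2⟩
      · refine ⟨u - a + b, ⟨by linarith [hu.1, h0.2], by linarith⟩, ?_⟩
        rw [glue_right e0 (by linarith [hu.1])]; congr 1; ring
  · refine (eVariationOn_glue_le h0.2 h0.1 e0).trans ?_
    have h := eVariationOn.Icc_add_Icc f (s := univ) h0.1 h0.2 (mem_univ _)
    simp only [univ_inter] at h
    rw [← h, add_comm]

/-- The image of a simple closed curve is an embedded cycle. -/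
theorem IsLoop.isEmbeddedCycle {f : ℝ → X} {a b : ℝ} (hf : IsLoop f a b) :
    IsEmbeddedCycle (f '' Icc a b) := by
  have hpos : 0 < b - a := sub_pos.2 hf.lt
  have : Fact (0 < b - a) := ⟨hpos⟩
  have hb : a + (b - a) = b := by ring
  have hc : Continuous (AddCircle.liftIco (b - a) a f) :=
    AddCircle.liftIco_continuous (by rw [hb]; exact hf.closed) (by rw [hb]; exact hf.cont)
  let e := (AddCircle.homeomorphCircle (T := b - a) hpos.ne').symm
  have hrep : ∀ z : AddCircle (b - a), ∃ t ∈ Ico a b, (t : AddCircle (b - a)) = z := by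
    intro z
    refine ⟨AddCircle.equivIco (b - a) a z, ?_, AddCircle.coe_equivIco⟩
    have := (AddCircle.equivIco (b - a) a z).2
    exact ⟨this.1, this.2.trans_eq hb⟩
  have hval : ∀ t ∈ Ico a b, AddCircle.liftIco (b - a) a f (t : AddCircle (b - a)) = f t :=
    fun t ht => AddCircle.liftIco_coe_apply (by rwa [hb])
  refine ⟨AddCircle.liftIco (b - a) a f ∘ e, hc.comp e.continuous, ?_, ?_⟩
  · refine Function.Injective.comp ?_ e.injective
    intro z w h
    obtain ⟨s, hs, rfl⟩ := hrep z
    obtain ⟨t, ht, rfl⟩ := hrep w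
    rw [hval s hs, hval t ht] at h
    rw [hf.inj hs ht h]
  · rw [range_comp, e.surjective.range_eq, image_univ]
    ext p
    constructor
    · rintro ⟨z, rfl⟩
      obtain ⟨s, hs, rfl⟩ := hrep z
      exact ⟨s, ⟨hs.1, hs.2.le⟩, (hval s hs).symm⟩
    · rintro ⟨t, ht, rfl⟩
      rcases ht.2.eq_or_lt with rfl | h
      · exact ⟨_, (hval a ⟨le_rfl, hf.lt⟩).trans hf.closed⟩
      · exact ⟨_, hval t ⟨ht.1, h⟩⟩

/-- An embedded cycle is parametrised by a simple closed curve starting at any of its points. -/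
theorem IsEmbeddedCycle.exists_isLoop {c : Set X} (hc : IsEmbeddedCycle c) {p : X} (hp : p ∈ c) :
    ∃ (f : ℝ → X) (b : ℝ), IsLoop f 0 b ∧ f 0 = p ∧ f '' Icc 0 b = c := by
  obtain ⟨F, F1, F2, rfl⟩ := hc
  obtain ⟨z, rfl⟩ := hp
  have h2 : Circle.exp (2 * Real.pi) = Circle.exp 0 := by simp
  refine ⟨fun t => F (z * Circle.exp t), 2 * Real.pi, ⟨by positivity, by fun_prop, ?_, ?_⟩,
    by simp, ?_⟩
  · intro s hs t ht h
    have h3 : Circle.exp s = Circle.exp t := mul_left_cancel (F2 h)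
    obtain ⟨m, hm⟩ := Circle.exp_eq_exp.1 h3
    have hpi := Real.pi_pos
    have : m = 0 := by
      have h4 : (m : ℝ) < 1 := by
        by_contra h5
        nlinarith [hs.2, ht.1, hs.1, ht.2]
      have h5 : (-1 : ℝ) < m := by
        by_contra h5
        nlinarith [hs.2, ht.1, hs.1, ht.2]
      have h6 : m < 1 := by exact_mod_cast h4
      have h7 : -1 < m := by exact_mod_cast h5
      omega
    simpa [this] using hm
  · simp only [h2]
  · ext p
    constructor
    · rintro ⟨t, _, rfl⟩; exact mem_range_self _
    · rintro ⟨w, rfl⟩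
      have hs : ∃ t ∈ Icc 0 (2 * Real.pi), Circle.exp t = z⁻¹ * w := by
        obtain ⟨y, hy⟩ := Circle.exp_surjective (z⁻¹ * w)
        have hpos : 0 < 2 * Real.pi := by positivity
        refine ⟨toIcoMod hpos 0 y, ?_, ?_⟩
        · have := toIcoMod_mem_Ico hpos 0 y
          rw [zero_add] at this
          exact ⟨this.1, this.2.le⟩
        · rw [← hy, Circle.exp_eq_exp]
          refine ⟨-toIcoDiv hpos 0 y, ?_⟩
          have := toIcoMod_add_toIcoDiv_zsmul hpos 0 y
          rw [zsmul_eq_mul] at this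
          push_cast
          linarith
      obtain ⟨t, ht, e⟩ := hs
      exact ⟨t, ht, by simp [e]⟩

end Arcs

/-! ### Sides of a point and loops -/

section Sides

variable {X : Type u} [MetricSpace X]

/-- `p` and `q` are on the same side of `z`: no geodesic from `p` to `q` passes through `z`. In
an `ℝ`-tree, this says that `p` and `q` are in the same connected component of the complement
of `z`. -/
def Near (z p q : X) : Prop := dist p q < dist p z + dist z q

/-- `m` lies on a geodesic from `p` to `q`. -/
def Btw (p m q : X) : Prop := dist p q = dist p m + dist m q

/-- Being on the same side of `z` is a transitive relation on `S`. -/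
def NearTrans (z : X) (S : Set X) : Prop :=
  ∀ p ∈ S, ∀ q ∈ S, ∀ w ∈ S, Near z p q → Near z q w → Near z p w

/-- Being on the same side of any point of `S` is a transitive relation on `S`. This is the
metric property of `ℝ`-trees on which the arguments below rely. -/
def TreeSet (S : Set X) : Prop := ∀ z ∈ S, NearTrans z S

theorem not_near {z p q : X} : ¬ Near z p q ↔ Btw p z q :=
  ⟨fun h => le_antisymm (dist_triangle _ _ _) (not_lt.1 h), fun h => (h : _ = _).not_lt⟩

theorem Near.symm {z p q : X} (h : Near z p q) : Near z q p := by
  unfold Near at *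
  rw [dist_comm q p, dist_comm q z, dist_comm z p]; linarith

theorem Btw.symm {m p q : X} (h : Btw p m q) : Btw q m p := by
  unfold Btw at *
  rw [dist_comm q p, dist_comm q m, dist_comm m p]; linarith

theorem near_of_dist_lt {z p q : X} (h : dist p q < dist p z) : Near z p q :=
  h.trans_le (le_add_of_nonneg_right dist_nonneg)

theorem near_self {z p : X} (h : p ≠ z) : Near z p p :=
  near_of_dist_lt (by rw [dist_self]; exact dist_pos.2 h)

theorem Near.left_ne {z p q : X} (h : Near z p q) : p ≠ z := by
  rintro rfl; simp [Near] at h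

theorem Near.right_ne {z p q : X} (h : Near z p q) : q ≠ z := h.symm.left_ne

/-- A point other than `v` on a geodesic from `v` to `p` is on the same side of `v` as `p`. -/
theorem Btw.near {v m p : X} (h : Btw v m p) (hm : m ≠ v) : Near v m p := by
  have := dist_pos.2 hm
  unfold Near
  unfold Btw at h
  rw [dist_comm m v] at *
  linarith

theorem exists_btw (hX : IsGeodesicSpace X) (p q : X) {s : ℝ} (hs : 0 ≤ s) (hs' : s ≤ dist p q) :
    ∃ m, dist p m = s ∧ Btw p m q := by
  obtain ⟨f, f0, f1, hf⟩ := hX p q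
  have h1 := hf 0 ⟨le_rfl, dist_nonneg⟩ s ⟨hs, hs'⟩
  have h2 := hf s ⟨hs, hs'⟩ (dist p q) ⟨dist_nonneg, le_rfl⟩
  rw [f0, zero_sub, abs_neg, abs_of_nonneg hs] at h1
  rw [f1, abs_sub_comm, abs_of_nonneg (by linarith)] at h2
  exact ⟨f s, h1, by unfold Btw; linarith⟩

/-- A geodesic, parametrised by the distance to its starting point. -/
theorem exists_geodesic (hX : IsGeodesicSpace X) (p q : X) :
    ∃ f : ℝ → X, IsArc f 0 (dist p q) ∧ f 0 = p ∧ f (dist p q) = q ∧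
      (∀ t ∈ Icc 0 (dist p q), dist p (f t) = t ∧ dist (f t) q = dist p q - t) ∧
      eVariationOn f (Icc 0 (dist p q)) ≤ edist p q := by
  obtain ⟨f, f0, f1, hf⟩ := hX p q
  have D0 : 0 ≤ dist p q := dist_nonneg
  have hL : LipschitzOnWith 1 f (Icc 0 (dist p q)) :=
    LipschitzOnWith.of_dist_le_mul fun s hs t ht => by simp [hf s hs t ht, Real.dist_eq]
  refine ⟨f, ⟨D0, hL.continuousOn, fun s hs t ht e => ?_⟩, f0, f1, fun t ht => ⟨?_, ?_⟩, ?_⟩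
  · have := hf s hs t ht
    rw [e, dist_self] at this
    exact sub_eq_zero.1 (abs_eq_zero.1 this.symm)
  · have h1 := hf 0 ⟨le_rfl, D0⟩ t ht
    rwa [f0, zero_sub, abs_neg, abs_of_nonneg ht.1] at h1
  · have h2 := hf t ht _ ⟨D0, le_rfl⟩
    rwa [f1, abs_sub_comm, abs_of_nonneg (by linarith [ht.2])] at h2
  · have e2 : eVariationOn (f ∘ id) (Icc 0 (dist p q)) ≤
        (1 : NNReal) * eVariationOn (id : ℝ → ℝ) (Icc 0 (dist p q)) :=
      hL.comp_eVariationOn_le fun t ht => ht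
    rw [edist_dist]
    refine e2.trans ?_
    simp

theorem Near.arcIn (hX : IsGeodesicSpace X) {z p q : X} (h : Near z p q) :
    ArcIn {z}ᶜ (edist p q) p q := by
  obtain ⟨f, f1, f2, f3, f4, f5⟩ := exists_geodesic hX p q
  have := f1.arcIn (S := {z}ᶜ) fun t ht e => by
    have e' : f t = z := e
    have h1 := f4 t ht
    rw [e'] at h1
    unfold Near at h
    linarith
  rw [f2, f3] at this
  exact this.mono subset_rfl f5

theorem exists_geodesic_through (hX : IsGeodesicSpace X) {p z q : X} (h : Btw p z q) :
    ∃ f : ℝ → X, IsArc f 0 (dist p q) ∧ f 0 = p ∧ f (dist p q) = q ∧ f (dist p z) = z ∧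
      eVariationOn f (Icc 0 (dist p q)) ≤ edist p q := by
  obtain ⟨f, f1, f2, f3, f4, f5⟩ := exists_geodesic hX p z
  obtain ⟨g, g1, g2, g3, g4, g5⟩ := exists_geodesic hX z q
  have e : f (dist p z) = g 0 := by rw [f3, g2]
  have hD : dist p z + (dist z q - 0) = dist p q := by unfold Btw at h; linarith
  have hd : ∀ t ∈ Icc 0 (dist p q), dist p (glue f g (dist p z) 0 t) = t := by
    intro t ht
    rcases le_total t (dist p z) with h1 | h1
    · rw [glue_left h1]; exact (f4 t ⟨ht.1, h1⟩).1
    · rw [glue_right e h1]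
      have h2 := g4 (t - dist p z + 0) ⟨by linarith, by linarith [ht.2]⟩
      have h3 := dist_triangle p z (g (t - dist p z + 0))
      have h4 := dist_triangle p (g (t - dist p z + 0)) q
      linarith
  refine ⟨glue f g (dist p z) 0, ⟨dist_nonneg, ?_, fun s hs t ht e => ?_⟩, ?_, ?_, ?_, ?_⟩
  · rw [← hD]
    exact glue_continuousOn dist_nonneg dist_nonneg f1.cont g1.cont e
  · rw [← hd s hs, ← hd t ht, e]
  · rw [glue_left dist_nonneg, f2]
  · rw [glue_right e (by linarith [hD, dist_nonneg (x := z) (y := q)])]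
    convert g3 using 2; linarith
  · rw [glue_left le_rfl, f3]
  · have h1 := eVariationOn_glue_le (f := f) (g := g) (a := 0) (b := dist p z) (c := 0)
      (d := dist z q) dist_nonneg dist_nonneg e
    rw [hD] at h1
    refine h1.trans ((add_le_add f5 g5).trans (le_of_eq ?_))
    rw [edist_dist, edist_dist, edist_dist, ← ENNReal.ofReal_add dist_nonneg dist_nonneg, h]

/-- If being on the same side of `z` fails to be transitive, there is a simple closed curve
through `z`. -/
theorem exists_isLoop_of_not_near (hX : IsGeodesicSpace X) {z p q w : X} (h1 : Near z p q)
    (h2 : Near z q w) (h3 : ¬ Near z p w) :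
    ∃ (h : ℝ → X) (s t : ℝ), IsLoop h s t ∧ z ∈ h '' Icc s t ∧
      eVariationOn h (Icc s t) ≤ edist p w + (edist p q + edist q w) := by
  rw [not_near] at h3
  obtain ⟨f, f1, f2, f3, f4, f5⟩ := exists_geodesic_through hX h3
  have hb : dist p z ∈ Icc 0 (dist p w) :=
    ⟨dist_nonneg, by unfold Btw at h3; linarith [dist_nonneg (x := z) (y := w)]⟩
  have h12 := (h1.arcIn hX).trans (h2.arcIn hX)
  obtain ⟨h, s, t, k1, k2, k3, k4⟩ := f1.exists_isLoop hb (S := {z}ᶜ) (by simp [f4])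
    (by rw [f2, f3]; exact h12)
  exact ⟨h, s, t, k1, ⟨_, k2, k3.trans f4⟩, k4.trans (add_le_add f5 le_rfl)⟩

/-- In an `ℝ`-tree, being on the same side of a point is transitive, since a failure would produce
a cycle. -/
theorem IsRTree.treeSet {S : Set X} (hS : IsRTree S) : TreeSet S := by
  intro z hz p hp q hq w hw h1 h2
  by_contra h3
  obtain ⟨h, s, t, k1, -⟩ := exists_isLoop_of_not_near hS.geodesic (z := ⟨z, hz⟩) (p := ⟨p, hp⟩)
    (q := ⟨q, hq⟩) (w := ⟨w, hw⟩) h1 h2 h3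
  exact hS.acyclic _ k1.isEmbeddedCycle

theorem NearTrans.mono {z : X} {S S' : Set X} (h : NearTrans z S) (hS : S' ⊆ S) :
    NearTrans z S' :=
  fun p hp q hq w hw => h p (hS hp) q (hS hq) w (hS hw)

/-- The points of a connected set that avoids `z` are on the same side of `z`. -/
theorem NearTrans.near_of_isPreconnected {z : X} {K : Set X} (h : NearTrans z K)
    (hK : IsPreconnected K) (hz : z ∉ K) {p q : X} (hp : p ∈ K) (hq : q ∈ K) : Near z p q := by
  refine hK.induction₂' (Near z) (fun x hx => ?_)
    (fun x y w hx hy hw => h x hx y hy w hw) hp hq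
  have hpos : 0 < dist x z := dist_pos.2 fun e => hz (e ▸ hx)
  filter_upwards [mem_nhdsWithin_of_mem_nhds (Metric.ball_mem_nhds x hpos)] with y hy
  have : Near z x y := near_of_dist_lt (by rw [dist_comm]; exact hy)
  exact ⟨this, this.symm⟩

/-- In an `ℝ`-tree, a path visits all points of the geodesic between its endpoints. -/
theorem TreeSet.mem_image_of_btw {S : Set X} (hS : TreeSet S) {f : ℝ → X} {a b : ℝ} (hab : a ≤ b)
    (hf : ContinuousOn f (Icc a b)) (hfS : f '' Icc a b ⊆ S) {m : X} (hm : m ∈ S)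
    (h : Btw (f a) m (f b)) : m ∈ f '' Icc a b := by
  by_contra hne
  exact not_near.2 h (((hS m hm).mono hfS).near_of_isPreconnected
    (isPreconnected_Icc.image f hf) hne ⟨a, ⟨le_rfl, hab⟩, rfl⟩ ⟨b, ⟨hab, le_rfl⟩, rfl⟩)

theorem NearTrans.btw_or {z : X} {S : Set X} (h : NearTrans z S) {p q w : X} (hp : p ∈ S)
    (hq : q ∈ S) (hw : w ∈ S) (hb : Btw p z w) : Btw p z q ∨ Btw q z w := by
  by_contra hcon
  rw [not_or, ← not_near, ← not_near, not_not, not_not] at hcon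
  exact not_near.2 hb (h p hp q hq w hw hcon.1 hcon.2)

/-- Two points of a geodesic in an `ℝ`-tree are as far from each other as their distances to the
starting point indicate. -/
theorem TreeSet.btw_of_btw {S : Set X} (hS : TreeSet S) {v u p q : X} (hv : v ∈ S) (hu : u ∈ S)
    (hp : p ∈ S) (hq : q ∈ S) (h1 : Btw v p u) (h2 : Btw v q u) (hle : dist v p ≤ dist v q) :
    Btw v p q := by
  rcases (hS p hp).btw_or hv hq hu h1 with h | h
  · exact h
  · unfold Btw at *
    have h3 := dist_nonneg (x := p) (y := q)
    rw [dist_comm q p] at h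
    linarith

/-- In an `ℝ`-tree, the geodesics from `v` to `a` and to `b` agree up to the distance from `v`
given by the Gromov product of `a` and `b`. -/
theorem TreeSet.btw_of_gromov {S : Set X} (hS : TreeSet S) {v a b p : X} (hv : v ∈ S) (ha : a ∈ S)
    (hb : b ∈ S) (hp : p ∈ S) (h1 : Btw v p a)
    (h2 : dist a b + 2 * dist v p ≤ dist a v + dist v b) : Btw v p b := by
  rcases (hS p hp).btw_or hv hb ha h1 with h | h
  · exact h
  · unfold Btw at *
    have h3 := dist_triangle v p b
    rw [dist_comm b a, dist_comm b p] at h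
    rw [dist_comm a v] at h2
    linarith

/-- On a compact set that does not contain `z`, the pairs of points on the same side of `z` are
uniformly so. -/
theorem NearTrans.exists_gap {z : X} {K : Set X} (h : NearTrans z K) (hK : IsCompact K)
    (hz : z ∉ K) :
    ∃ g > 0, ∀ p ∈ K, ∀ q ∈ K, Near z p q → dist p q + 2 * g ≤ dist p z + dist z q := by
  have hpos : ∀ p ∈ K, 0 < dist p z := fun p hp => dist_pos.2 fun e => hz (e ▸ hp)
  set O : Set (X × X) := ⋃ a ∈ {a : X × X | a.1 ∈ K ∧ a.2 ∈ K ∧ ¬ Near z a.1 a.2},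
    Metric.ball a.1 (dist a.1 z) ×ˢ Metric.ball a.2 (dist a.2 z) with hO
  have hOo : IsOpen O := isOpen_biUnion fun a _ => Metric.isOpen_ball.prod Metric.isOpen_ball
  have hR : ∀ p ∈ K, ∀ q ∈ K, (Near z p q ↔ (p, q) ∉ O) := by
    intro p hp q hq
    constructor
    · intro hn hm
      simp only [hO, mem_iUnion] at hm
      obtain ⟨⟨a, b⟩, ⟨ha, hb, hab⟩, hpa, hqb⟩ := hm
      have h1 : Near z a p := near_of_dist_lt (by rw [dist_comm]; exact hpa)
      have h2 : Near z b q := near_of_dist_lt (by rw [dist_comm]; exact hqb)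
      exact hab (h a ha p hp b hb h1 (h p hp q hq b hb hn h2.symm))
    · intro hm
      by_contra hn
      refine hm ?_
      simp only [hO, mem_iUnion]
      exact ⟨(p, q), ⟨hp, hq, hn⟩, Metric.mem_ball_self (hpos p hp),
        Metric.mem_ball_self (hpos q hq)⟩
  have hcomp : IsCompact ((K ×ˢ K) \ O) := (hK.prod hK).diff hOo
  rcases ((K ×ˢ K) \ O).eq_empty_or_nonempty with he | hne
  · refine ⟨1, one_pos, fun p hp q hq hn => ?_⟩
    have : (p, q) ∈ (K ×ˢ K) \ O := ⟨⟨hp, hq⟩, (hR p hp q hq).1 hn⟩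
    rw [he] at this
    exact this.elim
  · obtain ⟨⟨a, b⟩, ⟨⟨ha, hb⟩, hab⟩, hmin⟩ := hcomp.exists_isMinOn hne
      (f := fun a : X × X => dist a.1 z + dist z a.2 - dist a.1 a.2) (by fun_prop)
    have hn := (hR a ha b hb).2 hab
    refine ⟨(dist a z + dist z b - dist a b) / 2, half_pos (sub_pos.2 hn), fun p hp q hq hpq => ?_⟩
    have := hmin (show (p, q) ∈ (K ×ˢ K) \ O from ⟨⟨hp, hq⟩, (hR p hp q hq).1 hpq⟩)
    simp only [mem_ofPred_eq] at this
    linarith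

end Sides

/-! ### Convexity and local structure of the core -/

section Core

variable {X : Type u} [MetricSpace X]

theorem IsArc.mem_core {f : ℝ → X} {a b t : ℝ} (hf : IsArc f a b) (hab : a < b)
    (ha : ∃ c, IsEmbeddedCycle c ∧ f a ∈ c) (hb : ∃ c, IsEmbeddedCycle c ∧ f b ∈ c)
    (ht : t ∈ Icc a b) : f t ∈ core X := by
  have hpos : 0 < b - a := sub_pos.2 hab
  have hm : ∀ s : I, a + s * (b - a) ∈ Icc a b := fun s =>
    ⟨by nlinarith [s.2.1], by nlinarith [s.2.2]⟩
  refine ⟨fun s => f (a + s * (b - a)), hf.cont.comp_continuous (by fun_prop) hm, ?_,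
    by simpa using ha, by simpa using hb, ⟨⟨(t - a) / (b - a), ?_, ?_⟩, ?_⟩⟩
  · intro s s' e
    have := hf.inj (hm s) (hm s') e
    exact Subtype.ext (mul_right_cancel₀ hpos.ne' (by linarith))
  · exact div_nonneg (by linarith [ht.1]) hpos.le
  · rw [div_le_one hpos]; linarith [ht.2]
  · simp only
    congr 1
    field_simp
    ring

theorem IsEmbeddedCycle.subset_core {c : Set X} (hc : IsEmbeddedCycle c) : c ⊆ core X := by
  intro z hz
  obtain ⟨f, b, h1, rfl, h3⟩ := hc.exists_isLoop hz
  have hb := h1.lt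
  have hmem : ∀ t ∈ Icc 0 b, ∃ c, IsEmbeddedCycle c ∧ f t ∈ c := fun t ht =>
    ⟨c, hc, h3 ▸ ⟨t, ht, rfl⟩⟩
  exact (h1.arc le_rfl (by linarith : (0 : ℝ) ≤ b / 2) (by linarith)).mem_core (by linarith)
    (hmem 0 ⟨le_rfl, hb.le⟩) (hmem (b / 2) ⟨by linarith, by linarith⟩) ⟨le_rfl, by linarith⟩

/-- A point of the core that is not on a cycle separates two cycles. -/
theorem core_cases {w : X} (hw : w ∈ core X) (hcyc : ∀ c, IsEmbeddedCycle c → w ∉ c) :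
    ∃ p q : X, (∃ c, IsEmbeddedCycle c ∧ p ∈ c) ∧ (∃ c, IsEmbeddedCycle c ∧ q ∈ c) ∧
      ¬ ArcIn {w}ᶜ ⊤ p q := by
  obtain ⟨f, hf, hinj, h0, h1, ⟨t, rfl⟩⟩ := hw
  have hF : IsArc (f ∘ projIcc (0 : ℝ) 1 zero_le_one) 0 1 :=
    ⟨zero_le_one, (hf.comp continuous_projIcc).continuousOn,
      fun s hs s' hs' e => by
        have := congrArg Subtype.val (hinj e)
        rwa [projIcc_of_mem _ hs, projIcc_of_mem _ hs'] at this⟩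
  have e : ∀ s : I, (f ∘ projIcc (0 : ℝ) 1 zero_le_one) s = f s := fun s => by
    simp [projIcc_val]
  refine ⟨f 0, f 1, h0, h1, fun hA => ?_⟩
  have e0 := e 0
  have e1 := e 1
  rw [Icc.coe_zero] at e0
  rw [Icc.coe_one] at e1
  obtain ⟨h, s, s', k1, k2, k3, -⟩ := hF.exists_isLoop t.2 (S := {f t}ᶜ) (L := ⊤)
    (by rw [e]; simp) (by rw [e0, e1]; exact hA)
  exact hcyc _ k1.isEmbeddedCycle ⟨_, k2, k3.trans (e t)⟩

/-- If `a` is on no cycle, then any other point of the core can be joined to a cycle without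
visiting `a`. -/
theorem exists_arcIn_cycle (hX : IsGeodesicSpace X) {a w : X} (hw : w ∈ core X) (hwa : w ≠ a)
    (hcyc : ∀ c, IsEmbeddedCycle c → a ∉ c) :
    ∃ p, (∃ c, IsEmbeddedCycle c ∧ p ∈ c) ∧ ArcIn {a}ᶜ ⊤ w p := by
  by_cases h : ∀ c, IsEmbeddedCycle c → w ∉ c
  · obtain ⟨p, q, hp, hq, hpq⟩ := core_cases hw h
    have key : ∀ p, (∃ c, IsEmbeddedCycle c ∧ p ∈ c) → ¬ ArcIn {w}ᶜ ⊤ p a →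
        ArcIn {a}ᶜ ⊤ w p := by
      intro p hp hpa
      obtain ⟨f, f1, f2, f3, f4, f5⟩ := exists_geodesic hX w p
      by_cases hfa : ∃ t ∈ Icc 0 (dist w p), f t = a
      · obtain ⟨t, ht, rfl⟩ := hfa
        refine absurd ?_ hpa
        have h0 : 0 < t := lt_of_le_of_ne ht.1 (by rintro rfl; exact hwa f2.symm)
        have := (f1.sub ht.1 ht.2 le_rfl).arcIn (S := {w}ᶜ) fun s hs e => by
          have := f1.inj ⟨ht.1.trans hs.1, hs.2⟩ ⟨le_rfl, dist_nonneg⟩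
            ((e : f s = w).trans f2.symm)
          linarith [hs.1]
        rw [f3] at this
        exact (this.mono subset_rfl le_top).symm
      · push Not at hfa
        have := f1.arcIn (S := {a}ᶜ) hfa
        rw [f2, f3] at this
        exact this.mono subset_rfl le_top
    by_cases h1 : ArcIn {w}ᶜ ⊤ p a
    · refine ⟨q, hq, key q hq fun h2 => hpq ?_⟩
      exact (h1.trans h2.symm).mono subset_rfl le_top
    · exact ⟨p, hp, key p hp h1⟩
  · push Not at h
    exact ⟨w, h, ArcIn.refl hwa⟩

/-- The core is convex: it contains the simple arcs between its points. -/
theorem IsArc.mem_core_of_mem_core (hX : IsGeodesicSpace X) {f : ℝ → X} {a b t : ℝ}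
    (hf : IsArc f a b) (ha : f a ∈ core X) (hb : f b ∈ core X) (ht : t ∈ Icc a b) :
    f t ∈ core X := by
  by_cases hcyc : ∀ c, IsEmbeddedCycle c → f t ∉ c
  swap
  · push Not at hcyc
    obtain ⟨c, hc, h⟩ := hcyc
    exact hc.subset_core h
  rcases eq_or_ne (f a) (f t) with h1 | h1
  · rwa [← h1]
  rcases eq_or_ne (f b) (f t) with h2 | h2
  · rwa [← h2]
  obtain ⟨p, hp, hap⟩ := exists_arcIn_cycle hX ha h1 hcyc
  obtain ⟨q, hq, hbq⟩ := exists_arcIn_cycle hX hb h2 hcyc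
  obtain ⟨g, g1, g2, g3, g4, g5⟩ := exists_geodesic hX p q
  by_cases hg : ∃ s ∈ Icc 0 (dist p q), g s = f t
  · obtain ⟨s, hs, e⟩ := hg
    have hpq : p ≠ q := by
      rintro rfl
      obtain ⟨c, hc, hpc⟩ := hp
      simp only [dist_self, Icc_self, mem_singleton_iff] at hs
      rw [hs, g2] at e
      exact hcyc c hc (e ▸ hpc)
    rw [← e]
    exact g1.mem_core (dist_pos.2 hpq) (g2.symm ▸ hp) (g3.symm ▸ hq) hs
  · push Not at hg
    have hpq := g1.arcIn (S := {f t}ᶜ) hg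
    rw [g2, g3] at hpq
    -- the arc would be closed up by a path avoiding `f t`, which would then be on a cycle
    obtain ⟨h, s, s', k1, k2, k3, -⟩ := hf.exists_isLoop ht (S := {f t}ᶜ) (by simp)
      ((hap.trans hpq).trans hbq.symm)
    exact absurd ⟨_, k2, k3⟩ (hcyc _ k1.isEmbeddedCycle)

theorem IsRTree.not_cycle_subset {S : Set X} (hS : IsRTree S) {c : Set X}
    (hc : IsEmbeddedCycle c) : ¬ c ⊆ S := by
  rintro h
  obtain ⟨F, F1, F2, rfl⟩ := hc
  refine hS.acyclic _ ⟨fun z => ⟨F z, h ⟨z, rfl⟩⟩, F1.subtype_mk _, fun z w e => F2 ?_, rfl⟩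
  exact congrArg Subtype.val e

theorem IsRTree.exists_btw {S : Set X} (hS : IsRTree S) {p q : X} (hp : p ∈ S) (hq : q ∈ S)
    {s : ℝ} (hs : 0 ≤ s) (hs' : s ≤ dist p q) : ∃ m ∈ S, dist p m = s ∧ Btw p m q := by
  obtain ⟨m, h1, h2⟩ := RGraphs.exists_btw hS.geodesic ⟨p, hp⟩ ⟨q, hq⟩ hs hs'
  exact ⟨m, m.2, h1, h2⟩

/-- The first time at which a curve leaves a ball. -/
theorem exists_first_exit {f : ℝ → X} {a b r : ℝ} (v : X) (hab : a ≤ b)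
    (hf : ContinuousOn f (Icc a b)) (ha : dist v (f a) < r) (hb : r ≤ dist v (f b)) :
    ∃ t ∈ Ioc a b, dist v (f t) = r ∧ ∀ s ∈ Ico a t, dist v (f s) < r := by
  obtain ⟨t, ht, h1, h2⟩ := exists_first_mem hf (B := {u | r ≤ dist v u})
    (isClosed_le continuous_const (by fun_prop)) ⟨b, ⟨hab, le_rfl⟩, hb⟩
  have hat : a < t := lt_of_le_of_ne ht.1 (by rintro rfl; exact absurd h1 (not_le.2 ha))
  have h2' : ∀ s ∈ Ico a t, dist v (f s) < r := fun s hs => not_le.1 (h2 s hs)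
  have hc : ContinuousOn (fun s => dist v (f s)) (Icc a t) :=
    (continuous_const.dist continuous_id).comp_continuousOn (hf.mono (Icc_subset_Icc le_rfl ht.2))
  obtain ⟨s, hs, e⟩ := intermediate_value_Icc hat.le hc ⟨ha.le, h1⟩
  rcases hs.2.eq_or_lt with rfl | h
  · exact ⟨s, ⟨hat, ht.2⟩, e, h2'⟩
  · exact absurd e (h2' s ⟨hs.1, h⟩).ne

/-- The core has no leaves: seen from the centre of a ball that is an `ℝ`-tree, every point of the
core in this ball can be passed by a geodesic that goes on up to a given sphere. -/
theorem exists_extension (hX : IsGeodesicSpace X) {v w : X} {ε ρ : ℝ}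
    (hT : IsRTree (Metric.ball v ε)) (hw : w ∈ core X) (hvw : w ≠ v) (hwρ : dist v w < ρ)
    (hρ : ρ < ε) : ∃ u, dist v u = ρ ∧ Btw v w u := by
  have hS := hT.treeSet
  have hmem : ∀ u, dist v u < ε → u ∈ Metric.ball v ε := fun u hu => by
    rwa [Metric.mem_ball, dist_comm]
  have hfar : ∀ c, IsEmbeddedCycle c → ∃ u ∈ c, ε ≤ dist v u := by
    intro c hc
    obtain ⟨u, hu, hu'⟩ := not_subset.1 (hT.not_cycle_subset hc)
    exact ⟨u, hu, not_lt.1 fun h => hu' (hmem u h)⟩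
  have hwS := hmem w (hwρ.trans hρ)
  have hvS := hmem v (by rw [dist_self]; exact dist_nonneg.trans_lt (hwρ.trans hρ))
  by_cases hcyc : ∀ c, IsEmbeddedCycle c → w ∉ c
  · obtain ⟨p, q, hp, hq, hpq⟩ := core_cases hw hcyc
    -- one of the two cycles that `w` separates is also separated from `v`
    have key : ∃ p, (∃ c, IsEmbeddedCycle c ∧ p ∈ c) ∧ ¬ ArcIn {w}ᶜ ⊤ p v := by
      by_cases h1 : ArcIn {w}ᶜ ⊤ p v
      · exact ⟨q, hq, fun h2 => hpq ((h1.trans h2.symm).mono subset_rfl le_top)⟩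
      · exact ⟨p, hp, h1⟩
    obtain ⟨p, ⟨c, hc, hpc⟩, hpv⟩ := key
    obtain ⟨p', hp', hfar'⟩ := hfar c hc
    have hpp' : ArcIn {w}ᶜ ⊤ p p' := by
      obtain ⟨f, b, f1, rfl, rfl⟩ := hc.exists_isLoop hpc
      obtain ⟨t, ht, rfl⟩ := hp'
      have hav : ∀ s ∈ Icc 0 b, f s ∈ ({w}ᶜ : Set X) := fun s hs e =>
        hcyc _ hc ⟨s, hs, e⟩
      rcases ht.2.eq_or_lt with rfl | h
      · rw [← f1.closed]; exact ArcIn.refl (hav _ ⟨le_rfl, ht.1⟩)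
      · exact ((f1.arc le_rfl ht.1 h).arcIn fun s hs =>
          hav s ⟨hs.1, hs.2.trans ht.2⟩).mono subset_rfl le_top
    have hb : Btw v w p' := by
      by_contra hn
      rw [← not_near, not_not] at hn
      refine hpv ((hpp'.trans (hn.arcIn hX).symm).mono subset_rfl le_top)
    -- `u` is chosen beyond `w` on a geodesic from `v` to `p'` through `w`
    obtain ⟨u, hu, hub⟩ := exists_btw hX w p' (s := ρ - dist v w) (by linarith) (by
      unfold Btw at hb; linarith)
    unfold Btw at hb hub
    have h1 := dist_triangle v w u
    have h2 := dist_triangle v u p'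
    exact ⟨u, by linarith, by unfold Btw; linarith⟩
  · push Not at hcyc
    obtain ⟨c, hc, hwc⟩ := hcyc
    obtain ⟨h, b, k1, rfl, rfl⟩ := hc.exists_isLoop hwc
    obtain ⟨_, ⟨τ, hτ, rfl⟩, hfar'⟩ := hfar _ hc
    have hρτ := hρ.le.trans hfar'
    obtain ⟨t1, ht1, e1, l1⟩ := exists_first_exit v hτ.1
      (k1.cont.mono (Icc_subset_Icc le_rfl hτ.2)) hwρ hρτ
    have hm : ∀ s ∈ Icc (-b) (-τ), -s ∈ Icc 0 b := fun s hs =>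
      ⟨by linarith [hs.2, hτ.1], by linarith [hs.1]⟩
    obtain ⟨t2', ht2', e2, l2'⟩ := exists_first_exit (f := fun s => h (-s)) v
      (neg_le_neg hτ.2) (k1.cont.comp (by fun_prop) hm)
      (by simpa [← k1.closed] using hwρ) (by simpa using hρτ)
    obtain ⟨t2, rfl⟩ : ∃ t2, t2' = -t2 := ⟨-t2', by ring⟩
    rw [neg_neg] at e2
    have l2 : ∀ s ∈ Ioc t2 b, dist v (h s) < ρ := fun s hs => by
      simpa using l2' (-s) ⟨by linarith [hs.2], by linarith [hs.1]⟩
    have ht2 : t2 ∈ Ico τ b := ⟨by linarith [ht2'.2], by linarith [ht2'.1]⟩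
    have hu1S := hmem _ (e1.trans_lt hρ)
    have hu2S := hmem _ (e2.trans_lt hρ)
    by_contra hcon
    have n1 : Near (h 0) v (h t1) := by
      by_contra hn; exact hcon ⟨_, e1, not_near.1 hn⟩
    have n2 : Near (h 0) v (h t2) := by
      by_contra hn; exact hcon ⟨_, e2, not_near.1 hn⟩
    have n3 : Near (h 0) (h t1) (h t2) := hS _ hwS _ hu1S _ hvS _ hu2S n1.symm n2
    -- both halves of the cycle start with the same segment `[w, m]`
    unfold Near at n3
    have t3 := dist_triangle (h 0) (h t1) (h t2)
    have t4 := dist_triangle (h 0) (h t2) (h t1)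
    rw [dist_comm (h t2) (h t1)] at t4
    rw [dist_comm (h t1) (h 0)] at n3
    obtain ⟨m, hmS, hm1, hm2⟩ := hT.exists_btw hwS hu1S
      (s := (dist (h 0) (h t1) + dist (h 0) (h t2) - dist (h t1) (h t2)) / 4)
      (by linarith) (by linarith)
    have hm3 : Btw (h 0) m (h t2) :=
      hS.btw_of_gromov hwS hu1S hu2S hmS hm2 (by rw [dist_comm (h t1) (h 0)]; linarith)
    have hmne : m ≠ h 0 := by
      rintro rfl; rw [dist_self] at hm1; linarith
    obtain ⟨s1, hs1, rfl⟩ : m ∈ h '' Icc 0 t1 := by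
      refine hS.mem_image_of_btw ht1.1.le
        (k1.cont.mono (Icc_subset_Icc le_rfl (ht1.2.trans hτ.2))) ?_ hmS hm2
      rintro _ ⟨s, hs, rfl⟩
      rcases hs.2.eq_or_lt with rfl | h'
      · exact hu1S
      · exact hmem _ ((l1 s ⟨hs.1, h'⟩).trans hρ)
    obtain ⟨s2, hs2, e⟩ : h s1 ∈ h '' Icc t2 b := by
      refine hS.mem_image_of_btw ht2.2.le
        (k1.cont.mono (Icc_subset_Icc (hτ.1.trans ht2.1) le_rfl)) ?_ hmS
        (by rw [← k1.closed]; exact hm3.symm)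
      rintro _ ⟨s, hs, rfl⟩
      rcases hs.1.eq_or_lt with rfl | h'
      · exact hu2S
      · exact hmem _ ((l2 s ⟨h', hs.2⟩).trans hρ)
    have hs1' : s1 ∈ Ioo 0 b := ⟨lt_of_le_of_ne hs1.1 (by rintro rfl; exact hmne rfl),
      by linarith [hs1.2, ht1.2, ht2.1, ht2.2]⟩
    have := k1.eq_of_eq hs1' ⟨by linarith [hs2.1, ht2.1, hτ.1], hs2.2⟩ e.symm
    have : s1 = t1 := by linarith [hs1.2, hs2.1, ht1.2, ht2.1]
    rw [this] at hm1
    linarith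

/-- Around each point `v` of an `ℝ`-graph, the core is a finite star: two points of the core that
are close to `v` and on the same side of `v` are on the same geodesic issued from `v`. -/
theorem exists_core_star (hc : CompactSpace X) (hX : IsGeodesicSpace X) {v : X} {ε : ℝ}
    (hε : 0 < ε) (hT : IsRTree (Metric.ball v ε)) :
    ∃ δ > 0, δ ≤ ε ∧ ∀ p ∈ core X, ∀ q ∈ core X, dist v p < δ → dist v q < δ → Near v p q →
      dist v p ≤ dist v q → Btw v p q := by
  have hS := hT.treeSet
  have hmem : ∀ u, dist v u < ε → u ∈ Metric.ball v ε := fun u hu => by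
    rwa [Metric.mem_ball, dist_comm]
  have hvS := hmem v (by rwa [dist_self])
  have hsub : {u | dist v u = ε / 2} ⊆ Metric.ball v ε := fun u hu =>
    hmem u (by rw [show dist v u = ε / 2 from hu]; linarith)
  obtain ⟨g, hg, hgap⟩ := ((hS v hvS).mono hsub).exists_gap
    (isClosed_eq (by fun_prop) continuous_const : IsClosed {u | dist v u = ε / 2}).isCompact
    (by
      simp only [mem_ofPred_eq, dist_self]; linarith)
  refine ⟨min g (ε / 2), lt_min hg (by linarith), (min_le_right _ _).trans (by linarith), ?_⟩
  intro p hp q hq hvp hvq hn hle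
  obtain ⟨p', hp', hpb⟩ := exists_extension hX hT hp hn.left_ne (ρ := ε / 2)
    (hvp.trans_le (min_le_right _ _)) (by linarith)
  obtain ⟨q', hq', hqb⟩ := exists_extension hX hT hq hn.right_ne (ρ := ε / 2)
    (hvq.trans_le (min_le_right _ _)) (by linarith)
  have hpS := hmem p (by linarith [hvp.trans_le (min_le_right _ _)])
  have hqS := hmem q (by linarith [hvq.trans_le (min_le_right _ _)])
  have hn' : Near v p' q' :=
    hS v hvS _ (hsub hp') _ hpS _ (hsub hq') (hpb.near hn.left_ne).symm
      (hS v hvS _ hpS _ hqS _ (hsub hq') hn (hqb.near hn.right_ne))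
  have h1 := hgap p' hp' q' hq' hn'
  exact hS.btw_of_btw hvS (hsub hq') hpS hqS
    (hS.btw_of_gromov hvS (hsub hp') (hsub hq') hpS hpb
      (by linarith [hvp.trans_le (min_le_left _ _)])) hqb hle

end Core

/-! ### Sides and connected components -/

section Components

variable {X : Type u} [MetricSpace X]

theorem connectedComponents_mk_eq {A : Type v} [TopologicalSpace A] {i : A → X}
    (hi : Topology.IsInducing i) {K : Set X} (hK : IsPreconnected K) (hKi : K ⊆ range i) {p q : A}
    (hp : i p ∈ K) (hq : i q ∈ K) :
    (ConnectedComponents.mk p) = ConnectedComponents.mk q := by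
  have h1 : IsPreconnected (i ⁻¹' K) := by
    rw [← hi.isPreconnected_image, image_preimage_eq_of_subset hKi]
    exact hK
  rw [ConnectedComponents.coe_eq_coe']
  exact h1.subset_connectedComponent hq hp

theorem near_of_connectedComponents_mk_eq {A : Type v} [TopologicalSpace A] {i : A → X}
    (hi : Continuous i) {z : X} (hz : z ∉ range i) (h : NearTrans z (range i)) {p q : A}
    (hpq : (ConnectedComponents.mk p) = ConnectedComponents.mk q) : Near z (i p) (i q) := by
  rw [ConnectedComponents.coe_eq_coe'] at hpq
  have hsub : i '' connectedComponent q ⊆ range i := image_subset_range _ _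
  exact (h.mono hsub).near_of_isPreconnected
    (isPreconnected_connectedComponent.image i hi.continuousOn) (fun h => hz (hsub h))
    ⟨p, hpq, rfl⟩ ⟨q, mem_connectedComponent, rfl⟩

end Components

/-! ### Degrees in the core along a cycle -/

section KernelOfCore

variable {X : Type u} [MetricSpace X]

/-- The balls of the core are `ℝ`-trees when those of the space are. -/
theorem IsRTree.core_ball (hX : IsGeodesicSpace X) {v : core X} {ε : ℝ}
    (hT : IsRTree (Metric.ball (v : X) ε)) : IsRTree (Metric.ball v ε) := by
  refine ⟨fun a b => ?_, fun c hc => ?_⟩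
  · obtain ⟨f, f0, f1, hf⟩ := hT.geodesic ⟨(a : core X), a.2⟩ ⟨(b : core X), b.2⟩
    set D := dist a b with hD
    have D0 : 0 ≤ D := dist_nonneg
    change f D = _ at f1
    change ∀ s ∈ Icc 0 D, ∀ t ∈ Icc 0 D, _ at hf
    have harc : IsArc (fun t => (f t : X)) 0 D := by
      refine ⟨D0, ?_, fun s hs t ht e => ?_⟩
      · have hL : LipschitzOnWith 1 (fun t => (f t : X)) (Icc 0 D) :=
          LipschitzOnWith.of_dist_le_mul fun s hs t ht => by
            have := hf s hs t ht
            rw [NNReal.coe_one, one_mul, Real.dist_eq, ← this]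
            exact le_rfl
        exact hL.continuousOn
      · have := hf s hs t ht
        rw [Subtype.ext e, dist_self] at this
        exact sub_eq_zero.1 (abs_eq_zero.1 this.symm)
    have hcore : ∀ t ∈ Icc 0 D, (f t : X) ∈ core X := fun t ht =>
      harc.mem_core_of_mem_core hX (by simp only [f0]; exact a.1.2)
        (by simp only [f1]; exact b.1.2) ht
    let g : ℝ → Metric.ball v ε := fun t =>
      ⟨⟨f (projIcc 0 D D0 t), hcore _ (projIcc 0 D D0 t).2⟩, (f (projIcc 0 D D0 t)).2⟩
    have hg : ∀ t ∈ Icc 0 D, ((g t : core X) : X) = f t := fun t ht => by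
      simp only [g, projIcc_of_mem D0 ht]
    refine ⟨g, ?_, ?_, fun s hs t ht => ?_⟩
    · exact Subtype.ext (Subtype.ext ((hg 0 ⟨le_rfl, D0⟩).trans (by rw [f0])))
    · exact Subtype.ext (Subtype.ext ((hg D ⟨D0, le_rfl⟩).trans (by rw [f1])))
    · rw [← hf s hs t ht]
      change dist ((g s : core X) : X) ((g t : core X) : X) = dist (f s : X) (f t : X)
      rw [hg s hs, hg t ht]
  · obtain ⟨F, F1, F2, -⟩ := hc
    refine hT.acyclic _ ⟨fun z => (⟨((F z : core X) : X), (F z).2⟩ : Metric.ball (v : X) ε), ?_,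
      fun z w e => F2 ?_, rfl⟩
    · exact ((continuous_subtype_val.comp continuous_subtype_val).comp F1).subtype_mk _
    · have e' := congrArg Subtype.val e
      exact Subtype.ext (Subtype.ext e')

/-- A simple closed curve starts and ends with arcs that stay in a given ball. -/
theorem IsLoop.exists_arms {h : ℝ → X} {a b δ : ℝ} (hh : IsLoop h a b) (hδ : 0 < δ) :
    ∃ t₁ t₂, a < t₁ ∧ t₁ < t₂ ∧ t₂ < b ∧ (∀ s ∈ Icc a t₁, dist (h a) (h s) < δ) ∧
      ∀ s ∈ Icc t₂ b, dist (h a) (h s) < δ := by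
  have hab := hh.lt
  obtain ⟨d1, hd1, h1⟩ := Metric.continuousOn_iff.1 hh.cont a ⟨le_rfl, hab.le⟩ δ hδ
  obtain ⟨d2, hd2, h2⟩ := Metric.continuousOn_iff.1 hh.cont b ⟨hab.le, le_rfl⟩ δ hδ
  set τ := min (min (d1 / 2) (d2 / 2)) ((b - a) / 3) with hτ
  have hτ1 : τ ≤ d1 / 2 := (min_le_left _ _).trans (min_le_left _ _)
  have hτ2 : τ ≤ d2 / 2 := (min_le_left _ _).trans (min_le_right _ _)
  have hτ3 : τ ≤ (b - a) / 3 := min_le_right _ _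
  have hτ0 : 0 < τ := lt_min (lt_min (by linarith) (by linarith)) (by linarith)
  refine ⟨a + τ, b - τ, by linarith, by linarith, by linarith, fun s hs => ?_, fun s hs => ?_⟩
  · rw [dist_comm]
    refine h1 s ⟨hs.1, by linarith [hs.2]⟩ ?_
    rw [Real.dist_eq, abs_of_nonneg (by linarith [hs.1])]; linarith [hs.2]
  · rw [dist_comm, hh.closed]
    refine h2 s ⟨by linarith [hs.1], hs.2⟩ ?_
    rw [Real.dist_eq, abs_of_nonpos (by linarith [hs.2])]; linarith [hs.1]

/-- The points close to which a set `c` contains the whole core. -/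
def inner (c : Set X) : Set X := {v | ∃ δ > 0, ∀ p ∈ core X, dist v p < δ → p ∈ c}

theorem isOpen_inner (c : Set X) : IsOpen (inner c) := by
  rw [Metric.isOpen_iff]
  rintro v ⟨δ, hδ, h⟩
  refine ⟨δ / 2, by linarith, fun w hw => ⟨δ / 2, by linarith, fun p hp hwp => h p hp ?_⟩⟩
  rw [Metric.mem_ball, dist_comm] at hw
  linarith [dist_triangle v w p]

theorem IsLoop.ne_start {h : ℝ → X} {a b s : ℝ} (hh : IsLoop h a b) (hs : s ∈ Ioo a b) :
    h s ≠ h a := fun e => hs.1.ne' (hh.eq_of_eq hs ⟨le_rfl, hh.lt.le⟩ e)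

/-- The degree in the core is at most two at the points where the core is locally a cycle. -/
theorem IsLoop.degree_le_two {h : ℝ → X} {a b : ℝ} (hh : IsLoop h a b) {v : core X}
    (hv : h a = v) (hin : (v : X) ∈ inner (h '' Icc a b)) : degree v ≤ 2 := by
  have hab := hh.lt
  have hcore : ∀ s ∈ Icc a b, h s ∈ core X := fun s hs =>
    hh.isEmbeddedCycle.subset_core ⟨s, hs, rfl⟩
  refine iSup_le fun ε => iSup_le fun hε => iSup_le fun hT => ?_
  obtain ⟨t₁, t₂, l1, l2, l3, k1, k2⟩ := hh.exists_arms hε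
  rw [hv] at k1 k2
  have hi : Topology.IsInducing (fun p : ↥(Metric.ball v ε \ {v}) => ((p : core X) : X)) :=
    Topology.IsInducing.subtypeVal.comp Topology.IsInducing.subtypeVal
  have hrange : ∀ p ∈ core X, dist (v : X) p < ε → p ≠ v →
      p ∈ range (fun p : ↥(Metric.ball v ε \ {v}) => ((p : core X) : X)) := fun p hp h1 h2 =>
    ⟨⟨⟨p, hp⟩, by rw [Metric.mem_ball, dist_comm]; exact h1, fun e => h2 (congrArg Subtype.val e)⟩,
      rfl⟩
  have hne : ∀ s ∈ Ioo a b, h s ≠ v := fun s hs => hv ▸ hh.ne_start hs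
  have hm1 : t₁ ∈ Ioo a b := ⟨l1, l2.trans l3⟩
  have hm2 : t₂ ∈ Ioo a b := ⟨l1.trans l2, l3⟩
  obtain ⟨p1, hp1⟩ := hrange _ (hcore t₁ (Ioo_subset_Icc_self hm1)) (k1 t₁ ⟨l1.le, le_rfl⟩)
    (hne t₁ hm1)
  obtain ⟨p2, hp2⟩ := hrange _ (hcore t₂ (Ioo_subset_Icc_self hm2)) (k2 t₂ ⟨le_rfl, l3.le⟩)
    (hne t₂ hm2)
  obtain ⟨δ, hδ, hδc⟩ := hin
  -- the middle part of the cycle stays away from `v`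
  have hmid : ∃ δ' > 0, ∀ s ∈ Icc t₁ t₂, δ' ≤ dist (v : X) (h s) := by
    obtain ⟨s, hs, hmin⟩ := isCompact_Icc.exists_isMinOn (nonempty_Icc.2 l2.le)
      (f := fun s => dist (v : X) (h s)) ((continuous_const.dist continuous_id).comp_continuousOn
        (hh.cont.mono (Icc_subset_Icc l1.le l3.le)))
    exact ⟨dist (v : X) (h s), dist_pos.2 (hne s ⟨l1.trans_le hs.1, hs.2.trans_lt l3⟩).symm, hmin⟩
  obtain ⟨δ', hδ', hmid⟩ := hmid
  have key : ∀ k : ConnectedComponents ↥(Metric.ball v ε \ {v}),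
      k = ConnectedComponents.mk p1 ∨ k = ConnectedComponents.mk p2 := by
    intro k
    obtain ⟨q, rfl⟩ := ConnectedComponents.surjective_coe k
    have hqv : (q : core X) ≠ v := q.2.2
    have hvε : v ∈ Metric.ball v ε := Metric.mem_ball_self hε
    obtain ⟨f, f1, f2, f3, f4, f5⟩ := exists_geodesic hT.geodesic ⟨v, hvε⟩ ⟨q, q.2.1⟩
    set D := dist (⟨v, hvε⟩ : Metric.ball v ε) ⟨q, q.2.1⟩ with hD
    have hD0 : 0 < D := dist_pos.2 fun e => hqv (congrArg Subtype.val e).symm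
    set s := min D (min δ δ' / 2) with hs
    have hs0 : 0 < s := lt_min hD0 (by have := lt_min hδ hδ'; linarith)
    have hsD : s ≤ D := min_le_left _ _
    have hsδ : s < min δ δ' := by
      have := lt_min hδ hδ'
      linarith [min_le_right D (min δ δ' / 2)]
    have hfd : ∀ t ∈ Icc 0 D, dist (v : X) (f t : core X) = t := fun t ht => (f4 t ht).1
    have hK : ∀ t ∈ Icc s D, ((f t : core X) : X) ≠ v := fun t ht e => by
      have := hfd t ⟨hs0.le.trans ht.1, ht.2⟩
      rw [e, dist_self] at this
      linarith [ht.1]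
    have hKc : IsPreconnected ((fun t => ((f t : core X) : X)) '' Icc s D) :=
      isPreconnected_Icc.image _ ((continuous_subtype_val.comp
        continuous_subtype_val).comp_continuousOn (f1.cont.mono (Icc_subset_Icc hs0.le le_rfl)))
    have hball : ∀ t, dist (v : X) (f t : core X) < ε := fun t => by
      have := (f t).2
      rw [Metric.mem_ball, dist_comm] at this
      exact this
    have hm := hfd s ⟨hs0.le, hsD⟩
    obtain ⟨m, hmr⟩ := hrange _ (f s : core X).2 (hball s) (hK s ⟨le_rfl, hsD⟩)
    have hqm : ConnectedComponents.mk q = ConnectedComponents.mk m := by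
      refine connectedComponents_mk_eq hi hKc ?_ ⟨D, ⟨hsD, le_rfl⟩, ?_⟩ ⟨s, ⟨le_rfl, hsD⟩, hmr.symm⟩
      · rintro _ ⟨t, ht, rfl⟩
        exact hrange _ (f t : core X).2 (hball t) (hK t ht)
      · exact congrArg (fun z : Metric.ball v ε => ((z : core X) : X)) f3
    obtain ⟨θ, hθ, hθm⟩ := hδc _ (f s : core X).2 (hm.trans_lt (hsδ.trans_le (min_le_left _ _)))
    have hθne : h θ ≠ v := hθm ▸ hK s ⟨le_rfl, hsD⟩
    have hθa : a < θ := lt_of_le_of_ne hθ.1 (by rintro rfl; exact hθne hv)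
    have hθb : θ < b := lt_of_le_of_ne hθ.2 (by rintro rfl; exact hθne (hh.closed ▸ hv))
    have hθmid : θ < t₁ ∨ t₂ < θ := by
      by_contra hcon
      push Not at hcon
      have := hmid θ hcon
      rw [hθm, hm] at this
      linarith [min_le_right δ δ']
    have hmθ : ((m : core X) : X) = h θ := hmr.trans hθm.symm
    rw [show (q : ConnectedComponents ↥(Metric.ball v ε \ {v})) = ConnectedComponents.mk m from hqm]
    rcases hθmid with hlt | hlt
    · left
      refine connectedComponents_mk_eq hi (isPreconnected_Ioc.image h (hh.cont.mono ?_)) ?_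
        ⟨θ, ⟨hθa, hlt.le⟩, hmθ.symm⟩ ⟨t₁, ⟨l1, le_rfl⟩, hp1.symm⟩
      · exact fun t (ht : t ∈ Ioc a t₁) => ⟨ht.1.le, by linarith [ht.2]⟩
      · rintro _ ⟨t, ht, rfl⟩
        have ht' : t ∈ Ioo a b := ⟨ht.1, by linarith [ht.2]⟩
        exact hrange _ (hcore t (Ioo_subset_Icc_self ht')) (k1 t ⟨ht.1.le, ht.2⟩) (hne t ht')
    · right
      refine connectedComponents_mk_eq hi (isPreconnected_Ico.image h (hh.cont.mono ?_)) ?_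
        ⟨θ, ⟨hlt.le, hθb⟩, hmθ.symm⟩ ⟨t₂, ⟨le_rfl, l3⟩, hp2.symm⟩
      · exact fun t (ht : t ∈ Ico t₂ b) => ⟨by linarith [ht.1], ht.2.le⟩
      · rintro _ ⟨t, ht, rfl⟩
        have ht' : t ∈ Ioo a b := ⟨by linarith [ht.1], ht.2⟩
        exact hrange _ (hcore t (Ioo_subset_Icc_self ht')) (k2 t ⟨ht.1, ht.2.le⟩) (hne t ht')
  rw [← encard_univ]
  refine (encard_le_encard (t := {ConnectedComponents.mk p1, ConnectedComponents.mk p2})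
    fun k _ => key k).trans ((encard_insert_le _ _).trans ?_)
  rw [encard_singleton]
  norm_num

/-- Three points of the core, close to `v` and on different sides of `v`, are in different
components of a punctured ball of the core. -/
theorem three_le_degree (hX : IsGeodesicSpace X) {v : core X} {ε : ℝ} (hε : 0 < ε)
    (hT : IsRTree (Metric.ball (v : X) ε)) (p : Fin 3 → X) (hp : ∀ i, p i ∈ core X)
    (hpv : ∀ i, p i ≠ v) (hpε : ∀ i, dist (v : X) (p i) < ε)
    (hn : ∀ i j, i < j → ¬ Near (v : X) (p i) (p j)) : 3 ≤ degree v := by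
  refine le_trans ?_ (le_iSup_of_le ε (le_iSup_of_le hε (le_iSup_of_le (hT.core_ball hX) le_rfl)))
  let q : Fin 3 → ↥(Metric.ball v ε \ {v}) := fun i =>
    ⟨⟨p i, hp i⟩, by rw [Metric.mem_ball, dist_comm]; exact hpε i,
      fun e => hpv i (congrArg Subtype.val e)⟩
  have hi : Continuous (fun p : ↥(Metric.ball v ε \ {v}) => ((p : core X) : X)) :=
    continuous_subtype_val.comp continuous_subtype_val
  have hv : (v : X) ∉ range (fun p : ↥(Metric.ball v ε \ {v}) => ((p : core X) : X)) := by
    rintro ⟨z, hz⟩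
    exact z.2.2 (Subtype.ext hz)
  have hv' : (v : X) ∈ Metric.ball (v : X) ε := Metric.mem_ball_self hε
  have htr := (hT.treeSet _ hv').mono
    (S' := range (fun p : ↥(Metric.ball v ε \ {v}) => ((p : core X) : X)))
    (by rintro _ ⟨z, rfl⟩; exact z.2.1)
  have hinj : Function.Injective fun i => ConnectedComponents.mk (q i) := by
    intro i j e
    have h1 := near_of_connectedComponents_mk_eq hi hv htr e
    rcases lt_trichotomy i j with h | h | h
    · exact absurd h1 (hn i j h)
    · exact h
    · exact absurd h1.symm (hn j i h)
  have := ENat.card_le_card_of_injective hinj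
  simpa using this

/-- In a small ball centred at `v`, the core points that are on the same side of `v` as the
endpoint of a curve issued from `v`, and closer to `v`, are on this curve. -/
theorem mem_image_of_star {v : X} {ε δ : ℝ} (hT : IsRTree (Metric.ball v ε)) (hδε : δ ≤ ε)
    (hstar : ∀ p ∈ core X, ∀ q ∈ core X, dist v p < δ → dist v q < δ → Near v p q →
      dist v p ≤ dist v q → Btw v p q)
    {f : ℝ → X} {a b : ℝ} (hab : a ≤ b) (hf : ContinuousOn f (Icc a b)) (hfa : f a = v)
    (hfδ : ∀ s ∈ Icc a b, dist v (f s) < δ) (hfb : f b ∈ core X) {p : X} (hp : p ∈ core X)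
    (hn : Near v p (f b)) (hle : dist v p ≤ dist v (f b)) : p ∈ f '' Icc a b := by
  have hb := hfδ b ⟨hab, le_rfl⟩
  have hmem : ∀ u, dist v u < ε → u ∈ Metric.ball v ε := fun u hu => by
    rwa [Metric.mem_ball, dist_comm]
  refine hT.treeSet.mem_image_of_btw hab hf ?_ (hmem p (by linarith)) ?_
  · rintro _ ⟨s, hs, rfl⟩
    exact hmem _ ((hfδ s hs).trans_le hδε)
  · rw [hfa]
    exact hstar p hp _ hfb (hle.trans_lt hb) hb hn hle

/-- The degree in the core is at least three at the points of a cycle near which the core is not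
contained in this cycle. -/
theorem IsLoop.three_le_degree (hX : IsRGraph X) {h : ℝ → X} {a b : ℝ} (hh : IsLoop h a b)
    {v : core X} (hv : h a = v) (hin : (v : X) ∉ inner (h '' Icc a b)) : 3 ≤ degree v := by
  have hab := hh.lt
  have hcore : ∀ s ∈ Icc a b, h s ∈ core X := fun s hs =>
    hh.isEmbeddedCycle.subset_core ⟨s, hs, rfl⟩
  obtain ⟨ε, hε, hT⟩ := hX.locally_tree v
  obtain ⟨δ, hδ, hδε, hstar⟩ := exists_core_star hX.compact hX.geodesic hε hT
  obtain ⟨t₁, t₂, l1, l2, l3, k1, k2⟩ := hh.exists_arms hδ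
  rw [hv] at k1 k2
  have hm1 : t₁ ∈ Ioo a b := ⟨l1, l2.trans l3⟩
  have hm2 : t₂ ∈ Ioo a b := ⟨l1.trans l2, l3⟩
  have hc1 := hcore t₁ (Ioo_subset_Icc_self hm1)
  have hc2 := hcore t₂ (Ioo_subset_Icc_self hm2)
  have hne : ∀ s ∈ Ioo a b, h s ≠ v := fun s hs => hv ▸ hh.ne_start hs
  have arm1 : ∀ p ∈ core X, Near (v : X) p (h t₁) → dist (v : X) p ≤ dist (v : X) (h t₁) →
      p ∈ h '' Icc a t₁ := fun p hp =>
    mem_image_of_star hT hδε hstar l1.le (hh.cont.mono (Icc_subset_Icc le_rfl hm1.2.le)) hv k1 hc1 hp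
  have arm2 : ∀ p ∈ core X, Near (v : X) p (h t₂) → dist (v : X) p ≤ dist (v : X) (h t₂) →
      p ∈ h '' Icc t₂ b := by
    intro p hp h1 h2
    have hm : ∀ s ∈ Icc (-b) (-t₂), -s ∈ Icc t₂ b := fun s hs =>
      ⟨by linarith [hs.2], by linarith [hs.1]⟩
    obtain ⟨s, hs, e⟩ := mem_image_of_star (f := fun s => h (-s)) hT hδε hstar
      (neg_le_neg l3.le) ((hh.cont.mono (Icc_subset_Icc hm2.1.le le_rfl)).comp (by fun_prop) hm)
      (by rw [neg_neg, ← hh.closed, hv]) (fun s hs => k2 _ (hm s hs)) (by rwa [neg_neg]) hp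
      (by rwa [neg_neg]) (by rwa [neg_neg])
    exact ⟨-s, hm s hs, e⟩
  have hp : ∃ p ∈ core X, dist (v : X) p < min (dist (v : X) (h t₁)) (dist (v : X) (h t₂)) ∧
      p ∉ h '' Icc a b := by
    by_contra hcon
    push Not at hcon
    exact hin ⟨_, lt_min (dist_pos.2 (hne _ hm1).symm) (dist_pos.2 (hne _ hm2).symm), hcon⟩
  obtain ⟨p, hp, hpd, hpc⟩ := hp
  have hp1 := hpd.trans_le (min_le_left _ _)
  have hp2 := hpd.trans_le (min_le_right _ _)
  have d1 := k1 t₁ ⟨l1.le, le_rfl⟩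
  have d2 := k2 t₂ ⟨le_rfl, l3.le⟩
  refine RGraphs.three_le_degree hX.geodesic hε hT ![p, h t₁, h t₂] ?_ ?_ ?_ ?_
  · intro i; fin_cases i
    exacts [hp, hc1, hc2]
  · intro i; fin_cases i
    exacts [fun e => hpc ⟨a, ⟨le_rfl, hab.le⟩, hv.trans e.symm⟩, hne _ hm1, hne _ hm2]
  · intro i; fin_cases i
    exacts [(hp1.trans d1).trans_le hδε, d1.trans_le hδε, d2.trans_le hδε]
  · have n01 : ¬ Near (v : X) p (h t₁) := fun hn =>
      hpc (image_mono (Icc_subset_Icc le_rfl hm1.2.le) (arm1 p hp hn hp1.le))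
    have n02 : ¬ Near (v : X) p (h t₂) := fun hn =>
      hpc (image_mono (Icc_subset_Icc hm2.1.le le_rfl) (arm2 p hp hn hp2.le))
    have n12 : ¬ Near (v : X) (h t₁) (h t₂) := by
      intro hn
      rcases le_total (dist (v : X) (h t₁)) (dist (v : X) (h t₂)) with hle | hle
      · obtain ⟨s, hs, e⟩ := arm2 _ hc1 hn hle
        have := hh.eq_of_eq hm1 ⟨hm2.1.le.trans hs.1, hs.2⟩ e.symm
        linarith [hs.1]
      · obtain ⟨s, hs, e⟩ := arm1 _ hc2 hn.symm hle
        have := hh.eq_of_eq hm2 ⟨hs.1, hs.2.trans hm1.2.le⟩ e.symm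
        linarith [hs.2]
    intro i j hij
    fin_cases i <;> fin_cases j <;> first | exact absurd hij (by decide) | assumption

/-- A cycle contains points near which it coincides with the core. -/
theorem IsLoop.exists_inner (hX : IsRGraph X) {h : ℝ → X} {a b : ℝ} (hh : IsLoop h a b) :
    ∃ t ∈ Icc a b, h t ∈ inner (h '' Icc a b) := by
  have hab := hh.lt
  have hcore : ∀ s ∈ Icc a b, h s ∈ core X := fun s hs =>
    hh.isEmbeddedCycle.subset_core ⟨s, hs, rfl⟩
  obtain ⟨ε, hε, hT⟩ := hX.locally_tree (h a)
  obtain ⟨δ, hδ, hδε, hstar⟩ := exists_core_star hX.compact hX.geodesic hε hT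
  obtain ⟨t₁, t₂, l1, l2, l3, k1, k2⟩ := hh.exists_arms hδ
  have hm1 : t₁ ∈ Ioo a b := ⟨l1, l2.trans l3⟩
  have hpos : 0 < dist (h a) (h t₁) := dist_pos.2 (hh.ne_start hm1).symm
  have hc : ContinuousOn (fun s => dist (h a) (h s)) (Icc a t₁) :=
    (continuous_const.dist continuous_id).comp_continuousOn
      (hh.cont.mono (Icc_subset_Icc le_rfl hm1.2.le))
  obtain ⟨s, hs, e⟩ := intermediate_value_Icc l1.le hc
    (show dist (h a) (h t₁) / 2 ∈ Icc _ _ by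
      simp only [dist_self]; exact ⟨by linarith, by linarith⟩)
  simp only at e
  have has : a < s := lt_of_le_of_ne hs.1 (by rintro rfl; rw [dist_self] at e; linarith)
  -- the two points `h s` and `h t₁` are on the same side of `h a`
  have hns : Near (h a) (h s) (h t₁) := by
    have hsub : h '' Ioc a t₁ ⊆ Metric.ball (h a) ε := by
      rintro _ ⟨t, ht, rfl⟩
      rw [Metric.mem_ball, dist_comm]
      exact (k1 t ⟨ht.1.le, ht.2⟩).trans_le hδε
    refine ((hT.treeSet _ (Metric.mem_ball_self hε)).mono hsub).near_of_isPreconnected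
      (isPreconnected_Ioc.image h (hh.cont.mono ?_)) ?_ ⟨s, ⟨has, hs.2⟩, rfl⟩
      ⟨t₁, ⟨l1, le_rfl⟩, rfl⟩
    · exact fun t (ht : t ∈ Ioc a t₁) => ⟨ht.1.le, by linarith [ht.2, hm1.2]⟩
    · rintro ⟨t, ht, e⟩
      exact hh.ne_start ⟨ht.1, by linarith [ht.2, hm1.2]⟩ e
  refine ⟨s, ⟨hs.1, hs.2.trans hm1.2.le⟩, dist (h a) (h t₁) / 4, by linarith, fun p hp hsp => ?_⟩
  have h1 : dist (h a) p < dist (h a) (h t₁) := by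
    linarith [dist_triangle (h a) (h s) p]
  have h2 : Near (h a) p (h t₁) := by
    have h3 : Near (h a) (h s) p := near_of_dist_lt (by rw [dist_comm (h s) (h a)]; linarith)
    have hmem : ∀ u, dist (h a) u < ε → u ∈ Metric.ball (h a) ε := fun u hu => by
      rwa [Metric.mem_ball, dist_comm]
    have d1 := k1 t₁ ⟨l1.le, le_rfl⟩
    exact hT.treeSet _ (Metric.mem_ball_self hε) _ (hmem p (by linarith)) _
      (hmem (h s) (by linarith)) _ (hmem (h t₁) (by linarith)) h3.symm hns
  exact image_mono (Icc_subset_Icc le_rfl hm1.2.le) (mem_image_of_star hT hδε hstar l1.le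
    (hh.cont.mono (Icc_subset_Icc le_rfl hm1.2.le)) rfl k1
    (hcore t₁ (Ioo_subset_Icc_self hm1)) hp h2 h1.le)

end KernelOfCore

/-! ### Cycles contain kernel edges -/

section ShortCycles

variable {X : Type u} [MetricSpace X]

theorem IsLoop.mem_core {h : ℝ → X} {a b s : ℝ} (hh : IsLoop h a b) (hs : s ∈ Icc a b) :
    h s ∈ core X := hh.isEmbeddedCycle.subset_core ⟨s, hs, rfl⟩

/-- On a cycle, the vertices of the kernel are the points near which the core is not contained in
the cycle. -/
theorem IsLoop.mem_kernelVertices_iff (hX : IsRGraph X) {h : ℝ → X} {a b : ℝ} (hh : IsLoop h a b)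
    {v : core X} (hv : (v : X) ∈ h '' Icc a b) :
    v ∈ kernelVertices (core X) ↔ (v : X) ∉ inner (h '' Icc a b) := by
  obtain ⟨s, hs, hsv⟩ := hv
  obtain ⟨k, a', b', hk, hka, hkc, -⟩ := hh.rotate hs
  rw [← hkc]
  refine ⟨fun h1 h2 => ?_, fun h1 => hk.three_le_degree hX (hka.trans hsv) h1⟩
  have h3 : (3 : ℕ∞) ≤ 2 := le_trans h1 (hk.degree_le_two (hka.trans hsv) h2)
  exact absurd h3 (by decide)

/-- A part of a cycle, parametrised by a subinterval, is not longer than the cycle. -/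
theorem IsLoop.edgeLength_le {h : ℝ → X} {a b s t : ℝ} (hh : IsLoop h a b) (hs : a ≤ s)
    (hst : s < t) (ht : t ≤ b) {e : Set (core X)} (he : Subtype.val '' e = h '' Icc s t) :
    edgeLength e ≤ eVariationOn h (Icc a b) := by
  have hpos : 0 < t - s := sub_pos.2 hst
  have hm : ∀ w : I, s + w * (t - s) ∈ Icc s t := fun w =>
    ⟨by nlinarith [w.2.1], by nlinarith [w.2.2]⟩
  have hm' : ∀ w : I, s + w * (t - s) ∈ Icc a b := fun w =>
    Icc_subset_Icc hs ht (hm w)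
  let γ : I → core X := fun w => ⟨h (s + w * (t - s)), hh.mem_core (hm' w)⟩
  have hγ : Continuous γ := (hh.cont.comp_continuous (by fun_prop) hm').subtype_mk _
  refine iInf_le_of_le γ (iInf_le_of_le hγ (iInf_le_of_le ?_ (iInf_le_of_le ?_ ?_)))
  · intro w hw w' hw' e
    have key : ∀ w : I, w ≠ 1 → s + w * (t - s) ∈ Ico a b := fun w hw => by
      refine ⟨(hm' w).1, ?_⟩
      have : (w : ℝ) < 1 := lt_of_le_of_ne w.2.2 fun e => hw (Subtype.ext e)
      nlinarith
    have := hh.inj (key w hw) (key w' hw') (congrArg Subtype.val e)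
    exact Subtype.ext (mul_right_cancel₀ hpos.ne' (by linarith))
  · refine Subtype.val_injective.image_injective ?_
    rw [he]
    ext p
    constructor
    · rintro ⟨_, ⟨w, rfl⟩, rfl⟩
      exact ⟨_, hm w, rfl⟩
    · rintro ⟨u, hu, rfl⟩
      refine ⟨_, ⟨⟨(u - s) / (t - s), div_nonneg (by linarith [hu.1]) hpos.le, ?_⟩, rfl⟩, ?_⟩
      · rw [div_le_one hpos]; linarith [hu.2]
      · simp only [γ]
        congr 1
        field_simp
        ring
  · have h1 : eVariationOn (h ∘ fun w : I => s + w * (t - s)) univ ≤ eVariationOn h (Icc a b) :=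
      eVariationOn.comp_le_of_monotoneOn h _
        (fun w _ w' _ hww' => by
          have : (w : ℝ) ≤ w' := hww'
          nlinarith) (fun w _ => hm' w)
    exact h1

/-- Every cycle contains an edge of the kernel: follow the cycle, in both directions, from a point
near which it coincides with the core up to the next vertices. -/
theorem IsLoop.exists_kernelEdge (hX : IsRGraph X) {h : ℝ → X} {a b : ℝ} (hh : IsLoop h a b) :
    ∃ e ∈ kernelEdges (core X), edgeLength e ≤ eVariationOn h (Icc a b) := by
  set c := h '' Icc a b with hc
  have hcc : IsClosed c := (isCompact_Icc.image_of_continuousOn hh.cont).isClosed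
  have hccore : c ⊆ core X := hh.isEmbeddedCycle.subset_core
  have hinner : ∀ p ∈ core X, p ∈ inner c → p ∈ c := fun p hp hin => by
    obtain ⟨δ, hδ, h1⟩ := hin
    exact h1 p hp (by rwa [dist_self])
  have hcov : Subtype.val '' (Subtype.val ⁻¹' c : Set (core X)) = c := by
    rw [image_preimage_eq_of_subset]; rwa [Subtype.range_val]
  by_cases hall : ∀ p ∈ c, p ∈ inner c
  · have hu : h a ∈ c := ⟨a, ⟨le_rfl, hh.lt.le⟩, rfl⟩
    set z : core X := ⟨h a, hccore hu⟩ with hz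
    have hnv : (Subtype.val ⁻¹' c : Set (core X)) ⊆ (kernelVertices (core X))ᶜ := fun p hp hpv =>
      (hh.mem_kernelVertices_iff hX hp).1 hpv (hall _ hp)
    have hcl : IsClosed (Subtype.val ⁻¹' c : Set (core X)) := hcc.preimage continuous_subtype_val
    have hop : IsOpen (Subtype.val ⁻¹' c : Set (core X)) := by
      have : (Subtype.val ⁻¹' c : Set (core X)) = Subtype.val ⁻¹' inner c :=
        Subset.antisymm (fun p hp => hall _ hp) fun p hp => hinner _ p.2 hp
      rw [this]
      exact (isOpen_inner c).preimage continuous_subtype_val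
    have hcomp : connectedComponentIn (kernelVertices (core X))ᶜ z = Subtype.val ⁻¹' c := by
      refine Subset.antisymm ?_ ?_
      · exact isPreconnected_connectedComponentIn.subset_isClopen ⟨hcl, hop⟩
          ⟨z, mem_connectedComponentIn (hnv hu), hu⟩
      · refine IsPreconnected.subset_connectedComponentIn ?_ hu hnv
        rw [← Topology.IsInducing.subtypeVal.isPreconnected_image, hcov]
        exact isPreconnected_Icc.image h hh.cont
    refine ⟨_, ⟨z, hnv hu, rfl⟩, ?_⟩
    rw [hcomp, hcl.closure_eq]
    exact hh.edgeLength_le le_rfl hh.lt le_rfl hcov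
  · push Not at hall
    obtain ⟨_, ⟨t, ht, rfl⟩, hnin⟩ := hall
    -- the cycle is parametrised from a vertex `k a'`
    obtain ⟨k, a', b', hk, hka, hkc, hkv⟩ := hh.rotate ht
    rw [← hka] at hnin
    rw [← hc] at hkc
    obtain ⟨t₀, ht₀, hin₀⟩ := hk.exists_inner hX
    rw [hkc] at hin₀
    have hBcl : IsClosed (c ∩ (inner c)ᶜ) := hcc.inter (isOpen_inner c).isClosed_compl
    have hkmem : ∀ s ∈ Icc a' b', k s ∈ c := fun s hs => hkc ▸ ⟨s, hs, rfl⟩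
    have hab' := hk.lt.le
    obtain ⟨τ₂, hτ₂, hB₂, hlast⟩ := exists_last_mem (hk.cont.mono (Icc_subset_Icc le_rfl ht₀.2))
      hBcl ⟨a', ⟨le_rfl, ht₀.1⟩, hkmem _ ⟨le_rfl, hab'⟩, hnin⟩
    obtain ⟨τ₁, hτ₁, hB₁, hfirst⟩ := exists_first_mem (hk.cont.mono (Icc_subset_Icc ht₀.1 le_rfl))
      hBcl ⟨b', ⟨ht₀.2, le_rfl⟩, hkmem _ ⟨hab', le_rfl⟩, hk.closed ▸ hnin⟩
    have h2 : τ₂ < t₀ := lt_of_le_of_ne hτ₂.2 fun e => hB₂.2 (e ▸ hin₀)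
    have h1 : t₀ < τ₁ := lt_of_le_of_ne hτ₁.1 fun e => hB₁.2 (e ▸ hin₀)
    have hAI : ∀ s ∈ Ioo τ₂ τ₁, s ∈ Ioo a' b' := fun s hs =>
      ⟨hτ₂.1.trans_lt hs.1, hs.2.trans_le hτ₁.2⟩
    have hsubI : Icc τ₂ τ₁ ⊆ Icc a' b' := Icc_subset_Icc hτ₂.1 hτ₁.2
    have hAin : ∀ s ∈ Ioo τ₂ τ₁, k s ∈ inner c := by
      intro s hs
      by_contra hn
      have hsB : k s ∈ c ∩ (inner c)ᶜ := ⟨hkmem s (Ioo_subset_Icc_self (hAI s hs)), hn⟩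
      rcases le_or_gt s t₀ with hle | hlt
      · exact hlast s ⟨hs.1, hle⟩ hsB
      · exact hfirst s ⟨hlt.le, hs.2⟩ hsB
    set F : Set X := k '' Icc τ₂ τ₁ with hF
    set A : Set X := k '' Ioo τ₂ τ₁ with hA
    have hFcl : IsClosed F := (isCompact_Icc.image_of_continuousOn (hk.cont.mono hsubI)).isClosed
    have hFcore : F ⊆ core X := by
      rintro _ ⟨s, hs, rfl⟩; exact hk.mem_core (hsubI hs)
    have hAF : A ⊆ F := image_mono Ioo_subset_Icc_self
    have hApre : ∀ p ∈ A, p ∈ inner c := by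
      rintro _ ⟨s, hs, rfl⟩; exact hAin s hs
    have hmk : ∀ v : core X, (v : X) ∈ c → (v ∈ kernelVertices (core X) ↔ (v : X) ∉ inner c) :=
      fun v hv => hh.mem_kernelVertices_iff hX hv
    have hnv : (Subtype.val ⁻¹' A : Set (core X)) ⊆ (kernelVertices (core X))ᶜ := fun p hp hpv =>
      (hmk p (hinner _ p.2 (hApre _ hp))).1 hpv (hApre _ hp)
    -- the open arc `A` is open in the core
    have hOcl : IsClosed (k '' Icc a' τ₂ ∪ k '' Icc τ₁ b') :=
      ((isCompact_Icc.image_of_continuousOn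
        (hk.cont.mono (Icc_subset_Icc le_rfl (by linarith [hτ₁.2])))).union
        (isCompact_Icc.image_of_continuousOn
        (hk.cont.mono (Icc_subset_Icc (by linarith [hτ₂.1]) le_rfl)))).isClosed
    have hAopen : IsOpen (Subtype.val ⁻¹' A : Set (core X)) := by
      have : (Subtype.val ⁻¹' A : Set (core X)) =
          Subtype.val ⁻¹' (inner c ∩ (k '' Icc a' τ₂ ∪ k '' Icc τ₁ b')ᶜ) := by
        ext p
        constructor
        · rintro hp
          refine ⟨hApre _ hp, ?_⟩
          obtain ⟨s, hs, e⟩ := hp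
          rintro (⟨s', hs', e'⟩ | ⟨s', hs', e'⟩)
          · have := hk.eq_of_eq (hAI s hs) ⟨hs'.1, by linarith [hs'.2, hτ₁.2]⟩ (e.trans e'.symm)
            linarith [hs'.2, hs.1]
          · have := hk.eq_of_eq (hAI s hs) ⟨by linarith [hs'.1, hτ₂.1], hs'.2⟩ (e.trans e'.symm)
            linarith [hs'.1, hs.2]
        · rintro ⟨hp1, hp2⟩
          have hpc := hinner _ p.2 hp1
          rw [← hkc] at hpc
          obtain ⟨s, hs, e⟩ := hpc
          refine ⟨s, ⟨?_, ?_⟩, e⟩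
          · by_contra hn; exact hp2 (Or.inl ⟨s, ⟨hs.1, not_lt.1 hn⟩, e⟩)
          · by_contra hn; exact hp2 (Or.inr ⟨s, ⟨not_lt.1 hn, hs.2⟩, e⟩)
      rw [this]
      exact ((isOpen_inner c).inter hOcl.isOpen_compl).preimage continuous_subtype_val
    have hcovA : Subtype.val '' (Subtype.val ⁻¹' A : Set (core X)) = A := by
      rw [image_preimage_eq_of_subset]; rw [Subtype.range_val]; exact hAF.trans hFcore
    have hu : k t₀ ∈ A := ⟨t₀, ⟨h2, h1⟩, rfl⟩
    set z : core X := ⟨k t₀, hFcore (hAF hu)⟩ with hz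
    have hcomp : connectedComponentIn (kernelVertices (core X))ᶜ z = Subtype.val ⁻¹' A := by
      refine Subset.antisymm ?_ ?_
      · refine isPreconnected_connectedComponentIn.subset_left_of_subset_union hAopen
          (hFcl.isOpen_compl.preimage continuous_subtype_val) ?_ ?_
          ⟨z, mem_connectedComponentIn (hnv hu), hu⟩
        · exact disjoint_left.2 fun p hp hp' => hp' (hAF hp)
        · intro p hp
          have hpV : p ∉ kernelVertices (core X) := connectedComponentIn_subset _ _ hp
          by_cases hpF : (p : X) ∈ F
          · left
            obtain ⟨s, hs, e⟩ := hpF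
            have hpc : (p : X) ∈ c := e ▸ hkmem s (hsubI hs)
            have hpin : (p : X) ∈ inner c := by
              by_contra hn; exact hpV ((hmk p hpc).2 hn)
            refine ⟨s, ⟨lt_of_le_of_ne hs.1 ?_, lt_of_le_of_ne hs.2 ?_⟩, e⟩
            · rintro rfl; exact hB₂.2 (e ▸ hpin)
            · rintro rfl; exact hB₁.2 (e ▸ hpin)
          · exact Or.inr hpF
      · refine IsPreconnected.subset_connectedComponentIn ?_ hu hnv
        rw [← Topology.IsInducing.subtypeVal.isPreconnected_image, hcovA]
        exact isPreconnected_Ioo.image k (hk.cont.mono fun s hs => Ioo_subset_Icc_self (hAI s hs))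
    refine ⟨_, ⟨z, hnv hu, rfl⟩, ?_⟩
    rw [hcomp]
    refine (hk.edgeLength_le hτ₂.1 (h2.trans h1) hτ₁.2 ?_).trans hkv
    have hclA : closure A = F := by
      refine Subset.antisymm (closure_minimal hAF hFcl) ?_
      have := ContinuousOn.image_closure (f := k) (s := Ioo τ₂ τ₁)
        (by rw [closure_Ioo (h2.trans h1).ne]; exact hk.cont.mono hsubI)
      rwa [closure_Ioo (h2.trans h1).ne] at this
    ext p
    constructor
    · rintro ⟨q, hq, rfl⟩
      rw [closure_subtype, hcovA, hclA] at hq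
      exact hq
    · intro hp
      refine ⟨⟨p, hFcore hp⟩, ?_, rfl⟩
      rw [closure_subtype, hcovA, hclA]
      exact hp

/-- In an `ℝ`-graph whose kernel edges have length at least `r`, being on the same side of a point
is transitive in the ball of radius `r / 6`: there is no cycle of length less than `r`. -/
theorem IsElliptic.nearTrans {r : ℝ} (hX : IsElliptic r X) (x : X) :
    NearTrans x (Metric.ball x (r / 6)) := by
  intro p hp q hq w hw h1 h2
  by_contra h3
  obtain ⟨h, s, t, hh, -, hv⟩ := exists_isLoop_of_not_near hX.isRGraph.geodesic h1 h2 h3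
  obtain ⟨e, he, hle⟩ := hh.exists_kernelEdge hX.isRGraph
  have h4 := ((hX.le_edgeLength e he).trans hle).trans hv
  have hd : ∀ p ∈ Metric.ball x (r / 6), ∀ q ∈ Metric.ball x (r / 6), dist p q < r / 3 := by
    intro p hp q hq
    have := dist_triangle_right p q x
    rw [Metric.mem_ball] at hp hq
    linarith
  rw [edist_dist, edist_dist, edist_dist, ← ENNReal.ofReal_add dist_nonneg dist_nonneg,
    ← ENNReal.ofReal_add dist_nonneg (by positivity), ENNReal.ofReal_le_ofReal_iff (by positivity)]
    at h4
  linarith [hd p hp q hq, hd q hq w hw, hd p hp w hw]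

end ShortCycles

/-! ### The two sides of a point of degree two -/

section TwoSides

variable {X : Type u} [MetricSpace X]

theorem range_subtypeVal_ball_diff (x : X) (ε : ℝ) :
    range (Subtype.val : ↥(Metric.ball x ε \ {x}) → X) = Metric.ball x ε \ {x} :=
  Subtype.range_val

/-- A point of degree two has at most two sides. -/
theorem near_of_degree_le_two (hX : IsRGraph X) {x : X} (hd : degree x ≤ 2) {ρ : ℝ}
    (hρ : NearTrans x (Metric.ball x ρ)) (p : Fin 3 → X) (hpx : ∀ i, p i ≠ x)
    (hp : ∀ i, p i ∈ Metric.ball x ρ) : ∃ i j, i < j ∧ Near x (p i) (p j) := by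
  obtain ⟨ε, hε, hT⟩ := hX.locally_tree x
  -- each of the points is moved towards `x`, into a ball that is a tree
  have hm : ∀ i, ∃ m, m ∈ Metric.ball x ε \ {x} ∧ m ∈ Metric.ball x ρ ∧ Near x m (p i) := by
    intro i
    have h0 : 0 < dist x (p i) := dist_pos.2 (hpx i).symm
    obtain ⟨m, hm1, hm2⟩ := exists_btw hX.geodesic x (p i) (s := min (dist x (p i)) (ε / 2))
      (by positivity) (min_le_left _ _)
    have hmx : m ≠ x := by
      rintro rfl
      rw [dist_self] at hm1
      have : 0 < min (dist m (p i)) (ε / 2) := lt_min h0 (by linarith)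
      linarith
    have h1 := min_le_left (dist x (p i)) (ε / 2)
    have h2 := min_le_right (dist x (p i)) (ε / 2)
    have h3 := hp i
    rw [Metric.mem_ball, dist_comm] at h3
    refine ⟨m, ⟨?_, hmx⟩, ?_, hm2.near hmx⟩
    · rw [Metric.mem_ball, dist_comm]; linarith
    · rw [Metric.mem_ball, dist_comm]; linarith
  choose m hm1 hm2 hm3 using hm
  have hcard : ENat.card (ConnectedComponents ↥(Metric.ball x ε \ {x})) ≤ 2 := by
    refine le_trans ?_ hd
    exact le_iSup_of_le ε (le_iSup_of_le hε (le_iSup_of_le hT le_rfl))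
  have hninj : ¬ Function.Injective fun i : Fin 3 =>
      (ConnectedComponents.mk (⟨m i, hm1 i⟩ : ↥(Metric.ball x ε \ {x}))) := by
    intro hinj
    have h1 := (ENat.card_le_card_of_injective hinj).trans hcard
    have h2 : (3 : ℕ∞) ≤ 2 := by simpa using h1
    exact absurd h2 (by decide)
  have hnear : ∀ i j, ConnectedComponents.mk (⟨m i, hm1 i⟩ : ↥(Metric.ball x ε \ {x})) =
      ConnectedComponents.mk ⟨m j, hm1 j⟩ → Near x (p i) (p j) := by
    intro i j e
    have h1 : Near x (m i) (m j) :=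
      near_of_connectedComponents_mk_eq continuous_subtype_val
        (by rw [range_subtypeVal_ball_diff]; simp)
        ((hT.treeSet x (Metric.mem_ball_self hε)).mono
          (by rw [range_subtypeVal_ball_diff]; exact sdiff_subset)) e
    have h2 := hρ _ (hp i) _ (hm2 i) _ (hm2 j) (hm3 i).symm h1
    exact hρ _ (hp i) _ (hm2 j) _ (hp j) h2 (hm3 j)
  simp only [Function.Injective, not_forall] at hninj
  obtain ⟨i, j, e, hne⟩ := hninj
  rcases lt_or_gt_of_ne hne with h | h
  · exact ⟨i, j, h, hnear i j e⟩
  · exact ⟨j, i, h, hnear j i e.symm⟩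

/-- A point of degree two that does not disconnect the space is the midpoint of a geodesic of
given length, within the radius where being on the same side of this point is transitive. -/
theorem exists_opposite (hX : IsRGraph X) {x : X} (hx : IsPreconnected ({x}ᶜ : Set X))
    (hd : 2 ≤ degree x) {ρ s : ℝ} (hρ : NearTrans x (Metric.ball x ρ)) (hs : 0 < s)
    (hsρ : s < ρ) : ∃ v w, dist v x = s ∧ dist w x = s ∧ ¬ Near x v w := by
  -- two points close to `x`, on different sides of `x`
  have hex : ∃ ε, 0 < ε ∧ IsRTree (Metric.ball x ε) ∧
      2 ≤ ENat.card (ConnectedComponents ↥(Metric.ball x ε \ {x})) := by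
    by_contra hcon
    push Not at hcon
    have : degree x ≤ 1 := iSup_le fun ε => iSup_le fun hε => iSup_le fun hT =>
      Order.le_of_lt_add_one (by rw [one_add_one_eq_two]; exact hcon ε hε hT)
    exact absurd (hd.trans this) (by decide)
  obtain ⟨ε, hε, hT, hcard⟩ := hex
  have hnt : Nontrivial (ConnectedComponents ↥(Metric.ball x ε \ {x})) := by
    rw [← ENat.one_lt_card_iff_nontrivial]
    exact lt_of_lt_of_le (by decide) hcard
  obtain ⟨k, k', hkk'⟩ := hnt
  obtain ⟨p, rfl⟩ := ConnectedComponents.surjective_coe k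
  obtain ⟨q, rfl⟩ := ConnectedComponents.surjective_coe k'
  have hxε : x ∈ Metric.ball x ε := Metric.mem_ball_self hε
  have htree := hT.treeSet x hxε
  have hpq : ¬ Near x (p : X) q := by
    intro hn
    refine hkk' ?_
    -- a geodesic from `p` to `q` inside the tree avoids `x`
    have hn' : Near (⟨x, hxε⟩ : Metric.ball x ε) ⟨p, p.2.1⟩ ⟨q, q.2.1⟩ := hn
    obtain ⟨f, a, b, h1, h2, h3, h4, -⟩ := hn'.arcIn hT.geodesic
    refine connectedComponents_mk_eq (X := X) Topology.IsInducing.subtypeVal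
      ((isPreconnected_Icc.image f h1.cont).image _ continuous_subtype_val.continuousOn) ?_
      ⟨f a, ⟨a, ⟨le_rfl, h1.le⟩, rfl⟩, by rw [h2]⟩ ⟨f b, ⟨b, ⟨h1.le, le_rfl⟩, rfl⟩, by rw [h3]⟩
    rw [range_subtypeVal_ball_diff]
    rintro _ ⟨z, hz, rfl⟩
    exact ⟨z.2, fun e => h4 hz (Subtype.ext e)⟩
  have hmove : ∀ p : X, p ≠ x → ∃ m, m ≠ x ∧ dist m x < s ∧ Btw x m p := by
    intro p hp
    have h0 : 0 < dist x p := dist_pos.2 hp.symm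
    obtain ⟨m, hm1, hm2⟩ := exists_btw hX.geodesic x p (s := min (dist x p) (s / 2))
      (by positivity) (min_le_left _ _)
    have h1 : 0 < min (dist x p) (s / 2) := lt_min h0 (by linarith)
    refine ⟨m, ?_, ?_, hm2⟩
    · rintro rfl; rw [dist_self] at hm1; linarith
    · rw [dist_comm]; linarith [min_le_right (dist x p) (s / 2)]
  obtain ⟨p', hp'x, hp's, hp'⟩ := hmove p p.2.2
  obtain ⟨q', hq'x, hq's, hq'⟩ := hmove q q.2.2
  have hball : ∀ u m : X, u ∈ Metric.ball x ε → Btw x m u → m ∈ Metric.ball x ε := by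
    intro u m hu hm
    rw [Metric.mem_ball, dist_comm] at *
    unfold Btw at hm
    linarith [dist_nonneg (x := m) (y := u)]
  have hpq' : ¬ Near x p' q' := by
    intro hn
    have hp'ε := hball _ _ p.2.1 hp'
    have hq'ε := hball _ _ q.2.1 hq'
    exact hpq (htree _ p.2.1 _ hp'ε _ q.2.1 (hp'.near hp'x).symm
      (htree _ hp'ε _ hq'ε _ q.2.1 hn (hq'.near hq'x)))
  have hin : ∀ u : X, dist u x ≤ s → u ∈ Metric.ball x ρ := fun u hu =>
    Metric.mem_ball.2 (hu.trans_lt hsρ)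
  -- otherwise a whole side of `x` is contained in a small ball and disconnected from the rest
  have key : ∀ p q : X, p ≠ x → q ≠ x → dist p x < s → dist q x < s → ¬ Near x p q →
      ∃ v, dist v x = s ∧ Near x p v := by
    intro p q hp hq hps hqs hn
    by_contra hcon
    push Not at hcon
    have h1 := hx.subset_left_of_subset_union (u := {u | dist u x < s ∧ Near x p u})
      (v := {u | x ≠ u ∧ ¬ (dist u x < s ∧ Near x p u)}) ?_ ?_ ?_ ?_ ⟨p, hp, hps, near_self hp⟩
    · exact hn (h1 hq).2
    · refine IsOpen.inter (s := {u | dist u x < s}) (t := {u | Near x p u})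
        (isOpen_lt (by fun_prop) continuous_const) ?_
      exact isOpen_lt (f := fun u => dist p u) (g := fun u => dist p x + dist x u)
        (by fun_prop) (by fun_prop)
    · rw [Metric.isOpen_iff]
      rintro u ⟨hux, hu⟩
      have hpos : 0 < dist u x := dist_pos.2 hux.symm
      by_cases hus : dist u x ≤ s
      · refine ⟨min (dist u x) (ρ - s), lt_min hpos (by linarith), fun w hw => ?_⟩
        have hwd : dist w u < dist u x := lt_of_lt_of_le hw (min_le_left _ _)
        have hun : Near x u w := near_of_dist_lt (by rwa [dist_comm])
        refine ⟨hun.right_ne.symm, fun hw' => hu ?_⟩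
        have hpu : Near x p u := hρ _ (hin p hps.le) _ (hin w hw'.1.le) _ (hin u hus)
          hw'.2 hun.symm
        exact ⟨lt_of_le_of_ne hus fun e => hcon u e hpu, hpu⟩
      · push Not at hus
        refine ⟨dist u x - s, by linarith, fun w hw => ?_⟩
        rw [Metric.mem_ball] at hw
        have := dist_triangle u w x
        rw [dist_comm u w] at this
        refine ⟨?_, fun hw' => by linarith [hw'.1]⟩
        rintro rfl
        rw [dist_comm] at hw
        linarith
    · exact disjoint_left.2 fun u h1 h2 => h2.2 h1
    · intro u hu
      by_cases h : dist u x < s ∧ Near x p u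
      · exact Or.inl h
      · exact Or.inr ⟨fun e => hu e.symm, h⟩
  obtain ⟨v, hv, hpv⟩ := key p' q' hp'x hq'x hp's hq's hpq'
  obtain ⟨w, hw, hqw⟩ := key q' p' hq'x hp'x hq's hp's fun h => hpq' h.symm
  refine ⟨v, w, hv, hw, fun hn => hpq' ?_⟩
  exact hρ _ (hin _ hp's.le) _ (hin _ hv.le) _ (hin _ hq's.le) hpv
    (hρ _ (hin _ hv.le) _ (hin _ hw.le) _ (hin _ hq's.le) hn hqw.symm)

end TwoSides

/-! ### Cut distances and chains -/

section CutDist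

variable {X : Type u} [MetricSpace X] {x : X}

theorem edist_toCut (hX : IsRGraph X) (hx : x ∈ conn X) (a b : {y : X // y ≠ x}) :
    edist (toCut hX hx a) (toCut hX hx b) = puncturedEDist x a b :=
  UniformSpace.Completion.edist_eq (α := PuncturedSpace hX hx) a b

open Classical in
/-- The distance in the cut space between two points of `X \ {x}`, as a function on all pairs of
points of `X` that takes the value `0` if one of them is `x`. -/
noncomputable def cutDist (hX : IsRGraph X) (hx : x ∈ conn X) (a b : X) : ℝ :=
  if h : a ≠ x ∧ b ≠ x then dist (toCut hX hx ⟨a, h.1⟩) (toCut hX hx ⟨b, h.2⟩) else 0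

theorem cutDist_eq (hX : IsRGraph X) (hx : x ∈ conn X) (a b : {y : X // y ≠ x}) :
    cutDist hX hx a b = dist (toCut hX hx a) (toCut hX hx b) :=
  dif_pos ⟨a.2, b.2⟩

theorem cutDist_self (hX : IsRGraph X) (hx : x ∈ conn X) (a : X) : cutDist hX hx a a = 0 := by
  unfold cutDist
  split_ifs
  · exact dist_self _
  · rfl

theorem cutDist_comm (hX : IsRGraph X) (hx : x ∈ conn X) (a b : X) :
    cutDist hX hx a b = cutDist hX hx b a := by
  unfold cutDist
  by_cases ha : a ≠ x <;> by_cases hb : b ≠ x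
  · rw [dif_pos ⟨ha, hb⟩, dif_pos ⟨hb, ha⟩, dist_comm]
  all_goals rw [dif_neg (by tauto), dif_neg (by tauto)]

theorem cutDist_nonneg (hX : IsRGraph X) (hx : x ∈ conn X) (a b : X) : 0 ≤ cutDist hX hx a b := by
  unfold cutDist
  split_ifs
  · exact dist_nonneg
  · exact le_rfl

theorem cutDist_triangle (hX : IsRGraph X) (hx : x ∈ conn X) (a : X) {b : X} (hb : b ≠ x) (c : X) :
    cutDist hX hx a c ≤ cutDist hX hx a b + cutDist hX hx b c := by
  by_cases h : a ≠ x ∧ c ≠ x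
  · have h1 := cutDist_eq hX hx ⟨a, h.1⟩ ⟨c, h.2⟩
    have h2 := cutDist_eq hX hx ⟨a, h.1⟩ ⟨b, hb⟩
    have h3 := cutDist_eq hX hx ⟨b, hb⟩ ⟨c, h.2⟩
    rw [h1, h2, h3]
    exact dist_triangle _ _ _
  · have h0 : cutDist hX hx a c = 0 := dif_neg h
    rw [h0]
    exact add_nonneg (cutDist_nonneg _ _ _ _) (cutDist_nonneg _ _ _ _)

theorem cutDist_le_dist (hX : IsRGraph X) (hx : x ∈ conn X) {a b : X} (h : Near x a b) :
    cutDist hX hx a b ≤ dist a b := by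
  have h1 := cutDist_eq hX hx ⟨a, h.left_ne⟩ ⟨b, h.right_ne⟩
  refine h1.le.trans ?_
  rw [← ENNReal.ofReal_le_ofReal_iff dist_nonneg, ← edist_dist, ← edist_dist, edist_toCut]
  obtain ⟨f, f1, f2, f3, f4, f5⟩ := exists_geodesic hX.geodesic a b
  have hm : ∀ t : I, (t : ℝ) * dist a b ∈ Icc 0 (dist a b) := fun t =>
    ⟨mul_nonneg t.2.1 dist_nonneg, mul_le_of_le_one_left dist_nonneg t.2.2⟩
  let γ : Path a b := ⟨⟨fun t => f ((t : ℝ) * dist a b),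
    f1.cont.comp_continuous (by fun_prop) hm⟩, by simp [f2], by simp [f3]⟩
  refine (iInf₂_le γ fun t e => ?_).trans (le_trans ?_ f5)
  · have e' : f ((t : ℝ) * dist a b) = x := e
    have h1 := f4 _ (hm t)
    rw [e'] at h1
    unfold Near at h
    linarith
  · exact eVariationOn.comp_le_of_monotoneOn f (fun t : I => (t : ℝ) * dist a b)
      (fun s _ t _ hst => mul_le_mul_of_nonneg_right (by exact_mod_cast hst) dist_nonneg)
      (fun t _ => hm t)

theorem cutDist_le_sum (hX : IsRGraph X) (hx : x ∈ conn X) (p : ℕ → X) (N : ℕ)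
    (hp : ∀ i < N, Near x (p i) (p (i + 1))) :
    cutDist hX hx (p 0) (p N) ≤ ∑ i ∈ Finset.range N, dist (p i) (p (i + 1)) := by
  induction N with
  | zero => simp [cutDist_self]
  | succ N ih =>
    rw [Finset.sum_range_succ]
    have h := hp N (Nat.lt_succ_self N)
    exact (cutDist_triangle hX hx _ h.left_ne _).trans
      (add_le_add (ih fun i hi => hp i (hi.trans (Nat.lt_succ_self N))) (cutDist_le_dist hX hx h))

/-- The distance in the cut space is approximated by the lengths of chains of points, with
arbitrarily small steps, whose consecutive points are on the same side of `x`. -/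
theorem exists_chain (hX : IsRGraph X) (hx : x ∈ conn X) {a b : X} (ha : a ≠ x) (hb : b ≠ x)
    {L : ℝ} (hL : cutDist hX hx a b < L) {s : ℝ} (hs : 0 < s) :
    ∃ (N : ℕ) (p : ℕ → X), 0 < N ∧ p 0 = a ∧ p N = b ∧
      (∀ i < N, Near x (p i) (p (i + 1)) ∧ dist (p i) (p (i + 1)) ≤ s) ∧
      ∑ i ∈ Finset.range N, dist (p i) (p (i + 1)) ≤ L := by
  have hL0 : 0 < L := (cutDist_nonneg hX hx a b).trans_lt hL
  have h1 := cutDist_eq hX hx ⟨a, ha⟩ ⟨b, hb⟩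
  have h2 : puncturedEDist x ⟨a, ha⟩ ⟨b, hb⟩ < ENNReal.ofReal L := by
    rw [← edist_toCut hX hx, edist_dist, ← h1]
    exact (ENNReal.ofReal_lt_ofReal_iff hL0).2 hL
  unfold puncturedEDist at h2
  simp only [iInf_lt_iff] at h2
  obtain ⟨f, hf, hfL⟩ := h2
  obtain ⟨t₀, -, hmin⟩ := isCompact_univ.exists_isMinOn univ_nonempty
    (f := fun t : I => dist (f t) x) (by fun_prop)
  set θ := dist (f t₀) x with hθ
  have hθ0 : 0 < θ := dist_pos.2 (hf t₀)
  have hθf : ∀ t, θ ≤ dist (f t) x := fun t => hmin (mem_univ t)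
  have huc : UniformContinuous f := CompactSpace.uniformContinuous_of_continuous f.continuous
  obtain ⟨δ, hδ, hδf⟩ := Metric.uniformContinuous_iff.1 huc (min s θ) (lt_min hs hθ0)
  obtain ⟨N, hN⟩ := exists_nat_one_div_lt hδ
  set M := N + 1 with hM
  have hM0 : (0 : ℝ) < M := by positivity
  let w : ℕ → I := fun i => projIcc (0 : ℝ) 1 zero_le_one (i / M)
  have hw : Monotone w := fun i j hij => monotone_projIcc _ (by gcongr)
  have hstep : ∀ i, dist (f (w i)) (f (w (i + 1))) < min s θ := by
    intro i
    refine hδf ?_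
    have h3 : dist (w i) (w (i + 1)) ≤ dist ((i : ℝ) / M) ((i + 1 : ℕ) / M) := by
      have h4 := (LipschitzWith.projIcc (zero_le_one (α := ℝ))).dist_le_mul
        ((i : ℝ) / M) ((i + 1 : ℕ) / M)
      rw [NNReal.coe_one, one_mul] at h4
      exact h4
    refine h3.trans_lt (lt_of_eq_of_lt ?_ hN)
    rw [Real.dist_eq, ← sub_div, abs_div, abs_of_pos hM0, hM]
    push_cast
    congr 1
    rw [abs_sub_comm]
    simp
  refine ⟨M, fun i => f (w i), Nat.succ_pos N, ?_, ?_, fun i _ => ⟨?_, ?_⟩, ?_⟩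
  · have : w 0 = 0 := by simp [w]
    simp [this]
  · have : w M = 1 := by simp [w]
    simp [this]
  · exact near_of_dist_lt ((hstep i).trans_le ((min_le_right _ _).trans (hθf _)))
  · exact (hstep i).le.trans (min_le_left _ _)
  · have h5 := eVariationOn.sum_le (f := f) (s := univ) (n := M) hw (fun _ => mem_univ _)
    have h6 : ENNReal.ofReal (∑ i ∈ Finset.range M, dist (f (w i)) (f (w (i + 1)))) <
        ENNReal.ofReal L := by
      rw [ENNReal.ofReal_sum_of_nonneg fun _ _ => dist_nonneg]
      refine lt_of_le_of_lt (le_of_eq_of_le ?_ h5) hfL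
      refine Finset.sum_congr rfl fun i _ => ?_
      rw [← edist_dist, edist_comm]
    exact ((ENNReal.ofReal_lt_ofReal_iff hL0).1 h6).le

theorem Near.of_chain {ρ : ℝ} (hρ : NearTrans x (Metric.ball x ρ)) (p : ℕ → X) (hp0 : p 0 ≠ x)
    (N : ℕ) (hp : ∀ i < N, Near x (p i) (p (i + 1))) (hb : ∀ i ≤ N, dist (p i) x < ρ) :
    Near x (p 0) (p N) := by
  induction N with
  | zero => exact near_self hp0
  | succ N ih =>
    exact hρ _ (hb 0 (Nat.zero_le _)) _ (hb N (Nat.le_succ N)) _ (hb (N + 1) le_rfl)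
      (ih (fun i hi => hp i (hi.trans (Nat.lt_succ_self N))) fun i hi => hb i (hi.trans
        (Nat.le_succ N))) (hp N (Nat.lt_succ_self N))

end CutDist

/-! ### Transfer of cut distances through correspondences -/

section Comparison

/-- The properties of a marked point `x` of an `ℝ`-graph `X` that are used to compare cut spaces:
`x` is a point of the core of degree two that does not disconnect `X`, and being on the same side
of `x` is transitive in the ball of radius `ρ` centred at `x`. The radius `ρ` is explicit because
it has to be the same for all the spaces of a sequence. -/
structure CutAt {X : Type u} [MetricSpace X] (ρ : ℝ) (x : X) : Prop where
  isRGraph : IsRGraph X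
  mem_conn : x ∈ conn X
  degree_eq : degree x = 2
  nearTrans : NearTrans x (Metric.ball x ρ)

/-- `C` is a correspondence, of distortion at most `ε`, between the pointed spaces `(X, x)` and
`(Y, y)`. Its measurability plays no role in the comparison of distances, and is not required. -/
structure PointedCorr {X : Type u} {Y : Type v} [MetricSpace X] [MetricSpace Y] (x : X) (y : Y)
    (C : Set (X × Y)) (ε : ℝ) : Prop where
  base : (x, y) ∈ C
  exists_right : ∀ p, ∃ q, (p, q) ∈ C
  exists_left : ∀ q, ∃ p, (p, q) ∈ C
  dist_le : ∀ p q p' q', (p, q) ∈ C → (p', q') ∈ C → |dist p p' - dist q q'| ≤ ε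

variable {Y : Type v} [MetricSpace Y] {y : Y}

theorem eventually_mul_lt (k : ℝ) {c : ℝ} (hc : 0 < c) : ∀ᶠ ε in 𝓝[>] (0 : ℝ), k * ε < c := by
  have h : Tendsto (fun ε : ℝ => k * ε) (𝓝[>] 0) (𝓝 (k * 0)) :=
    ((continuous_const.mul continuous_id).tendsto 0).mono_left nhdsWithin_le_nhds
  rw [mul_zero] at h
  exact h.eventually (gt_mem_nhds hc)

section Corr

variable {X : Type u} [MetricSpace X] {x : X} {C : Set (X × Y)} {ε : ℝ}

theorem PointedCorr.le_add (h : PointedCorr x y C ε) {p p' : X} {q q' : Y} (hp : (p, q) ∈ C)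
    (hp' : (p', q') ∈ C) : dist p p' ≤ dist q q' + ε ∧ dist q q' ≤ dist p p' + ε := by
  have := abs_le.1 (h.dist_le p q p' q' hp hp')
  constructor <;> linarith

theorem PointedCorr.base_le_add (h : PointedCorr x y C ε) {p : X} {q : Y} (hp : (p, q) ∈ C) :
    dist p x ≤ dist q y + ε ∧ dist q y ≤ dist p x + ε :=
  h.le_add hp h.base

/-- Points on the same side of `y`, with a margin, correspond to points on the same side of `x`. -/
theorem PointedCorr.near (h : PointedCorr x y C ε) {p p' : X} {q q' : Y} (hp : (p, q) ∈ C)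
    (hp' : (p', q') ∈ C) (hn : dist q q' + 3 * ε < dist q y + dist y q') : Near x p p' := by
  have h1 := h.le_add hp hp'
  have h2 := h.base_le_add hp
  have h3 := h.base_le_add hp'
  unfold Near
  rw [dist_comm x] at *
  rw [dist_comm y] at hn
  linarith

end Corr

/-- For given points `a` and `b`, cut distances are upper semicontinuous: an almost optimal chain
from `a` to `b` corresponds to a chain of the other space. -/
theorem cutDist_le_pointwise (hY : IsRGraph Y) (hy : y ∈ conn Y) {a b : Y} (ha : a ≠ y)
    (hb : b ≠ y) {κ : ℝ} (hκ : 0 < κ) :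
    ∀ᶠ ε in 𝓝[>] (0 : ℝ), ∀ (X : Type u) [MetricSpace X] (x : X) (hX : IsRGraph X)
      (hx : x ∈ conn X) (C : Set (X × Y)), PointedCorr x y C ε → ∀ a' b', (a', a) ∈ C →
      (b', b) ∈ C → cutDist hX hx a' b' ≤ cutDist hY hy a b + κ := by
  obtain ⟨N, q, hN, rfl, rfl, hq, hsum⟩ := exists_chain hY hy ha hb
    (lt_add_of_pos_right _ (half_pos hκ)) one_pos
  have hgap : ∀ᶠ ε in 𝓝[>] (0 : ℝ), ∀ i ∈ Finset.range N,
      3 * ε < dist (q i) y + dist y (q (i + 1)) - dist (q i) (q (i + 1)) := by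
    rw [eventually_all_finset]
    intro i hi
    exact eventually_mul_lt 3 (sub_pos.2 (hq i (Finset.mem_range.1 hi)).1)
  filter_upwards [hgap, eventually_mul_lt N (half_pos hκ)] with ε h1 h2
  intro X _ x hX hx C hC a' b' ha' hb'
  choose g hg using hC.exists_left
  let p : ℕ → X := fun i => if i = 0 then a' else if i = N then b' else g (q i)
  have hp : ∀ i, (p i, q i) ∈ C := by
    intro i
    simp only [p]
    split_ifs with h3 h4
    · rw [h3]; exact ha'
    · rw [h4]; exact hb'
    · exact hg _
  have hp0 : p 0 = a' := by simp [p]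
  have hpN : p N = b' := by simp [p, hN.ne']
  have hnear : ∀ i < N, Near x (p i) (p (i + 1)) := fun i hi =>
    hC.near (hp i) (hp (i + 1)) (by linarith [h1 i (Finset.mem_range.2 hi)])
  have h3 := cutDist_le_sum hX hx p N hnear
  rw [hp0, hpN] at h3
  have h4 : ∑ i ∈ Finset.range N, dist (p i) (p (i + 1)) ≤
      ∑ i ∈ Finset.range N, (dist (q i) (q (i + 1)) + ε) :=
    Finset.sum_le_sum fun i _ => (hC.le_add (hp i) (hp (i + 1))).1
  rw [Finset.sum_add_distrib, Finset.sum_const, Finset.card_range, nsmul_eq_mul] at h4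
  linarith

/-- The upper bound of `cutDist_le_pointwise` holds uniformly for points that are not close to the
marked point, by compactness. -/
theorem cutDist_le_uniform (hY : IsRGraph Y) (hy : y ∈ conn Y) {ζ κ : ℝ} (hζ : 0 < ζ)
    (hκ : 0 < κ) :
    ∀ᶠ ε in 𝓝[>] (0 : ℝ), ∀ (X : Type u) [MetricSpace X] (x : X) (hX : IsRGraph X)
      (hx : x ∈ conn X) (C : Set (X × Y)), PointedCorr x y C ε → ∀ a b a' b', (a', a) ∈ C →
      (b', b) ∈ C → ζ ≤ dist a y → ζ ≤ dist b y →
      cutDist hX hx a' b' ≤ cutDist hY hy a b + κ := by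
  have := hY.compact
  have hK : IsCompact {a : Y | ζ ≤ dist a y} :=
    (isClosed_le continuous_const (by fun_prop)).isCompact
  have hθ : 0 < min (κ / 16) (ζ / 4) := lt_min (by linarith) (by linarith)
  obtain ⟨t, htK, htf, hcov⟩ := hK.finite_cover_balls hθ
  have hne : ∀ f ∈ t, f ≠ y := by
    rintro f hf rfl
    have : ζ ≤ dist f f := htK hf
    rw [dist_self] at this
    linarith
  have hpt := (htf.eventually_all (l := 𝓝[>] (0 : ℝ))).2 fun f hf =>
    (htf.eventually_all (l := 𝓝[>] (0 : ℝ))).2 fun f' hf' =>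
      cutDist_le_pointwise.{u} hY hy (hne f hf) (hne f' hf') (show 0 < κ / 4 by linarith)
  filter_upwards [hpt, eventually_mul_lt 1 hθ, self_mem_nhdsWithin] with ε h1 h2 h0
  intro X _ x hX hx C hC a b a' b' ha' hb' haζ hbζ
  have hε0 : 0 < ε := h0
  have hm1 := min_le_left (κ / 16) (ζ / 4)
  have hm2 := min_le_right (κ / 16) (ζ / 4)
  have happ : ∀ a a', (a', a) ∈ C → ζ ≤ dist a y → ∃ f ∈ t, ∃ f', (f', f) ∈ C ∧ f' ≠ x ∧
      cutDist hX hx a' f' ≤ κ / 8 ∧ cutDist hY hy f a ≤ κ / 16 := by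
    intro a a' ha haζ
    obtain ⟨f, hft, hf⟩ : ∃ f ∈ t, dist a f < min (κ / 16) (ζ / 4) := by
      have := hcov haζ
      simp only [mem_iUnion, Metric.mem_ball, exists_prop] at this
      exact this
    obtain ⟨f', hf'⟩ := hC.exists_left f
    have h3 := hC.le_add ha hf'
    have h4 := hC.base_le_add ha
    have hn : Near x a' f' := near_of_dist_lt (by linarith)
    have hn' : Near y f a := (near_of_dist_lt (by linarith)).symm
    refine ⟨f, hft, f', hf', hn.right_ne, ?_, ?_⟩
    · linarith [cutDist_le_dist hX hx hn]
    · linarith [cutDist_le_dist hY hy hn', dist_comm f a]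
  obtain ⟨f, hft, f', hf', hfx, hf1, hf2⟩ := happ a a' ha' haζ
  obtain ⟨e, het, e', he', hex, he1, he2⟩ := happ b b' hb' hbζ
  have hmain := h1 f hft e het X x hX hx C hC f' e' hf' he'
  have hay : a ≠ y := by rintro rfl; rw [dist_self] at haζ; linarith
  have hby : b ≠ y := by rintro rfl; rw [dist_self] at hbζ; linarith
  have k1 := cutDist_triangle hX hx a' hfx b'
  have k2 := cutDist_triangle hX hx f' hex b'
  have k3 := cutDist_triangle hY hy f hay e
  have k4 := cutDist_triangle hY hy a hby e
  rw [cutDist_comm hX hx e' b'] at k2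
  rw [cutDist_comm hY hy b e] at k4
  linarith

/-- The two sides of the marked point match through a correspondence of small distortion. -/
theorem near_of_near (ρ : ℝ) (hY : CutAt ρ y) {ζ : ℝ} (hζ : 0 < ζ) (hζρ : ζ ≤ ρ / 2) :
    ∀ᶠ ε in 𝓝[>] (0 : ℝ), ∀ (X : Type u) [MetricSpace X] (x : X) (_ : CutAt ρ x)
      (C : Set (X × Y)), PointedCorr x y C ε → ∀ p q p' q', (p, q) ∈ C → (p', q') ∈ C →
      ζ ≤ dist p x → dist p x ≤ 3 * ρ / 4 → ζ ≤ dist p' x → dist p' x ≤ 3 * ρ / 4 →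
      Near x p p' → Near y q q' := by
  have := hY.isRGraph.compact
  have hρ : 0 < ρ := by linarith
  set K : Set Y := {q | ζ / 2 ≤ dist q y ∧ dist q y ≤ 7 * ρ / 8} with hK
  have hKc : IsCompact K := (IsClosed.inter (s₁ := {q | ζ / 2 ≤ dist q y})
    (s₂ := {q | dist q y ≤ 7 * ρ / 8}) (isClosed_le continuous_const (by fun_prop))
    (isClosed_le (by fun_prop) continuous_const)).isCompact
  have hKb : K ⊆ Metric.ball y ρ := fun q hq => Metric.mem_ball.2 (by linarith [hq.2])
  have hyK : y ∉ K := fun h => by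
    have := h.1
    rw [dist_self] at this
    linarith
  obtain ⟨g, hg, hgap⟩ := (hY.nearTrans.mono hKb).exists_gap hKc hyK
  filter_upwards [eventually_mul_lt 1 (half_pos hζ), eventually_mul_lt 8 hρ,
    eventually_mul_lt 3 hg, self_mem_nhdsWithin] with ε h1 h2 h3 h0
  intro X _ x hX C hC p q p' q' hp hp' hpζ hpρ hpζ' hpρ' hn
  have hε0 : 0 < ε := h0
  have hmem : ∀ p q, (p, q) ∈ C → ζ ≤ dist p x → dist p x ≤ 3 * ρ / 4 → q ∈ K := by
    intro p q h4 h5 h6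
    have := hC.base_le_add h4
    exact ⟨by linarith, by linarith⟩
  have hback : ∀ p q p' q', (p, q) ∈ C → (p', q') ∈ C → q ∈ K → q' ∈ K → Near y q q' →
      Near x p p' := fun p q p' q' h4 h5 h6 h7 h8 =>
    hC.near h4 h5 (by linarith [hgap q h6 q' h7 h8])
  have hball : ∀ p, dist p x ≤ 3 * ρ / 4 → p ∈ Metric.ball x ρ := fun p h4 =>
    Metric.mem_ball.2 (by linarith)
  obtain ⟨v, w, hv, hw, hvw⟩ := exists_opposite hX.isRGraph hX.mem_conn.2.isPreconnected
    hX.degree_eq.ge hX.nearTrans (half_pos hρ) (by linarith)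
  obtain ⟨V, hV⟩ := hC.exists_right v
  obtain ⟨W, hW⟩ := hC.exists_right w
  have hqK := hmem p q hp hpζ hpρ
  have hqK' := hmem p' q' hp' hpζ' hpρ'
  have hVK := hmem v V hV (by linarith) (by linarith)
  have hWK := hmem w W hW (by linarith) (by linarith)
  have hvb := hball v (by linarith)
  have hwb := hball w (by linarith)
  have hVW : ¬ Near y V W := fun h4 => hvw (hback v V w W hV hW hVK hWK h4)
  -- each point of `K` is on the side of `V` or on the side of `W`
  have hside : ∀ q ∈ K, Near y q V ∨ Near y q W := by
    intro q hq
    have hne : ∀ q ∈ K, q ≠ y := fun q hq e => hyK (e ▸ hq)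
    obtain ⟨i, j, hij, h4⟩ := near_of_degree_le_two hY.isRGraph hY.degree_eq.le hY.nearTrans
      ![q, V, W] (by intro i; fin_cases i; exacts [hne q hq, hne V hVK, hne W hWK])
      (by intro i; fin_cases i; exacts [hKb hq, hKb hVK, hKb hWK])
    fin_cases i <;> fin_cases j <;>
      first | exact absurd hij (by decide) | exact Or.inl h4 | exact Or.inr h4 | exact absurd h4 hVW
  rcases hside q hqK with h4 | h4 <;> rcases hside q' hqK' with h5 | h5
  · exact hY.nearTrans _ (hKb hqK) _ (hKb hVK) _ (hKb hqK') h4 h5.symm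
  · refine absurd ?_ hvw
    have k1 := hback _ _ _ _ hp hV hqK hVK h4
    have k2 := hback _ _ _ _ hp' hW hqK' hWK h5
    exact hX.nearTrans _ hvb _ (hball p hpρ) _ hwb k1.symm
      (hX.nearTrans _ (hball p hpρ) _ (hball p' hpρ') _ hwb hn k2)
  · refine absurd ?_ hvw
    have k1 := hback _ _ _ _ hp hW hqK hWK h4
    have k2 := hback _ _ _ _ hp' hV hqK' hVK h5
    exact hX.nearTrans _ hvb _ (hball p' hpρ') _ hwb k2.symm
      (hX.nearTrans _ (hball p' hpρ') _ (hball p hpρ) _ hwb hn.symm k1)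
  · exact hY.nearTrans _ (hKb hqK) _ (hKb hWK) _ (hKb hqK') h4 h5.symm

/-- Transfer of a chain of points of `X` to `Y`, the hypothesis `hside` being the conclusion of
`near_of_near`. The steps of the chain may be much smaller than `ε`, so they cannot be transferred
one by one. The chain is cut into pieces instead: a piece that starts at distance at least `ρ / 2`
from `x` is followed until its length is at least `ρ / 8`, a piece that starts closer to `x` until
it is at distance at least `ρ / 2` from `x`. The endpoints of a piece are on the same side of the
marked point, in `X` as in `Y`, so that each piece costs an error `ε`. Two pieces of the second
kind are never consecutive, so the number of pieces is bounded by the length of the chain; the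
constants are such that a piece of the first kind pays for itself and for the next piece. -/
theorem cutDist_le_of_chain {X : Type u} [MetricSpace X] {x : X} {ρ ζ ε : ℝ} (hX : CutAt ρ x)
    (hY : CutAt ρ y) {C : Set (X × Y)} (hC : PointedCorr x y C ε) (hζ : 0 < ζ) (hζρ : ζ ≤ ρ / 4)
    (hε : 0 < ε) (hερ : 8 * ε < ρ)
    (hside : ∀ p q p' q', (p, q) ∈ C → (p', q') ∈ C → ζ ≤ dist p x → dist p x ≤ 3 * ρ / 4 →
      ζ ≤ dist p' x → dist p' x ≤ 3 * ρ / 4 → Near x p p' → Near y q q') (N : ℕ) :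
    ∀ (p : ℕ → X) (q q' : Y), (p 0, q) ∈ C → (p N, q') ∈ C →
      (∀ i < N, Near x (p i) (p (i + 1)) ∧ dist (p i) (p (i + 1)) ≤ ρ / 8) →
      ζ ≤ dist (p 0) x → ζ ≤ dist (p N) x →
      cutDist hY.isRGraph hY.mem_conn q q' ≤ ∑ i ∈ Finset.range N, dist (p i) (p (i + 1)) +
        ε * (16 * (∑ i ∈ Finset.range N, dist (p i) (p (i + 1))) / ρ + 3) ∧
      (ρ / 2 ≤ dist (p 0) x → cutDist hY.isRGraph hY.mem_conn q q' ≤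
        ∑ i ∈ Finset.range N, dist (p i) (p (i + 1)) +
        ε * (16 * (∑ i ∈ Finset.range N, dist (p i) (p (i + 1))) / ρ + 2)) := by
  induction N using Nat.strong_induction_on with
  | _ N ih =>
  intro p q q' hq hq' hp h0 hN
  set S : ℕ → ℝ := fun j => ∑ i ∈ Finset.range j, dist (p i) (p (i + 1)) with hS
  have hS0 : ∀ j, 0 ≤ S j := fun j => Finset.sum_nonneg fun _ _ => dist_nonneg
  have hdS : ∀ j, dist (p 0) (p j) ≤ S j := fun j => dist_le_range_sum_dist p j
  change cutDist _ _ q q' ≤ S N + ε * (16 * S N / ρ + 3) ∧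
    (_ → cutDist _ _ q q' ≤ S N + ε * (16 * S N / ρ + 2))
  have hρ : 0 < ρ := by linarith
  have hSN : 0 ≤ 16 * S N / ρ := div_nonneg (by linarith [hS0 N]) hρ.le
  -- a piece that ends at time `j`, followed by the rest of the chain
  have hrest : ∀ j, 0 < j → j ≤ N → ζ ≤ dist (p j) x → ∀ q₁, (p j, q₁) ∈ C → Near y q q₁ →
      cutDist hY.isRGraph hY.mem_conn q q' ≤ S N + ε * (16 * (S N - S j) / ρ + 4) ∧
      (ρ / 2 ≤ dist (p j) x → cutDist hY.isRGraph hY.mem_conn q q' ≤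
        S N + ε * (16 * (S N - S j) / ρ + 3)) := by
    intro j hj0 hjN hjζ q₁ hq₁ hn
    obtain ⟨m, rfl⟩ := Nat.exists_eq_add_of_le hjN
    obtain ⟨h1, h2⟩ := ih m (by omega) (fun i => p (j + i)) q₁ q' hq₁ hq'
      (fun i hi => hp (j + i) (by omega)) hjζ hN
    have hsum : S (j + m) - S j = ∑ i ∈ Finset.range m, dist (p (j + i)) (p (j + (i + 1))) := by
      simp only [hS, Finset.sum_range_add, add_sub_cancel_left, add_assoc]
    rw [← hsum] at h1 h2
    have h3 := cutDist_triangle hY.isRGraph hY.mem_conn q hn.right_ne q'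
    have h4 := cutDist_le_dist hY.isRGraph hY.mem_conn hn
    have h5 := (hC.le_add hq hq₁).2
    have h6 := hdS j
    refine ⟨by linarith, fun h => ?_⟩
    have h7 := h2 h
    linarith
  have hlast : Near y q q' → cutDist hY.isRGraph hY.mem_conn q q' ≤ S N + ε := by
    intro hn
    have h4 := cutDist_le_dist hY.isRGraph hY.mem_conn hn
    have h5 := (hC.le_add hq hq').2
    linarith [hdS N]
  have hmono : ∀ a b, a ≤ b → S N + ε * (16 * S N / ρ + a) ≤ S N + ε * (16 * S N / ρ + b) :=
    fun a b hab => by gcongr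
  have hεS : S N + ε ≤ S N + ε * (16 * S N / ρ + 2) := by nlinarith
  rcases le_or_gt (ρ / 2) (dist (p 0) x) with hout | hin
  · suffices h : cutDist hY.isRGraph hY.mem_conn q q' ≤ S N + ε * (16 * S N / ρ + 2) from
      ⟨h.trans (hmono 2 3 (by norm_num)), fun _ => h⟩
    have hqy := (hC.base_le_add hq).1
    by_cases hex : ∃ j, j ≤ N ∧ ρ / 8 ≤ S j
    · classical
      obtain ⟨hjN, hj⟩ := Nat.find_spec hex
      have hmin := fun i (hi : i < Nat.find hex) => Nat.find_min hex hi
      set j := Nat.find hex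
      have hj0 : 0 < j := by
        rcases Nat.eq_zero_or_pos j with h | h
        · rw [h] at hj
          simp only [hS, Finset.range_zero, Finset.sum_empty] at hj
          linarith
        · exact h
      obtain ⟨i, hi⟩ : ∃ i, j = i + 1 := ⟨j - 1, by omega⟩
      have hSi : S i < ρ / 8 := by
        by_contra hcon
        exact hmin i (by omega) ⟨by omega, not_lt.1 hcon⟩
      have hSj : S j ≤ ρ / 4 := by
        have : S j = S i + dist (p i) (p (i + 1)) := by
          rw [hi]; exact Finset.sum_range_succ _ _
        have h1 := (hp i (by omega)).2
        linarith
      obtain ⟨q₁, hq₁⟩ := hC.exists_right (p j)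
      have h1 := (hC.le_add hq hq₁).2
      have h2 := dist_triangle (p 0) (p j) x
      obtain ⟨h3, -⟩ := hrest j hj0 hjN (by linarith [hdS j]) q₁ hq₁
        (near_of_dist_lt (by linarith [hdS j]))
      refine h3.trans ?_
      have h4 : 16 * (S N - S j) / ρ + 4 ≤ 16 * S N / ρ + 2 := by
        have h5 : 2 ≤ 16 * S j / ρ := by rw [le_div_iff₀ hρ]; linarith
        have h6 : 16 * (S N - S j) / ρ = 16 * S N / ρ - 16 * S j / ρ := by ring
        linarith
      have := mul_le_mul_of_nonneg_left h4 hε.le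
      linarith
    · push Not at hex
      have h1 := hex N le_rfl
      have h2 := (hC.le_add hq hq').2
      exact (hlast (near_of_dist_lt (by linarith [hdS N]))).trans hεS
  · refine ⟨?_, fun h => absurd h (not_le.2 hin)⟩
    have hp0 : p 0 ≠ x := by intro e; rw [e, dist_self] at h0; linarith
    by_cases hex : ∃ j, j ≤ N ∧ ρ / 2 ≤ dist (p j) x
    · classical
      obtain ⟨hjN, hj⟩ := Nat.find_spec hex
      have hmin := fun i (hi : i < Nat.find hex) => Nat.find_min hex hi
      set j := Nat.find hex
      have hj0 : 0 < j := by
        rcases Nat.eq_zero_or_pos j with h | h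
        · rw [h] at hj; linarith
        · exact h
      obtain ⟨i, hi⟩ : ∃ i, j = i + 1 := ⟨j - 1, by omega⟩
      have hlt : ∀ i < j, dist (p i) x < ρ / 2 := fun i hi => by
        by_contra hcon
        exact hmin i hi ⟨by omega, not_lt.1 hcon⟩
      have hjd : dist (p j) x ≤ 3 * ρ / 4 := by
        have h1 := (hp i (by omega)).2
        have h2 := dist_triangle (p (i + 1)) (p i) x
        rw [dist_comm (p (i + 1)) (p i)] at h2
        rw [hi]
        linarith [hlt i (by omega)]
      have hn : Near x (p 0) (p j) := Near.of_chain hX.nearTrans p hp0 j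
        (fun i hi => (hp i (by omega)).1) fun i hi => by
          rcases hi.eq_or_lt with h | h
          · rw [h]; linarith
          · linarith [hlt i h]
      obtain ⟨q₁, hq₁⟩ := hC.exists_right (p j)
      have hn' := hside _ _ _ _ hq hq₁ h0 (by linarith) (by linarith) hjd hn
      obtain ⟨-, h3⟩ := hrest j hj0 hjN (by linarith) q₁ hq₁ hn'
      refine (h3 hj).trans ?_
      have h4 : 16 * (S N - S j) / ρ + 3 ≤ 16 * S N / ρ + 3 := by
        gcongr; linarith [hS0 j]
      have := mul_le_mul_of_nonneg_left h4 hε.le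
      linarith
    · push Not at hex
      have hn : Near x (p 0) (p N) := Near.of_chain hX.nearTrans p hp0 N
        (fun i hi => (hp i hi).1) fun i hi => by linarith [hex i hi]
      have hn' := hside _ _ _ _ hq hq' h0 (by linarith) hN (by linarith [hex N le_rfl]) hn
      exact (hlast hn').trans (hεS.trans (hmono 2 3 (by norm_num)))

theorem exists_cutDist_le (hY : IsRGraph Y) (hy : y ∈ conn Y) {ζ : ℝ} (hζ : 0 < ζ) :
    ∃ D, 0 ≤ D ∧ ∀ a b, ζ ≤ dist a y → ζ ≤ dist b y → cutDist hY hy a b ≤ D := by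
  have := hY.compact
  have hK : IsCompact {a : Y | ζ ≤ dist a y} :=
    (isClosed_le continuous_const (by fun_prop)).isCompact
  have hne : ∀ a, ζ ≤ dist a y → a ≠ y := by
    rintro a ha rfl
    rw [dist_self] at ha
    linarith
  have hK' : IsCompact (Subtype.val ⁻¹' {a : Y | ζ ≤ dist a y} : Set {a : Y // a ≠ y}) := by
    rw [Subtype.isCompact_iff, image_preimage_eq_of_subset]
    · exact hK
    · exact fun a ha => ⟨⟨a, hne a ha⟩, rfl⟩
  obtain ⟨D, hD⟩ := Metric.isBounded_iff.1 (hK'.image (continuous_toCut hY hy)).isBounded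
  refine ⟨max D 0, le_max_right _ _, fun a b ha hb => ?_⟩
  refine (cutDist_eq hY hy ⟨a, hne a ha⟩ ⟨b, hne b hb⟩).le.trans ((hD ?_ ?_).trans (le_max_left _ _))
  · exact ⟨_, ha, rfl⟩
  · exact ⟨_, hb, rfl⟩

/-- Away from the marked points, a correspondence of small distortion between the spaces has a
small distortion for the distances of the cut spaces. -/
theorem abs_cutDist_sub_le {ρ : ℝ} (hY : CutAt ρ y) {ζ κ : ℝ} (hζ : 0 < ζ) (hζρ : ζ ≤ ρ / 4)
    (hκ : 0 < κ) :
    ∀ᶠ ε in 𝓝[>] (0 : ℝ), ∀ (X : Type u) [MetricSpace X] (x : X) (hX : CutAt ρ x)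
      (C : Set (X × Y)), PointedCorr x y C ε → ∀ a b a' b', (a', a) ∈ C → (b', b) ∈ C →
      ζ ≤ dist a' x → ζ ≤ dist b' x →
      |cutDist hX.isRGraph hX.mem_conn a' b' - cutDist hY.isRGraph hY.mem_conn a b| ≤ κ := by
  have hρ : 0 < ρ := by linarith
  obtain ⟨D, hD0, hD⟩ := exists_cutDist_le hY.isRGraph hY.mem_conn (half_pos hζ)
  filter_upwards [cutDist_le_uniform.{u} hY.isRGraph hY.mem_conn (half_pos hζ) hκ,
    near_of_near.{u} ρ hY hζ (by linarith : ζ ≤ ρ / 2), eventually_mul_lt 8 hρ,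
    eventually_mul_lt 1 (half_pos hζ), self_mem_nhdsWithin,
    eventually_mul_lt (16 * (D + κ + κ / 2) / ρ + 3) (half_pos hκ)] with ε h1 h2 h3 h4 h0 h5
  intro X _ x hX C hC a b a' b' ha hb haζ hbζ
  have hε0 : 0 < ε := h0
  have haζ' : ζ / 2 ≤ dist a y := by linarith [(hC.base_le_add ha).1]
  have hbζ' : ζ / 2 ≤ dist b y := by linarith [(hC.base_le_add hb).1]
  have hup := h1 X x hX.isRGraph hX.mem_conn C hC a b a' b' ha hb haζ' hbζ'
  have hne : ∀ a : X, ζ ≤ dist a x → a ≠ x := by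
    rintro a ha rfl
    rw [dist_self] at ha
    linarith
  obtain ⟨N, p, -, rfl, rfl, hp, hsum⟩ := exists_chain hX.isRGraph hX.mem_conn (hne a' haζ)
    (hne b' hbζ) (lt_add_of_pos_right _ (half_pos hκ)) (show 0 < ρ / 8 by linarith)
  have hlow := (cutDist_le_of_chain hX hY hC hζ hζρ hε0 h3 (h2 X x hX C hC) N p a b ha hb hp
    haζ hbζ).1
  set T := ∑ i ∈ Finset.range N, dist (p i) (p (i + 1))
  have hT : T ≤ D + κ + κ / 2 := by linarith [hD a b haζ' hbζ']
  have h6 : ε * (16 * T / ρ + 3) ≤ ε * (16 * (D + κ + κ / 2) / ρ + 3) := by gcongr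
  rw [abs_le]
  constructor <;> linarith

/-- Every point of the punctured space is close, in the cut space, to points that are not close to
the marked point. -/
theorem CutAt.exists_far {X : Type u} [MetricSpace X] {x : X} {ρ ζ : ℝ} (hX : CutAt ρ x)
    (hζ : 0 < ζ) (hζρ : ζ < ρ) (p : X) (hp : p ≠ x) :
    ∃ m, ζ ≤ dist m x ∧ cutDist hX.isRGraph hX.mem_conn p m ≤ 2 * ζ := by
  rcases le_or_gt ζ (dist p x) with h | h
  · exact ⟨p, h, by rw [cutDist_self]; linarith⟩
  obtain ⟨v, w, hv, hw, hvw⟩ := exists_opposite hX.isRGraph hX.mem_conn.2.isPreconnected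
    hX.degree_eq.ge hX.nearTrans hζ hζρ
  have hfar : ∀ m, dist m x = ζ → Near x p m →
      ∃ m, ζ ≤ dist m x ∧ cutDist hX.isRGraph hX.mem_conn p m ≤ 2 * ζ := by
    intro m hm hn
    refine ⟨m, hm.ge, (cutDist_le_dist _ _ hn).trans ?_⟩
    linarith [dist_triangle_right p m x]
  have hne : ∀ m, dist m x = ζ → m ≠ x := by
    rintro m hm rfl
    rw [dist_self] at hm
    linarith
  have hb : ∀ m, dist m x ≤ ζ → m ∈ Metric.ball x ρ := fun m hm =>
    Metric.mem_ball.2 (by linarith)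
  obtain ⟨i, j, hij, hn⟩ := near_of_degree_le_two hX.isRGraph hX.degree_eq.le hX.nearTrans
    ![p, v, w] (by intro i; fin_cases i; exacts [hp, hne v hv, hne w hw])
    (by intro i; fin_cases i; exacts [hb p h.le, hb v hv.le, hb w hw.le])
  fin_cases i <;> fin_cases j <;> first
    | exact absurd hij (by decide) | exact hfar _ hv hn | exact hfar _ hw hn | exact absurd hn hvw

end Comparison

/-! ### Total variation and push-forwards -/

section TotalVariation

variable {α : Type*} [MeasurableSpace α] (μ ν : Measure α) [IsFiniteMeasure μ] [IsFiniteMeasure ν]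

theorem sub_toSignedMeasure_apply {A : Set α} (hA : MeasurableSet A) :
    (μ.toSignedMeasure - ν.toSignedMeasure) A = μ.real A - ν.real A := by
  rw [sub_apply, Measure.toSignedMeasure_apply_measurable hA,
    Measure.toSignedMeasure_apply_measurable hA]

/-- Together with `le_totalVariation_sub`: the total variation of `μ - ν` is the largest value of
`(μ - ν)(A) - (μ - ν)(Aᶜ)`. -/
theorem totalVariation_sub_le {K : ℝ}
    (h : ∀ A, MeasurableSet A → μ.real A - ν.real A - (μ.real Aᶜ - ν.real Aᶜ) ≤ K) :
    (μ.toSignedMeasure - ν.toSignedMeasure).totalVariation univ ≤ ENNReal.ofReal K := by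
  set s := μ.toSignedMeasure - ν.toSignedMeasure with hs
  obtain ⟨i, hi, h1, h2, h3, h4⟩ := s.toJordanDecomposition_spec
  have hp : s.toJordanDecomposition.posPart univ = ENNReal.ofReal (s i) := by
    rw [h3, SignedMeasure.toMeasureOfZeroLE_apply _ _ hi MeasurableSet.univ]
    simp only [inter_univ]
    rw [ENNReal.ofReal, ENNReal.coe_inj]
    exact (Real.toNNReal_of_nonneg _).symm
  have hn : s.toJordanDecomposition.negPart univ = ENNReal.ofReal (-s iᶜ) := by
    rw [h4, SignedMeasure.toMeasureOfLEZero_apply _ _ hi.compl MeasurableSet.univ]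
    simp only [inter_univ]
    rw [ENNReal.ofReal, ENNReal.coe_inj]
    exact (Real.toNNReal_of_nonneg _).symm
  have k1 : 0 ≤ s i := s.nonneg_of_zero_le_restrict h1
  have k2 : s iᶜ ≤ 0 := s.nonpos_of_restrict_le_zero h2
  rw [SignedMeasure.totalVariation, Measure.add_apply, hp, hn,
    ← ENNReal.ofReal_add k1 (by linarith)]
  refine ENNReal.ofReal_le_ofReal ?_
  have := h i hi
  rw [← sub_toSignedMeasure_apply μ ν hi, ← sub_toSignedMeasure_apply μ ν hi.compl] at this
  linarith

theorem le_totalVariation_sub {A : Set α} (hA : MeasurableSet A) :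
    μ.real A - ν.real A - (μ.real Aᶜ - ν.real Aᶜ) ≤
      ((μ.toSignedMeasure - ν.toSignedMeasure).totalVariation univ).toReal := by
  rw [← sub_toSignedMeasure_apply μ ν hA, ← sub_toSignedMeasure_apply μ ν hA.compl]
  set s := μ.toSignedMeasure - ν.toSignedMeasure with hs
  set j := s.toJordanDecomposition with hj
  have h1 : ∀ A, MeasurableSet A → s A = j.posPart.real A - j.negPart.real A := by
    intro A hA
    rw [← sub_toSignedMeasure_apply _ _ hA]
    exact congrArg (fun t : SignedMeasure α => t A) s.toSignedMeasure_toJordanDecomposition.symm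
  have h2 : (s.totalVariation univ).toReal = j.posPart.real univ + j.negPart.real univ := by
    rw [SignedMeasure.totalVariation, Measure.add_apply,
      ENNReal.toReal_add (measure_ne_top _ _) (measure_ne_top _ _)]
    rfl
  rw [h1 A hA, h1 Aᶜ hA.compl, h2]
  have h3 := measureReal_mono (μ := j.posPart) (subset_univ A)
  have h4 := measureReal_mono (μ := j.negPart) (subset_univ Aᶜ)
  have h5 := measureReal_nonneg (μ := j.posPart) (s := Aᶜ)
  have h6 := measureReal_nonneg (μ := j.negPart) (s := A)
  linarith

/-- The total variation of a difference of measures does not increase under push-forward. The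
push-forwards `μ'` and `ν'` are given by their values. -/
theorem totalVariation_sub_le_of_map {β : Type*} [MeasurableSpace β] (μ' ν' : Measure β)
    [IsFiniteMeasure μ'] [IsFiniteMeasure ν'] {f : α → β} (hf : Measurable f)
    (hμ : ∀ A, MeasurableSet A → μ' A = μ (f ⁻¹' A))
    (hν : ∀ A, MeasurableSet A → ν' A = ν (f ⁻¹' A)) :
    (μ'.toSignedMeasure - ν'.toSignedMeasure).totalVariation univ ≤
      (μ.toSignedMeasure - ν.toSignedMeasure).totalVariation univ := by
  have hfin : (μ.toSignedMeasure - ν.toSignedMeasure).totalVariation univ ≠ ⊤ := by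
    rw [SignedMeasure.totalVariation, Measure.add_apply]
    exact ENNReal.add_ne_top.2 ⟨measure_ne_top _ _, measure_ne_top _ _⟩
  rw [← ENNReal.ofReal_toReal hfin]
  refine totalVariation_sub_le μ' ν' fun A hA => ?_
  simp only [measureReal_def, hμ A hA, hν A hA, hμ Aᶜ hA.compl, hν Aᶜ hA.compl, preimage_compl]
  exact le_totalVariation_sub μ ν (hf hA)

theorem measure_le_add_totalVariation {A : Set α} (hA : MeasurableSet A) :
    ν A ≤ μ A + (μ.toSignedMeasure - ν.toSignedMeasure).totalVariation univ := by
  have hsm : (μ.toSignedMeasure - ν.toSignedMeasure) A =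
      (μ.toSignedMeasure - ν.toSignedMeasure).toJordanDecomposition.posPart.real A -
        (μ.toSignedMeasure - ν.toSignedMeasure).toJordanDecomposition.negPart.real A := by
    rw [← sub_toSignedMeasure_apply _ _ hA]
    exact congrArg (fun t : SignedMeasure α => t A)
      (SignedMeasure.toSignedMeasure_toJordanDecomposition _).symm
  rw [sub_toSignedMeasure_apply μ ν hA] at hsm
  set j := (μ.toSignedMeasure - ν.toSignedMeasure).toJordanDecomposition with hj
  have h1 : ν.real A ≤ μ.real A + j.negPart.real A := by
    linarith [measureReal_nonneg (μ := j.posPart) (s := A)]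
  have h2 : ν A ≤ μ A + j.negPart A := by
    rw [← ENNReal.toReal_le_toReal (measure_ne_top _ _)
      (ENNReal.add_ne_top.2 ⟨measure_ne_top _ _, measure_ne_top _ _⟩),
      ENNReal.toReal_add (measure_ne_top _ _) (measure_ne_top _ _)]
    exact h1
  refine h2.trans (add_le_add le_rfl ((measure_mono (subset_univ A)).trans ?_))
  rw [SignedMeasure.totalVariation, Measure.add_apply]
  exact le_add_self

end TotalVariation

/-! ### The measure on the cut space -/

section CutMeasure

variable {X : Type u} [MetricSpace X] {x : X}

theorem denseRange_toCut (hX : IsRGraph X) (hx : x ∈ conn X) : DenseRange (toCut hX hx) :=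
  UniformSpace.Completion.denseRange_coe (α := PuncturedSpace hX hx)

theorem secondCountable_cutSpace (hX : IsRGraph X) (hx : x ∈ conn X) :
    SecondCountableTopology (CutSpace hX hx) := by
  have := hX.compact
  have : TopologicalSpace.SeparableSpace (CutSpace hX hx) :=
    (denseRange_toCut hX hx).separableSpace (continuous_toCut hX hx)
  exact UniformSpace.secondCountable_of_separable _

open Classical in
/-- The canonical map `X \ {x} → X_x`, extended to `X` by an arbitrary value at `x`. -/
noncomputable def toCutTotal (hX : IsRGraph X) (hx : x ∈ conn X) (p : X) : CutSpace hX hx :=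
  if h : p ≠ x then toCut hX hx ⟨p, h⟩ else toCut hX hx ⟨hx.2.nonempty.some, hx.2.nonempty.some_mem⟩

theorem toCutTotal_eq (hX : IsRGraph X) (hx : x ∈ conn X) (p : {p : X // p ≠ x}) :
    toCutTotal hX hx p = toCut hX hx p := dif_pos p.2

theorem dist_toCutTotal (hX : IsRGraph X) (hx : x ∈ conn X) {p q : X} (hp : p ≠ x) (hq : q ≠ x) :
    dist (toCutTotal hX hx p) (toCutTotal hX hx q) = cutDist hX hx p q := by
  rw [toCutTotal_eq hX hx ⟨p, hp⟩, toCutTotal_eq hX hx ⟨q, hq⟩]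
  exact (cutDist_eq hX hx ⟨p, hp⟩ ⟨q, hq⟩).symm

theorem measurable_toCutTotal [MeasurableSpace X] [BorelSpace X] (hX : IsRGraph X)
    (hx : x ∈ conn X) : Measurable (toCutTotal hX hx) := by
  refine measurable_of_continuousOn_compl_singleton x ?_
  rw [continuousOn_iff_continuous_domRestrict]
  exact (continuous_toCut hX hx).congr fun p => (toCutTotal_eq hX hx p).symm

theorem cutMeasure_apply [MeasurableSpace X] [BorelSpace X] (hX : IsRGraph X) (hx : x ∈ conn X)
    (μ : Measure X) (hμ : μ {x} = 0) {A : Set (CutSpace hX hx)} (hA : MeasurableSet A) :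
    cutMeasure hX hx μ A = μ (toCutTotal hX hx ⁻¹' A) := by
  have hm : MeasurableSet {y : X | y ≠ x} := (measurableSet_singleton x).compl
  have h1 : cutMeasure hX hx μ A = μ (Subtype.val '' (toCut hX hx ⁻¹' A)) := by
    rw [cutMeasure, Measure.map_apply (continuous_toCut hX hx).measurable hA]
    exact (MeasurableEmbedding.subtype_coe hm).comap_apply μ _
  rw [h1]
  refine le_antisymm (measure_mono ?_) ?_
  · rintro _ ⟨p, hp, rfl⟩
    rw [mem_preimage, toCutTotal_eq]
    exact hp
  · have h2 : toCutTotal hX hx ⁻¹' A ⊆ Subtype.val '' (toCut hX hx ⁻¹' A) ∪ {x} := by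
      intro p hp
      by_cases h : p = x
      · exact Or.inr h
      · refine Or.inl ⟨⟨p, h⟩, ?_, rfl⟩
        rw [mem_preimage, ← toCutTotal_eq]
        exact hp
    refine (measure_mono h2).trans ((measure_union_le _ _).trans ?_)
    rw [hμ, add_zero]

/-- The images of the points that are at distance at least `ζ` from the marked point form a
`2 ζ`-net of the cut space, up to an arbitrarily small error. -/
theorem CutAt.exists_far_near {ρ ζ : ℝ} (hX : CutAt ρ x) (hζ : 0 < ζ) (hζρ : ζ < ρ)
    (a : CutSpace hX.isRGraph hX.mem_conn) {t : ℝ} (ht : 2 * ζ < t) :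
    ∃ m, ζ ≤ dist m x ∧ dist a (toCutTotal hX.isRGraph hX.mem_conn m) < t := by
  obtain ⟨_, hp, ⟨p, rfl⟩⟩ := Metric.dense_iff.1 (denseRange_toCut hX.isRGraph hX.mem_conn) a
    (t - 2 * ζ) (by linarith)
  rw [Metric.mem_ball, dist_comm] at hp
  obtain ⟨m, hm, hpm⟩ := hX.exists_far hζ hζρ p p.2
  have hmx : m ≠ x := by
    rintro rfl
    rw [dist_self] at hm
    linarith
  refine ⟨m, hm, ?_⟩
  rw [← dist_toCutTotal _ _ p.2 hmx, toCutTotal_eq] at hpm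
  linarith [dist_triangle a (toCut hX.isRGraph hX.mem_conn p)
    (toCutTotal hX.isRGraph hX.mem_conn m)]

end CutMeasure

/-! ### Convergence of the cut spaces -/

section Convergence

/-- The correspondence between cut spaces induced by a correspondence `C`: the pairs of points that
are at distance less than `t` from corresponding points at distance at least `ζ` from the first
marked point. It is open, hence measurable. -/
def cutCorr {X : Type u} {Y : Type v} [MetricSpace X] [MetricSpace Y] {x : X} {y : Y}
    (hX : IsRGraph X) (hx : x ∈ conn X) (hY : IsRGraph Y) (hy : y ∈ conn Y) (C : Set (X × Y))
    (ζ t : ℝ) : Set (CutSpace hX hx × CutSpace hY hy) :=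
  ⋃ a ∈ {a : X × Y | a ∈ C ∧ ζ ≤ dist a.1 x},
    Metric.ball (toCutTotal hX hx a.1) t ×ˢ Metric.ball (toCutTotal hY hy a.2) t

theorem distortion_le {X : Type u} {Y : Type v} [MetricSpace X] [MetricSpace Y]
    {C : Set (X × Y)} {ε : ℝ} (h : ∀ a ∈ C, ∀ b ∈ C, |dist a.1 b.1 - dist a.2 b.2| ≤ ε) :
    distortion C ≤ ENNReal.ofReal ε :=
  iSup₂_le fun a ha => iSup₂_le fun b hb => ENNReal.ofReal_le_ofReal (h a ha b hb)

theorem PointedCorr.of_distortion {X : Type u} {Y : Type v} [MetricSpace X] [MetricSpace Y]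
    [MeasurableSpace X] [MeasurableSpace Y] {x : X} {y : Y} {C : Set (X × Y)} {ε : ℝ}
    (hε : 0 ≤ ε) (hC : IsCorrespondence C) (hxy : (x, y) ∈ C)
    (h : distortion C ≤ ENNReal.ofReal ε) : PointedCorr x y C ε := by
  refine ⟨hxy, hC.exists_right, hC.exists_left, fun p q p' q' hp hp' => ?_⟩
  rw [← ENNReal.ofReal_le_ofReal_iff hε]
  refine le_trans ?_ h
  exact le_iSup₂_of_le (p, q) hp (le_iSup₂_of_le (p', q') hp' le_rfl)

/-- A bound for the Gromov--Hausdorff--Prokhorov distance between cut spaces, in terms of a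
correspondence and a measure on the product of the original spaces. -/
theorem ghpDist_cut_le {X : Type u} {Y : Type v} [MetricSpace X] [MetricSpace Y]
    [MeasurableSpace X] [BorelSpace X] [MeasurableSpace Y] [BorelSpace Y] {x : X} {y : Y} {ρ : ℝ}
    (hX : CutAt ρ x) (hY : CutAt ρ y) (μ : Measure X) [IsFiniteMeasure μ] (ν : Measure Y)
    [IsFiniteMeasure ν] (hμ : μ {x} = 0) (hν : ν {y} = 0) {κ ζ ε : ℝ} {C : Set (X × Y)}
    (hC : PointedCorr x y C ε) (π : FiniteMeasure (X × Y)) (hζ : 0 < ζ) (hζρ : 2 * ζ < ρ)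
    (hζκ : 100 * ζ < κ) (hεζ : 2 * ε < ζ)
    (hcut : ∀ a b a' b', (a', a) ∈ C → (b', b) ∈ C → ζ ≤ dist a' x → ζ ≤ dist b' x →
      |cutDist hX.isRGraph hX.mem_conn a' b' - cutDist hY.isRGraph hY.mem_conn a b| ≤ κ / 4)
    (hdisc : discrepancy (π : Measure (X × Y)) μ ν ≤ ENNReal.ofReal (κ / 4))
    (hπ : (π : Measure (X × Y)) Cᶜ ≤ ENNReal.ofReal (κ / 4))
    (hνball : ν (Metric.ball y (2 * ζ)) ≤ ENNReal.ofReal (κ / 4)) :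
    ghpDist (cutMeasure hX.isRGraph hX.mem_conn μ) (cutMeasure hY.isRGraph hY.mem_conn ν) ≤
      ENNReal.ofReal κ := by
  have hκ : 0 < κ := by linarith
  set τX := toCutTotal hX.isRGraph hX.mem_conn with hτX
  set τY := toCutTotal hY.isRGraph hY.mem_conn with hτY
  have mX : Measurable τX := measurable_toCutTotal _ _
  have mY : Measurable τY := measurable_toCutTotal _ _
  set C' := cutCorr hX.isRGraph hX.mem_conn hY.isRGraph hY.mem_conn C ζ (κ / 8) with hC'
  have hmem : ∀ a b, (a, b) ∈ C' ↔ ∃ p q, (p, q) ∈ C ∧ ζ ≤ dist p x ∧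
      dist a (τX p) < κ / 8 ∧ dist b (τY q) < κ / 8 := by
    intro a b
    simp only [hC', cutCorr, mem_iUnion, mem_prod, Metric.mem_ball, exists_prop, mem_ofPred_eq]
    constructor
    · rintro ⟨⟨p, q⟩, ⟨h1, h2⟩, h3, h4⟩
      exact ⟨p, q, h1, h2, h3, h4⟩
    · rintro ⟨p, q, h1, h2, h3, h4⟩
      exact ⟨⟨p, q⟩, ⟨h1, h2⟩, h3, h4⟩
  have hmeas : MeasurableSet C' := by
    have := secondCountable_cutSpace hX.isRGraph hX.mem_conn
    exact IsOpen.measurableSet (isOpen_biUnion fun a _ => Metric.isOpen_ball.prod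
      Metric.isOpen_ball)
  have hcorr : IsCorrespondence C' := by
    refine ⟨hmeas, fun a => ?_, fun b => ?_⟩
    · obtain ⟨m, hm, ham⟩ := hX.exists_far_near hζ (by linarith) a (t := κ / 8) (by linarith)
      obtain ⟨q, hq⟩ := hC.exists_right m
      exact ⟨τY q, (hmem _ _).2 ⟨m, q, hq, hm, ham, by rw [dist_self]; linarith⟩⟩
    · obtain ⟨q, hq, hbq⟩ := hY.exists_far_near (ζ := 2 * ζ) (by linarith) hζρ b (t := κ / 8)
        (by linarith)
      obtain ⟨m, hm⟩ := hC.exists_left q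
      have := (hC.base_le_add hm).2
      exact ⟨τX m, (hmem _ _).2 ⟨m, q, hm, by linarith, by rw [dist_self]; linarith, hbq⟩⟩
  have hdist : distortion C' ≤ ENNReal.ofReal κ := by
    refine distortion_le ?_
    rintro ⟨a, b⟩ hab ⟨a', b'⟩ hab'
    obtain ⟨p, q, h1, h2, h3, h4⟩ := (hmem a b).1 hab
    obtain ⟨p', q', h1', h2', h3', h4'⟩ := (hmem a' b').1 hab'
    have hneX : ∀ p, ζ ≤ dist p x → p ≠ x := by
      rintro p hp rfl
      rw [dist_self] at hp
      linarith
    have hneY : ∀ p q, (p, q) ∈ C → ζ ≤ dist p x → q ≠ y := by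
      rintro p q hpq hp rfl
      have := (hC.base_le_add hpq).1
      rw [dist_self] at this
      linarith
    have h5 := hcut q q' p p' h1 h1' h2 h2'
    rw [← dist_toCutTotal _ _ (hneX p h2) (hneX p' h2'),
      ← dist_toCutTotal _ _ (hneY p q h1 h2) (hneY p' q' h1' h2')] at h5
    rw [← hτX, ← hτY, abs_le] at h5
    rw [abs_le]
    have h6 := dist_triangle4 a (τX p) (τX p') a'
    have h7 := dist_triangle4 (τX p) a a' (τX p')
    have h8 := dist_triangle4 b (τY q) (τY q') b'
    have h9 := dist_triangle4 (τY q) b b' (τY q')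
    rw [dist_comm (τX p') a'] at h6
    rw [dist_comm (τX p) a] at h7
    rw [dist_comm (τY q') b'] at h8
    rw [dist_comm (τY q) b] at h9
    constructor <;> linarith [h5.1, h5.2]
  have mXY : Measurable (Prod.map τX τY) := mX.prodMap mY
  let π' : FiniteMeasure (CutSpace hX.isRGraph hX.mem_conn × CutSpace hY.isRGraph hY.mem_conn) :=
    π.map (Prod.map τX τY)
  have hπ' : ∀ A, MeasurableSet A →
      (π' : Measure _) A = (π : Measure (X × Y)) (Prod.map τX τY ⁻¹' A) := fun A hA =>
    Measure.map_apply mXY hA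
  have hdisc' : discrepancy (π' : Measure _) (cutMeasure hX.isRGraph hX.mem_conn μ)
      (cutMeasure hY.isRGraph hY.mem_conn ν) ≤ discrepancy (π : Measure (X × Y)) μ ν := by
    refine add_le_add ?_ ?_
    · refine totalVariation_sub_le_of_map _ _ _ _ mX
        (fun A hA => cutMeasure_apply _ _ μ hμ hA) fun A hA => ?_
      rw [Measure.map_apply measurable_fst hA, hπ' _ (measurable_fst hA),
        Measure.map_apply measurable_fst (mX hA)]
      rfl
    · refine totalVariation_sub_le_of_map _ _ _ _ mY
        (fun A hA => cutMeasure_apply _ _ ν hν hA) fun A hA => ?_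
      rw [Measure.map_apply measurable_snd hA, hπ' _ (measurable_snd hA),
        Measure.map_apply measurable_snd (mY hA)]
      rfl
  have hcompl : (π' : Measure _) C'ᶜ ≤ ENNReal.ofReal κ := by
    rw [hπ' _ hmeas.compl]
    have hsub : Prod.map τX τY ⁻¹' C'ᶜ ⊆ Cᶜ ∪ Prod.snd ⁻¹' Metric.ball y (2 * ζ) := by
      rintro ⟨p, q⟩ hpq
      by_contra hcon
      rw [mem_union, not_or, mem_compl_iff, not_not, mem_preimage, Metric.mem_ball, not_lt] at hcon
      obtain ⟨h1, h2⟩ := hcon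
      have h3 := (hC.base_le_add h1).2
      simp only at h2
      exact hpq ((hmem _ _).2 ⟨p, q, h1, by linarith,
        (dist_self (τX p)).trans_lt (by linarith),
        (dist_self (τY q)).trans_lt (by linarith)⟩)
    have h1 : (π : Measure (X × Y)) (Prod.snd ⁻¹' Metric.ball y (2 * ζ)) ≤
        ENNReal.ofReal (κ / 4) + ENNReal.ofReal (κ / 4) := by
      rw [← Measure.map_apply measurable_snd measurableSet_ball]
      refine (measure_le_add_totalVariation ν _ measurableSet_ball).trans (add_le_add hνball ?_)
      refine le_trans ?_ hdisc
      exact le_add_self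
    calc (π : Measure (X × Y)) (Prod.map τX τY ⁻¹' C'ᶜ)
        ≤ ENNReal.ofReal (κ / 4) + (ENNReal.ofReal (κ / 4) + ENNReal.ofReal (κ / 4)) :=
          (measure_mono hsub).trans ((measure_union_le _ _).trans (add_le_add hπ h1))
      _ ≤ ENNReal.ofReal κ := by
          rw [← ENNReal.ofReal_add (by positivity) (by positivity),
            ← ENNReal.ofReal_add (by positivity) (by positivity)]
          exact ENNReal.ofReal_le_ofReal (by linarith)
  refine iInf₂_le_of_le C' hcorr (iInf_le_of_le π' (max_le ?_ (max_le ?_ hcompl)))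
  · exact ENNReal.half_le_self.trans hdist
  · exact (hdisc'.trans hdisc).trans (ENNReal.ofReal_le_ofReal (by linarith))

theorem exists_measure_ball_le {Y : Type v} [MetricSpace Y] [MeasurableSpace Y] [BorelSpace Y]
    (y : Y) (ν : Measure Y) [IsFiniteMeasure ν] (hν : ν {y} = 0) {κ : ℝ} (hκ : 0 < κ) :
    ∀ᶠ ζ in 𝓝[>] (0 : ℝ), ν (Metric.ball y (2 * ζ)) ≤ ENNReal.ofReal κ := by
  have h1 := tendsto_measure_cthickening_of_isClosed (μ := ν) (s := {y})
    ⟨1, one_pos, measure_ne_top _ _⟩ isClosed_singleton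
  rw [hν] at h1
  have h2 : Tendsto (fun ζ : ℝ => 2 * ζ) (𝓝[>] 0) (𝓝 0) := by
    have : Tendsto (fun ζ : ℝ => 2 * ζ) (𝓝[>] 0) (𝓝 (2 * 0)) :=
      ((continuous_const.mul continuous_id).tendsto 0).mono_left nhdsWithin_le_nhds
    rwa [mul_zero] at this
  filter_upwards [(h1.comp h2).eventually (gt_mem_nhds (ENNReal.ofReal_pos.2 hκ)),
    self_mem_nhdsWithin] with ζ h3 h4
  refine le_trans (measure_mono ?_) h3.le
  have h5 : (0 : ℝ) < ζ := h4
  simp only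
  rw [Metric.cthickening_singleton _ (by linarith)]
  exact Metric.ball_subset_closedBall

end Convergence

end RGraphs

theorem theorem7p1 {r : ℝ} (hr : r ∈ Set.Ioo (0 : ℝ) 1)
    {X : ℕ → Type*} [∀ n, MetricSpace (X n)] [∀ n, MeasurableSpace (X n)] [∀ n, BorelSpace (X n)]
    (x : ∀ n, X n) (μ : ∀ n, Measure (X n)) [∀ n, IsFiniteMeasure (μ n)]
    {Y : Type*} [MetricSpace Y] [MeasurableSpace Y] [BorelSpace Y]
    (y : Y) (ν : Measure Y) [IsFiniteMeasure ν]
    (hXr : ∀ n, IsElliptic r (X n)) (hX : ∀ n, IsSafelyPointed (x n) (μ n))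
    (hYr : IsElliptic r Y) (hY : IsSafelyPointed y ν)
    (hlim : Tendsto (fun n => pointedGhpDist (x n) (μ n) y ν) atTop (𝓝 0)) :
    Tendsto (fun n => ghpDist (cutMeasure (hX n).isRGraph (hX n).mem_conn (μ n))
      (cutMeasure hY.isRGraph hY.mem_conn ν)) atTop (𝓝 0) := by
  have hr0 : 0 < r := hr.1
  have hXc : ∀ n, CutAt (r / 6) (x n) := fun n =>
    ⟨(hX n).isRGraph, (hX n).mem_conn, (hX n).degree_eq, (hXr n).nearTrans _⟩
  have hYc : CutAt (r / 6) y := ⟨hY.isRGraph, hY.mem_conn, hY.degree_eq, hYr.nearTrans _⟩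
  rw [ENNReal.tendsto_nhds_zero]
  intro e he
  obtain ⟨κ, hκ, hκe⟩ : ∃ κ : ℝ, 0 < κ ∧ ENNReal.ofReal κ ≤ e := by
    have h1 : min e 1 ≠ ⊤ := ne_top_of_le_ne_top ENNReal.one_ne_top (min_le_right _ _)
    refine ⟨(min e 1).toReal, ENNReal.toReal_pos (lt_min he one_pos).ne' h1, ?_⟩
    rw [ENNReal.ofReal_toReal h1]
    exact min_le_left _ _
  obtain ⟨ζ, hζν, hζκ, hζr, hζ⟩ := ((exists_measure_ball_le y ν hY.measure_eq_zero
    (show 0 < κ / 4 by linarith)).and ((eventually_mul_lt 100 hκ).and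
    ((eventually_mul_lt 4 (show 0 < r / 6 by linarith)).and self_mem_nhdsWithin))).exists
  have hζ0 : 0 < ζ := hζ
  obtain ⟨ε, hεcut, hεζ, hεκ, hε⟩ := ((abs_cutDist_sub_le hYc hζ0 (by linarith)
    (show 0 < κ / 4 by linarith)).and ((eventually_mul_lt 2 hζ0).and
    ((eventually_mul_lt 1 (show 0 < κ / 4 by linarith)).and self_mem_nhdsWithin))).exists
  have hε0 : 0 < ε := hε
  filter_upwards [hlim.eventually (gt_mem_nhds (ENNReal.ofReal_pos.2 (half_pos hε0)))] with n hn
  unfold pointedGhpDist at hn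
  simp only [iInf_lt_iff, max_lt_iff] at hn
  obtain ⟨C, hC, hxy, π, h1, h2, h3⟩ := hn
  have hle : ENNReal.ofReal (ε / 2) ≤ ENNReal.ofReal (κ / 4) :=
    ENNReal.ofReal_le_ofReal (by linarith)
  have hdist : distortion C ≤ ENNReal.ofReal ε := by
    refine ((ENNReal.div_le_iff two_ne_zero ENNReal.ofNat_ne_top).1 h1.le).trans_eq ?_
    rw [mul_two, ← ENNReal.ofReal_add (by linarith) (by linarith), add_halves]
  have hpc : PointedCorr (x n) y C ε := PointedCorr.of_distortion hε0.le hC hxy hdist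
  exact (ghpDist_cut_le (hXc n) hYc (μ n) ν (hX n).measure_eq_zero hY.measure_eq_zero hpc π hζ0
    (by linarith) hζκ hεζ (hεcut (X n) (x n) (hXc n) C hpc) (h2.le.trans hle) (h3.le.trans hle)
    hζν).trans hκe
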